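/- Let $d\ge 0$, and let $e_1,\dots,e_d$ be the standard basis of $\mathbb{R}^d$. For $J\subseteq[d]=\{1,\dots,d\}$ let $\mathbb{R}^J$ be the span of the $e_j$, $j\in J$. A polytope is a non-empty compact intersection of finitely many half-spaces. Its faces are $\emptyset$ and the sets of maximizers over it of linear functionals, with $\dim\emptyset=-1$. A flag of $P$ is a chain $F_{-1}\subsetneq F_0\subsetneq\dots\subsetneq F_{\dim P}$ of faces of $P$ with $\dim F_i=i$. A polytope $P\subset\mathbb{R}^d$ is called locally anti-blocking if for every $J\subseteq[d]$ the orthogonal projection of $P$ onto $\mathbb{R}^J$ equals $P\cap\mathbb{R}^J$; normalized if $\max_{x\in P}\langle x,\pm e_i\rangle=1$ for all $i\in[d]$ and both signs; and flag-minimizing if it has exactly $2^d\cdot d!$ flags. Let $P\subset\mathbb{R}^d$ be a flag-minimizing normalized locally anti-blocking polytope. Then: (1) For all $i\ne j$, the section $P\cap\mathbb{R}^{\{i,j\}}$ is either axis-aligned, that is, a product of two segments $[a_1,b_1]\times[a_2,b_2]$ in the coordinate axes with $a_1,a_2<0<b_1,b_2$, or a diamond, that is, the convex hull of two such segments. Thus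 the graph $G(P)$ on the vertex set $[d]$, in which $\{i,j\}$ is an edge if and only if $P\cap\mathbb{R}^{\{i,j\}}$ is axis-aligned, is defined. (2) $P=\operatorname{conv}\{1_D\}$, where $D$ runs over all cones positively spanned by a subset $J_D\subseteq\{\pm e_1,\dots,\pm e_d\}$ that does not contain both $e_i$ and $-e_i$ for any $i$, such that $D\subseteq\mathbb{R}^J$ for some (possibly empty) clique $J\subseteq[d]$ of $G(P)$, and where $1_D=\sum_{v\in J_D}v$. (3) $P$ is determined by $G(P)$: if $Q\subset\mathbb{R}^d$ is another flag-minimizing normalized locally anti-blocking polytope with $G(Q)=G(P)$, then $Q=P$. (4) All vertices of $P$ lie in $\{0,1,-1\}^d$. -/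

import Mathlib

open scoped RealInnerProductSpace

noncomputable section

namespace FlagPolytope

/-- Euclidean space `ℝ^d`; its coordinates are indexed by `Fin d`. -/
abbrev E (d : ℕ) : Type := EuclideanSpace ℝ (Fin d)

/-- The standard basis vector `e_i`. -/
def e {d : ℕ} (i : Fin d) : E d := EuclideanSpace.single i 1

/-- The coordinate subspace `ℝ^J`, spanned by the `e_j` with `j ∈ J`. -/
def coordSubspace {d : ℕ} (J : Set (Fin d)) : Submodule ℝ (E d) :=
  Submodule.span ℝ (e '' J)

/-- A polyhedron is the intersection of finitely many closed half-spaces. -/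
def IsPolyhedron {d : ℕ} (P : Set (E d)) : Prop :=
  ∃ H : Finset (E d × ℝ), P = {x | ∀ h ∈ H, ⟪h.1, x⟫ ≤ h.2}

/-- A polytope is a (non-empty) compact polyhedron. -/
structure IsPolytope {d : ℕ} (P : Set (E d)) : Prop where
  nonempty : P.Nonempty
  isCompact : IsCompact P
  isPolyhedron : IsPolyhedron P

/-- `P` is locally anti-blocking: for every coordinate subspace `H`, the orthogonal projection
of `P` onto `H` is equal to `P ∩ H`. -/
def IsLocallyAntiBlocking {d : ℕ} (P : Set (E d)) : Prop :=
  ∀ J : Set (Fin d),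
    (fun x => (coordSubspace J).starProjection x) '' P = P ∩ (coordSubspace J : Set (E d))

/-- `P` is normalized: `max_{x ∈ P} ⟪x, ± e_i⟫ = 1` for all `i` and both signs. -/
def IsNormalized {d : ℕ} (P : Set (E d)) : Prop :=
  ∀ i : Fin d, IsGreatest ((fun x => ⟪x, e i⟫) '' P) 1 ∧ IsGreatest ((fun x => ⟪x, -e i⟫) '' P) 1

/-- The faces of `P`: the empty set, and the sets of maximizers over `P` of a linear functional
(the zero functional gives `P` itself). -/
def faces {d : ℕ} (P : Set (E d)) : Set (Set (E d)) :=
  {F | IsExposed ℝ P F}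

open Classical in
/-- The dimension of the affine span of a set, with the convention that `∅` has dimension `-1`. -/
def dim {d : ℕ} (F : Set (E d)) : ℤ :=
  if F = ∅ then -1 else (Module.finrank ℝ (vectorSpan ℝ F) : ℤ)

/-- The `k`-dimensional faces of `P`. -/
def facesOfDim {d : ℕ} (P : Set (E d)) (k : ℤ) : Set (Set (E d)) :=
  {F | F ∈ faces P ∧ dim F = k}

/-- The (full) flags `F_{-1} ⊊ F_0 ⊊ ⋯ ⊊ F_{dim P}` of `P`, where `F_i` is an
`i`-dimensional face of `P`. -/
def flags {d : ℕ} (P : Set (E d)) : Set (Set.Icc (-1 : ℤ) (dim P) → Set (E d)) :=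
  {F | (∀ i : Set.Icc (-1 : ℤ) (dim P), F i ∈ facesOfDim P i) ∧ StrictMono F}

/-- `P ⊆ ℝ^d` has exactly `2^d · d!` flags. -/
def IsFlagMinimizing {d : ℕ} (P : Set (E d)) : Prop :=
  (flags P).ncard = 2 ^ d * d.factorial

/-- The vertices of `P`, i.e. the points that form a zero-dimensional face of `P`. -/
def vertices {d : ℕ} (P : Set (E d)) : Set (E d) :=
  {v | {v} ∈ facesOfDim P 0}

/-- The section of `P` by the coordinate plane `ℝ^{i,j}` is a product `[a₁,b₁] × [a₂,b₂]` of two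
segments in the coordinate axes with `0` in their relative interiors. -/
def IsAxisAligned {d : ℕ} (P : Set (E d)) (i j : Fin d) : Prop :=
  ∃ a₁ b₁ a₂ b₂ : ℝ, a₁ < 0 ∧ 0 < b₁ ∧ a₂ < 0 ∧ 0 < b₂ ∧
    P ∩ (coordSubspace {i, j} : Set (E d)) =
      {x | ∃ s ∈ Set.Icc a₁ b₁, ∃ t ∈ Set.Icc a₂ b₂, x = s • e i + t • e j}

/-- The section of `P` by the coordinate plane `ℝ^{i,j}` is the convex hull of two
segments in the coordinate axes with `0` in their relative interiors. -/
def IsDiamond {d : ℕ} (P : Set (E d)) (i j : Fin d) : Prop :=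
  ∃ a₁ b₁ a₂ b₂ : ℝ, a₁ < 0 ∧ 0 < b₁ ∧ a₂ < 0 ∧ 0 < b₂ ∧
    P ∩ (coordSubspace {i, j} : Set (E d)) =
      convexHull ℝ ({x | ∃ s ∈ Set.Icc a₁ b₁, x = s • e i} ∪ {x | ∃ t ∈ Set.Icc a₂ b₂, x = t • e j})

theorem IsAxisAligned.symm {d : ℕ} {P : Set (E d)} {i j : Fin d} (h : IsAxisAligned P i j) :
    IsAxisAligned P j i := by
  obtain ⟨a₁, b₁, a₂, b₂, h1, h2, h3, h4, h5⟩ := h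
  refine ⟨a₂, b₂, a₁, b₁, h3, h4, h1, h2, ?_⟩
  rw [Set.pair_comm, h5]
  ext x
  constructor
  · rintro ⟨s, hs, t, ht, rfl⟩
    exact ⟨t, ht, s, hs, add_comm _ _⟩
  · rintro ⟨s, hs, t, ht, rfl⟩
    exact ⟨t, ht, s, hs, add_comm _ _⟩

/-- The condition under which the graph of `P` is defined: each section by a coordinate plane
is axis-aligned or a diamond. -/
def HasGraph {d : ℕ} (P : Set (E d)) : Prop :=
  ∀ i j : Fin d, i ≠ j → IsAxisAligned P i j ∨ IsDiamond P i j

/-- The graph `G(P)` on the coordinate indices: `{i, j}` is an edge if and only if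
the section of `P` by `ℝ^{i,j}` is axis-aligned. -/
def graph {d : ℕ} (P : Set (E d)) : SimpleGraph (Fin d) where
  Adj i j := i ≠ j ∧ IsAxisAligned P i j
  symm := ⟨fun _ _ h => ⟨h.1.symm, h.2.symm⟩⟩
  loopless := ⟨fun _ h => h.1 rfl⟩

/-- The cones of the standard fan, positively spanned by a set of vectors `± e_i` which
does not contain both `e_i` and `-e_i` for any `i`. Such a set is encoded by `s : Fin d → {0, 1, -1}`:
it consists of the vectors `s i • e_i` with `s i ≠ 0`. -/
def orthantCone {d : ℕ} (s : Fin d → SignType) : PointedCone ℝ (E d) :=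
  PointedCone.hull ℝ {v | ∃ i, s i ≠ 0 ∧ v = (s i : ℝ) • e i}

/-- The vector `1_D`, the sum of the generators `± e_i` of the orthant cone `D`
(a zero sign contributes nothing). -/
def oneVec {d : ℕ} (s : Fin d → SignType) : E d :=
  ∑ i, (s i : ℝ) • e i

/-- The convex hull `C(G)` of the vectors `1_D` over all orthant cones `D` that are contained in
`ℝ^J` for some clique `J` of `G`. -/
def cliqueHull {d : ℕ} (G : SimpleGraph (Fin d)) : Set (E d) :=
  convexHull ℝ {v | ∃ s : Fin d → SignType,
    (∃ J : Set (Fin d), G.IsClique J ∧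
      (orthantCone s : Set (E d)) ⊆ (coordSubspace J : Set (E d))) ∧ v = oneVec s}

end FlagPolytope

end

namespace FlagPolytope

variable {d n : ℕ}

/-! ### Polyhedra and their faces -/

/-! Let `P` be a locally anti-blocking polytope with the origin in its interior relative to an
`n`-dimensional coordinate subspace. For each coordinate `k`, a non-empty face is parallel to the
`k`-th axis (high), contained in the hyperplane `x k = 0` (low), or has a well-defined sign. Along a
full chain of faces a coordinate is first low, then signed, then high. So the columns of the `n × n`
matrix of signs of the proper faces are, up to sign, indicators of intervals, and its determinant is
0, 1 or -1 (`abs_det_signMatrix_le`). A chain also has an orientation, which is reversed when a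
single proper face is exchanged (`orient_adjacent`).

The weight of a chain is its orientation times this determinant. The sum of all weights is always `±
2 ^ n * n!` (`abs_sum_weight`), by induction on `n`. Some column of a sign matrix is constant, so
the cofactor expansion along the last column can be rewritten until its `m`-th term ignores the
`m`-th face, except through the orientation. Exchanging that face then cancels everything but the
chains in which the `m`-th face alone has a sign in the last coordinate (`sum_term`). These chains
are the chains of the section by the last coordinate hyperplane, each lifted once to either side,
and each counts `n + 1` times.

Hence there are at least `2 ^ n * n!` chains, and if there are no more, every sign matrix is
invertible (`IsLAB.det_ne_zero`). This property passes to coordinate sections. It implies that a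
vertex and the functional of a facet through it share at most one coordinate, since each shared
coordinate yields a constant column and two such columns are proportional
(`IsNonsingular.eq_of_ne_zero`). It follows that a vertex is extremal in every coordinate of its
support (`IsNonsingular.vertex_mul_le`), so after normalization vertices have coordinates 0, 1, -1.

In a plane section one corner of the square forces the others (`corner_neg`), so the section is a
square or a diamond. By induction on the size of a clique, all sign vectors on it lie in `P`
(`mem_of_isClique`); conversely, projecting a vertex to pairs of coordinates shows that its support
is a clique. So `P` is the clique hull of its graph. -/

theorem IsPolyhedron.convex {P : Set (E d)} (hP : IsPolyhedron P) : Convex ℝ P := by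
  obtain ⟨H, rfl⟩ := hP
  intro x hx y hy a b ha hb hab h hh
  have h1 := mul_le_mul_of_nonneg_left (hx h hh) ha
  have h2 := mul_le_mul_of_nonneg_left (hy h hh) hb
  rw [inner_add_right, inner_smul_right, inner_smul_right]
  calc _ ≤ a * h.2 + b * h.2 := add_le_add h1 h2
    _ = h.2 := by rw [← add_mul, hab, one_mul]

/-- A direction that does not increase the constraints active at `z` is feasible at `z`. -/
theorem exists_pos_add_smul_mem (H : Finset (E d × ℝ)) {z w : E d}
    (hz : ∀ h ∈ H, ⟪h.1, z⟫ ≤ h.2) (hw : ∀ h ∈ H, ⟪h.1, z⟫ = h.2 → ⟪h.1, w⟫ ≤ 0) :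
    ∃ η > (0 : ℝ), ∀ h ∈ H, ⟪h.1, z + η • w⟫ ≤ h.2 := by
  have key : ∀ᶠ η in nhdsWithin (0 : ℝ) (Set.Ioi 0), ∀ h ∈ H, ⟪h.1, z + η • w⟫ ≤ h.2 := by
    rw [Filter.eventually_all_finset]
    intro h hh
    rcases (hz h hh).eq_or_lt with heq | hlt
    · filter_upwards [self_mem_nhdsWithin] with η hη
      rw [inner_add_right, inner_smul_right, heq]
      have := mul_nonpos_of_nonneg_of_nonpos (le_of_lt hη) (hw h hh heq)
      linarith
    · have hc : Continuous fun η : ℝ => ⟪h.1, z + η • w⟫ := by fun_prop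
      have ht : Filter.Tendsto (fun η : ℝ => ⟪h.1, z + η • w⟫) (nhds 0) (nhds ⟪h.1, z⟫) := by
        simpa using hc.tendsto 0
      exact Filter.Eventually.mono (nhdsWithin_le_nhds (ht.eventually (gt_mem_nhds hlt)))
        fun _ h => le_of_lt h
  obtain ⟨η, hη, hpos⟩ := (key.and self_mem_nhdsWithin).exists
  exact ⟨η, hpos, hη⟩

/-- The smallest face of `P` that contains `z`. -/
def faceAt (P : Set (E d)) (z : E d) : Set (E d) :=
  {y ∈ P | ∃ ε > (0 : ℝ), z + ε • (z - y) ∈ P}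

theorem mem_faceAt_self {P : Set (E d)} {z : E d} (hz : z ∈ P) : z ∈ faceAt P z :=
  ⟨hz, 1, one_pos, by simpa using hz⟩

theorem mem_openSegment_extension {z y : E d} {ε : ℝ} (hε : 0 < ε) :
    z ∈ openSegment ℝ y (z + ε • (z - y)) := by
  have h1 : (1 + ε) ≠ 0 := by positivity
  refine ⟨ε / (1 + ε), 1 / (1 + ε), by positivity, by positivity, by field_simp; ring, ?_⟩
  rw [smul_add, smul_smul, smul_sub]
  have : 1 / (1 + ε) * ε = ε / (1 + ε) := by ring
  rw [this]
  have h2 : (1 / (1 + ε)) • z + (ε / (1 + ε)) • z = z := by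
    rw [← add_smul, ← add_div, div_self h1, one_smul]
  calc _ = (1 / (1 + ε)) • z + (ε / (1 + ε)) • z := by abel
    _ = z := h2

theorem faceAt_subset_of_isExtreme {P F : Set (E d)} (hF : IsExtreme ℝ P F) {z : E d}
    (hz : z ∈ F) : faceAt P z ⊆ F := by
  rintro y ⟨hy, ε, hε, hyε⟩
  exact hF.left_mem_of_mem_openSegment hy hyε hz (mem_openSegment_extension hε)

theorem mem_faceAt_of_active {H : Finset (E d × ℝ)} {z y : E d}
    (hz : ∀ h ∈ H, ⟪h.1, z⟫ ≤ h.2) (hy : ∀ h ∈ H, ⟪h.1, y⟫ ≤ h.2)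
    (hzy : ∀ h ∈ H, ⟪h.1, z⟫ = h.2 → ⟪h.1, y⟫ = h.2) :
    y ∈ faceAt {x | ∀ h ∈ H, ⟪h.1, x⟫ ≤ h.2} z := by
  obtain ⟨η, hη, h⟩ := exists_pos_add_smul_mem H (w := z - y) hz (by
    intro h hh he
    rw [inner_sub_right, he, hzy h hh he, sub_self])
  exact ⟨hy, η, hη, h⟩

theorem active_of_mem_faceAt {H : Finset (E d × ℝ)} {z y : E d}
    (hy : y ∈ faceAt {x | ∀ h ∈ H, ⟪h.1, x⟫ ≤ h.2} z) :
    ∀ h ∈ H, ⟪h.1, z⟫ = h.2 → ⟪h.1, y⟫ = h.2 := by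
  obtain ⟨hy, ε, hε, hyε⟩ := hy
  intro h hh he
  have h1 := hyε h hh
  have h2 := hy h hh
  rw [inner_add_right, inner_smul_right, inner_sub_right, he] at h1
  have h3 : ε * (h.2 - ⟪h.1, y⟫) ≤ 0 := by linarith
  have h4 : h.2 - ⟪h.1, y⟫ ≤ 0 := by
    by_contra hc
    push Not at hc
    have := mul_pos hε hc
    linarith
  linarith

/-- The sum of the normals active at `z` is the exposing functional: it attains its maximum only
where each active constraint is tight. -/
theorem isExposed_faceAt {P : Set (E d)} (hP : IsPolyhedron P) {z : E d} (hz : z ∈ P) :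
    IsExposed ℝ P (faceAt P z) := by
  classical
  obtain ⟨H, rfl⟩ := hP
  intro _
  set A := H.filter fun h => ⟪h.1, z⟫ = h.2 with hA
  have hl : ∀ x : E d, innerSL ℝ (∑ h ∈ A, h.1) x = ∑ h ∈ A, ⟪h.1, x⟫ := by
    intro x
    rw [innerSL_apply_apply, sum_inner]
  refine ⟨innerSL ℝ (∑ h ∈ A, h.1), ?_⟩
  ext y
  constructor
  · intro hy
    refine ⟨hy.1, fun x hx => ?_⟩
    rw [hl, hl]
    refine Finset.sum_le_sum fun h hh => ?_
    rw [hA, Finset.mem_filter] at hh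
    rw [active_of_mem_faceAt hy h hh.1 hh.2]
    exact hx h hh.1
  · rintro ⟨hy, hmax⟩
    refine mem_faceAt_of_active hz hy fun h hh he => ?_
    have h1 := hmax z hz
    rw [hl, hl] at h1
    have hle : ∀ k ∈ A, ⟪k.1, y⟫ ≤ ⟪k.1, z⟫ := by
      intro k hk
      rw [hA, Finset.mem_filter] at hk
      rw [hk.2]
      exact hy k hk.1
    have h2 := (Finset.sum_eq_sum_iff_of_le hle).1 (le_antisymm (Finset.sum_le_sum hle) h1)
    rw [h2 h (by rw [hA, Finset.mem_filter]; exact ⟨hh, he⟩), he]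

/-- A point of `G` with the fewest active constraints is a relative interior point. Passing to its
midpoint with another point of `G` cannot lose further constraints, so whatever is active at it is
active on all of `G`. -/
theorem exists_eq_faceAt {P G : Set (E d)} (hP : IsPolyhedron P) (hG : IsExtreme ℝ P G)
    (hc : Convex ℝ G) (hne : G.Nonempty) : ∃ z ∈ G, G = faceAt P z := by
  classical
  obtain ⟨H, rfl⟩ := hP
  let act : E d → Finset (E d × ℝ) := fun x => H.filter fun h => ⟪h.1, x⟫ = h.2
  obtain ⟨z, hzG, hz⟩ : ∃ z ∈ G, ∀ y ∈ G, (act z).card ≤ (act y).card := by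
    have hex : ∃ k, ∃ z ∈ G, (act z).card = k := ⟨_, hne.some, hne.some_mem, rfl⟩
    obtain ⟨z, hz, hk⟩ := Nat.find_spec hex
    exact ⟨z, hz, fun y hy => hk ▸ Nat.find_min' hex ⟨y, hy, rfl⟩⟩
  refine ⟨z, hzG, subset_antisymm (fun y hy => ?_) (faceAt_subset_of_isExtreme hG hzG)⟩
  have hzP := hG.subset hzG
  have hyP := hG.subset hy
  refine mem_faceAt_of_active hzP hyP fun h hh he => ?_
  have hm : midpoint ℝ z y ∈ G := hc.midpoint_mem hzG hy
  have hmid : ∀ k : E d × ℝ, ⟪k.1, midpoint ℝ z y⟫ = (⟪k.1, z⟫ + ⟪k.1, y⟫) / 2 := by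
    intro k
    rw [midpoint_eq_smul_add, inner_smul_right, inner_add_right]
    simp only [invOf_eq_inv]
    ring
  have hsub : act (midpoint ℝ z y) ⊆ act z := by
    intro k hk
    simp only [act, Finset.mem_filter] at hk ⊢
    refine ⟨hk.1, ?_⟩
    have h1 := hzP k hk.1
    have h2 := hyP k hk.1
    have h3 := hk.2
    rw [hmid] at h3
    linarith
  have heq := Finset.eq_of_subset_of_card_le hsub (hz _ hm)
  have : h ∈ act (midpoint ℝ z y) := by
    rw [heq]
    simp only [act, Finset.mem_filter]
    exact ⟨hh, he⟩
  simp only [act, Finset.mem_filter, hmid] at this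
  linarith [this.2]

theorem IsPolyhedron.isExposed_of_isExtreme {P G : Set (E d)} (hP : IsPolyhedron P)
    (hG : IsExtreme ℝ P G) (hc : Convex ℝ G) : IsExposed ℝ P G := by
  rcases G.eq_empty_or_nonempty with rfl | hne
  · exact isExposed_empty
  obtain ⟨z, hz, h⟩ := exists_eq_faceAt hP hG hc hne
  rw [h]
  exact isExposed_faceAt hP (hG.subset hz)

/-- A non-empty face is determined by the set of constraints active at one of its relative interior
points. -/
theorem IsPolyhedron.finite_isExposed {P : Set (E d)} (hP : IsPolyhedron P) :
    {F | IsExposed ℝ P F}.Finite := by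
  classical
  have hP' := hP
  obtain ⟨H, rfl⟩ := hP
  let f : Finset (E d × ℝ) → Set (E d) := fun A =>
    {x | (∀ h ∈ H, ⟪h.1, x⟫ ≤ h.2) ∧ ∀ h ∈ A, ⟪h.1, x⟫ = h.2}
  refine ((H.powerset.finite_toSet.image f).union (Set.finite_singleton ∅)).subset ?_
  intro F hF
  rcases F.eq_empty_or_nonempty with rfl | hne
  · exact Or.inr rfl
  left
  obtain ⟨z, hz, h⟩ := exists_eq_faceAt hP' hF.isExtreme (hF.convex hP'.convex) hne
  refine ⟨H.filter fun h => ⟪h.1, z⟫ = h.2, by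
    rw [Finset.mem_coe, Finset.mem_powerset]
    exact Finset.filter_subset _ _, ?_⟩
  rw [h]
  ext y
  constructor
  · rintro ⟨hy, hyz⟩
    exact mem_faceAt_of_active (hF.subset hz) hy fun k hk he =>
      hyz k (Finset.mem_filter.2 ⟨hk, he⟩)
  · intro hy
    exact ⟨hy.1, fun k hk => active_of_mem_faceAt hy k (Finset.mem_filter.1 hk).1
      (Finset.mem_filter.1 hk).2⟩

/-- Ray shooting from `b` in a direction `u` that is not feasible at `a`: the last point of the ray
that satisfies the constraints active at `a` is moved towards `a` until it lies in `P`. -/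
theorem IsPolyhedron.exists_shoot {P : Set (E d)} (hP : IsPolyhedron P) {a b u : E d}
    (ha : a ∈ P) (hb : b ∈ P) (hu : ∀ ε > (0 : ℝ), a + ε • u ∉ P) :
    ∃ s ≥ (0 : ℝ), ∃ t > (0 : ℝ), a + t • (b + s • u - a) ∈ P ∧
      (∀ ε > (0 : ℝ), a + t • (b + s • u - a) + ε • u ∉ P) ∧
      a ∈ faceAt P (a + t • (b + s • u - a)) ∧ ∀ r : ℝ, b + r • u ∈ P → r ≤ s := by
  classical
  obtain ⟨H, rfl⟩ := hP
  set K := H.filter fun h => ⟪h.1, a⟫ = h.2 ∧ 0 < ⟪h.1, u⟫ with hK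
  have hKne : K.Nonempty := by
    by_contra hne
    rw [Finset.not_nonempty_iff_eq_empty, Finset.filter_eq_empty_iff] at hne
    obtain ⟨η, hη, h⟩ := exists_pos_add_smul_mem H (w := u) ha (by
      intro h hh he
      have := hne hh
      push Not at this
      exact this he)
    exact hu η hη h
  -- `K` consists of the constraints tight at `a` that `u` violates. The ray from `b` first meets
  -- one of their hyperplanes at the parameter `s`.
  obtain ⟨k, hkK, hmin⟩ := K.exists_min_image (fun h => (h.2 - ⟪h.1, b⟫) / ⟪h.1, u⟫) hKne
  rw [hK, Finset.mem_filter] at hkK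
  obtain ⟨hkH, hka, hku⟩ := hkK
  set s := (k.2 - ⟪k.1, b⟫) / ⟪k.1, u⟫ with hs
  have hs0 : 0 ≤ s := div_nonneg (sub_nonneg.2 (hb k hkH)) hku.le
  have hsk : s * ⟪k.1, u⟫ = k.2 - ⟪k.1, b⟫ := div_mul_cancel₀ _ hku.ne'
  set w := b + s • u - a with hw
  have hwi : ∀ h : E d × ℝ, ⟪h.1, w⟫ = ⟪h.1, b⟫ + s * ⟪h.1, u⟫ - ⟪h.1, a⟫ := by
    intro h
    rw [hw, inner_sub_right, inner_add_right, inner_smul_right]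
  obtain ⟨η, hη, hηP⟩ := exists_pos_add_smul_mem H (w := w) ha (by
    intro h hh he
    rw [hwi, he]
    rcases le_or_gt ⟪h.1, u⟫ 0 with hle | hlt
    · have := mul_nonpos_of_nonneg_of_nonpos hs0 hle
      have := hb h hh
      linarith
    · have := hmin h (by rw [hK, Finset.mem_filter]; exact ⟨hh, he, hlt⟩)
      rw [le_div_iff₀ hlt] at this
      linarith)
  have hconv : Convex ℝ {x : E d | ∀ h ∈ H, ⟪h.1, x⟫ ≤ h.2} := IsPolyhedron.convex ⟨H, rfl⟩
  have hmem : a + (η / 2) • w ∈ {x : E d | ∀ h ∈ H, ⟪h.1, x⟫ ≤ h.2} := by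
    have := hconv.midpoint_mem ha hηP
    have he : midpoint ℝ a (a + η • w) = a + (η / 2) • w := by
      rw [midpoint_eq_smul_add, invOf_eq_inv]
      module
    rwa [he] at this
  -- Only half of the feasible step is used: the segment from `a` continues in `P` beyond the new
  -- point, so `a` lies in the smallest face of that point.
  refine ⟨s, hs0, η / 2, by positivity, hmem, ?_, ⟨ha, 1, one_pos, ?_⟩, ?_⟩
  · intro ε hε hmem'
    have := hmem' k hkH
    rw [inner_add_right, inner_add_right, inner_smul_right, inner_smul_right, hwi, hsk, hka] at this
    have := mul_pos hε hku
    linarith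
  · have he : a + (η / 2) • w + (1 : ℝ) • (a + (η / 2) • w - a) = a + η • w := by module
    rw [he]
    exact hηP
  · intro r hr
    have := hr k hkH
    rw [inner_add_right, inner_smul_right] at this
    rw [hs, le_div_iff₀ hku]
    linarith

/-- A bounded polyhedron has a last point on every ray. -/
theorem exists_last_on_ray {P : Set (E d)} (hP : IsCompact P) {b u : E d} (hb : b ∈ P)
    (hu : u ≠ 0) : ∃ s ≥ (0 : ℝ), b + s • u ∈ P ∧ ∀ r : ℝ, b + r • u ∈ P → r ≤ s := by
  have hK : IsCompact {r : ℝ | b + r • u ∈ P} := by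
    have hemb : Topology.IsClosedEmbedding fun r : ℝ => b + r • u :=
      (Homeomorph.addLeft b).isClosedEmbedding.comp (isClosedEmbedding_smul_left hu)
    exact hemb.isCompact_preimage hP
  have hne : (0 : ℝ) ∈ {r : ℝ | b + r • u ∈ P} := by simpa using hb
  obtain ⟨s, hs, hmax⟩ := hK.exists_isGreatest ⟨0, hne⟩
  exact ⟨s, hmax hne, hs, fun r hr => hmax hr⟩

/-! ### Supporting functionals -/

theorem _root_.IsExposed.exists_support {P F : Set (E d)} (hF : IsExposed ℝ P F)
    (hne : F.Nonempty) :
    ∃ (l : StrongDual ℝ (E d)) (M : ℝ), (∀ x ∈ P, l x ≤ M) ∧ F = {x ∈ P | l x = M} := by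
  obtain ⟨l, hl⟩ := hF hne
  obtain ⟨z, hz⟩ := hne
  have hz' := hl ▸ hz
  refine ⟨l, l z, hz'.2, ?_⟩
  rw [hl]
  ext x
  constructor
  · rintro ⟨hx, hmax⟩
    exact ⟨hx, le_antisymm (hz'.2 x hx) (hmax z hz'.1)⟩
  · rintro ⟨hx, he⟩
    exact ⟨hx, fun y hy => he ▸ hz'.2 y hy⟩

/-- The dimension of the affine hull of a set (`0` for the empty set). -/
noncomputable def affDim (F : Set (E d)) : ℕ := Module.finrank ℝ (vectorSpan ℝ F)

/-- The functional exposing `A` vanishes on all directions of `A`, but not on a direction from `A`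
to a point of `B` outside `A`. -/
theorem affDim_lt_of_ssubset {P A B : Set (E d)} (hA : IsExposed ℝ P A) (hB : B ⊆ P)
    (hne : A.Nonempty) (hAB : A ⊂ B) : affDim A < affDim B := by
  apply Submodule.finrank_lt_finrank_of_lt
  refine lt_of_le_of_ne (vectorSpan_mono ℝ hAB.subset) fun heq => ?_
  obtain ⟨l, M, hl, rfl⟩ := hA.exists_support hne
  obtain ⟨b, hb, hbA⟩ := Set.exists_of_ssubset hAB
  obtain ⟨a, ha⟩ := hne
  have h1 : b - a ∈ vectorSpan ℝ {x ∈ P | l x = M} := by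
    rw [heq]
    exact vsub_mem_vectorSpan ℝ hb (hAB.subset ha)
  have h2 : vectorSpan ℝ {x ∈ P | l x = M} ≤ LinearMap.ker (l : E d →ₗ[ℝ] ℝ) := by
    rw [vectorSpan_def, Submodule.span_le]
    rintro _ ⟨x, hx, y, hy, rfl⟩
    simp [hx.2, hy.2]
  have h3 := h2 h1
  simp only [LinearMap.mem_ker, ContinuousLinearMap.coe_coe, map_sub, ha.2] at h3
  exact hbA ⟨hB hb, by linarith⟩

/-! ### Locally anti-blocking polytopes in a coordinate subspace -/

theorem e_apply (k j : Fin d) : (e k : E d) j = if j = k then 1 else 0 := by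
  simp [e]

theorem e_apply_self (k : Fin d) : (e k : E d) k = 1 := by simp [e_apply]

theorem e_apply_of_ne {k j : Fin d} (h : j ≠ k) : (e k : E d) j = 0 := by simp [e_apply, h]

theorem eq_sum_smul_e (x : E d) : x = ∑ k, x k • e k := by
  ext j
  simp [e_apply]

theorem map_eq_sum (l : StrongDual ℝ (E d)) (x : E d) : l x = ∑ k, x k * l (e k) := by
  conv_lhs => rw [eq_sum_smul_e x]
  simp

/-- The orthogonal projection along the `k`-th coordinate axis. -/
noncomputable def coordProj (k : Fin d) (x : E d) : E d := x - x k • e k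

theorem coordProj_apply_self (k : Fin d) (x : E d) : coordProj k x k = 0 := by
  simp [coordProj, e_apply]

theorem coordProj_apply_of_ne {k j : Fin d} (h : j ≠ k) (x : E d) : coordProj k x j = x j := by
  simp [coordProj, e_apply, h]

theorem coordProj_of_eq_zero {k : Fin d} {x : E d} (h : x k = 0) : coordProj k x = x := by
  simp [coordProj, h]

theorem coordProj_comm (j k : Fin d) (x : E d) :
    coordProj j (coordProj k x) = coordProj k (coordProj j x) := by
  rcases eq_or_ne j k with rfl | h
  · rfl
  · simp only [coordProj, PiLp.sub_apply, PiLp.smul_apply, e_apply, h, h.symm, if_false]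
    simp only [smul_eq_mul, mul_zero, sub_zero]
    abel

theorem map_coordProj (l : StrongDual ℝ (E d)) (k : Fin d) (x : E d) :
    l (coordProj k x) = l x - x k * l (e k) := by
  simp [coordProj]

/-- A locally anti-blocking polytope that spans the coordinate subspace with coordinates `ι k` and
has the origin in its relative interior. -/
structure IsLAB (ι : Fin n → Fin d) (P : Set (E d)) : Prop where
  injective : Function.Injective ι
  isCompact : IsCompact P
  isPolyhedron : IsPolyhedron P
  nonempty : P.Nonempty
  apply_eq_zero : ∀ x ∈ P, ∀ j, j ∉ Set.range ι → x j = 0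
  coordProj_mem : ∀ x ∈ P, ∀ j, coordProj j x ∈ P
  exists_pos : ∀ k, ∃ x ∈ P, 0 < x (ι k)
  exists_neg : ∀ k, ∃ x ∈ P, x (ι k) < 0

theorem isPolyhedron_inter_coord {P : Set (E d)} (hP : IsPolyhedron P) (i : Fin d) :
    IsPolyhedron (P ∩ {x | x i = 0}) := by
  classical
  obtain ⟨H, rfl⟩ := hP
  refine ⟨insert (e i, 0) (insert (-e i, 0) H), ?_⟩
  have he : ∀ x : E d, ⟪e i, x⟫ = x i := fun x => by simp [e, EuclideanSpace.inner_single_left]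
  ext x
  simp only [Set.mem_inter_iff, Set.mem_ofPred_eq, Finset.mem_insert, forall_eq_or_imp,
    inner_neg_left, he]
  constructor
  · rintro ⟨h1, h2⟩
    exact ⟨h2.le, by simp [h2], h1⟩
  · rintro ⟨h1, h2, h3⟩
    exact ⟨h3, by linarith⟩

theorem isClosed_coord (i : Fin d) : IsClosed {x : E d | x i = 0} :=
  isClosed_eq (by fun_prop) continuous_const

namespace IsLAB

theorem convex {ι : Fin n → Fin d} {P : Set (E d)} (hP : IsLAB ι P) : Convex ℝ P :=
  hP.isPolyhedron.convex

theorem sub_sum_mem {ι : Fin n → Fin d} {P : Set (E d)} (hP : IsLAB ι P) {x : E d} (hx : x ∈ P)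
    (S : Finset (Fin d)) : x - ∑ k ∈ S, x k • e k ∈ P := by
  classical
  induction S using Finset.induction_on with
  | empty => simpa using hx
  | insert a S ha ih =>
    have := hP.coordProj_mem _ ih a
    rw [Finset.sum_insert ha]
    have h : (x - ∑ k ∈ S, x k • e k) a = x a := by
      simp only [PiLp.sub_apply, WithLp.ofLp_sum, Finset.sum_apply, PiLp.smul_apply, e_apply]
      simp [ha]
    rw [coordProj, h] at this
    convert this using 1
    abel

theorem sum_mem {ι : Fin n → Fin d} {P : Set (E d)} (hP : IsLAB ι P) {x : E d} (hx : x ∈ P)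
    (S : Finset (Fin d)) : ∑ k ∈ S, x k • e k ∈ P := by
  classical
  have := hP.sub_sum_mem hx Sᶜ
  have h : x - ∑ k ∈ Sᶜ, x k • e k = ∑ k ∈ S, x k • e k := by
    rw [sub_eq_iff_eq_add, Finset.sum_add_sum_compl]
    exact eq_sum_smul_e x
  rwa [h] at this

theorem smul_e_mem {ι : Fin n → Fin d} {P : Set (E d)} (hP : IsLAB ι P) {x : E d} (hx : x ∈ P)
    (k : Fin d) : x k • e k ∈ P := by
  simpa using hP.sum_mem hx {k}

theorem zero_mem {ι : Fin n → Fin d} {P : Set (E d)} (hP : IsLAB ι P) : (0 : E d) ∈ P := by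
  simpa using hP.sum_mem hP.nonempty.some_mem ∅

/-- `P` contains points on both sides of the origin on each of its axes, so the functional vanishes
on every axis. -/
theorem map_eq_zero_of_nonpos {ι : Fin n → Fin d} {P : Set (E d)} (hP : IsLAB ι P)
    {l : StrongDual ℝ (E d)} (hl : ∀ x ∈ P, l x ≤ 0) {x : E d}
    (hx : ∀ j, j ∉ Set.range ι → x j = 0) : l x = 0 := by
  have h0 : ∀ k, l (e (ι k)) = 0 := by
    intro k
    obtain ⟨x, hx, hxk⟩ := hP.exists_pos k
    obtain ⟨y, hy, hyk⟩ := hP.exists_neg k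
    have h1 := hl _ (hP.smul_e_mem hx (ι k))
    have h2 := hl _ (hP.smul_e_mem hy (ι k))
    rw [map_smul, smul_eq_mul] at h1 h2
    nlinarith
  rw [map_eq_sum]
  refine Finset.sum_eq_zero fun k _ => ?_
  by_cases hk : k ∈ Set.range ι
  · obtain ⟨k, rfl⟩ := hk
    rw [h0, mul_zero]
  · rw [hx k hk, zero_mul]

/-- The origin is an interior point relative to the coordinate subspace. -/
theorem exists_smul_mem {ι : Fin n → Fin d} {P : Set (E d)} (hP : IsLAB ι P) {w : E d}
    (hw : ∀ j, j ∉ Set.range ι → w j = 0) : ∃ η > (0 : ℝ), η • w ∈ P := by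
  have h0 := hP.zero_mem
  obtain ⟨H, hH⟩ := hP.isPolyhedron
  rw [hH] at h0
  obtain ⟨η, hη, hmem⟩ := exists_pos_add_smul_mem H (w := w) h0 (by
    intro h hh he
    refine (hP.map_eq_zero_of_nonpos (l := innerSL ℝ h.1) (fun x hx => ?_) hw).le
    rw [hH] at hx
    rw [innerSL_apply_apply]
    rw [inner_zero_right] at he
    exact (hx h hh).trans_eq he.symm)
  refine ⟨η, hη, ?_⟩
  rw [zero_add] at hmem
  rw [hH]
  exact hmem

theorem inter_coord {ι : Fin (n + 1) → Fin d} {P : Set (E d)} (hP : IsLAB ι P) :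
    IsLAB (ι ∘ Fin.castSucc) (P ∩ {x | x (ι (Fin.last n)) = 0}) where
  injective := hP.injective.comp (Fin.castSucc_injective n)
  isCompact := hP.isCompact.inter_right (isClosed_coord _)
  isPolyhedron := isPolyhedron_inter_coord hP.isPolyhedron _
  nonempty := ⟨0, hP.zero_mem, by simp⟩
  apply_eq_zero := by
    rintro x ⟨hx, hx0⟩ j hj
    by_cases hjr : j ∈ Set.range ι
    · obtain ⟨k, rfl⟩ := hjr
      induction k using Fin.lastCases with
      | last => exact hx0
      | cast k => exact absurd ⟨k, rfl⟩ hj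
    · exact hP.apply_eq_zero x hx j hjr
  coordProj_mem := by
    rintro x ⟨hx, hx0⟩ j
    refine ⟨hP.coordProj_mem x hx j, ?_⟩
    rcases eq_or_ne (ι (Fin.last n)) j with h | h
    · simp only [Set.mem_ofPred_eq, h, coordProj_apply_self]
    · simp only [Set.mem_ofPred_eq, coordProj_apply_of_ne h]
      exact hx0
  exists_pos := by
    intro k
    obtain ⟨x, hx, hxk⟩ := hP.exists_pos k.castSucc
    have hne : ι k.castSucc ≠ ι (Fin.last n) :=
      fun h => (Fin.castSucc_lt_last k).ne (hP.injective h)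
    refine ⟨coordProj (ι (Fin.last n)) x, ⟨hP.coordProj_mem x hx _, coordProj_apply_self _ _⟩, ?_⟩
    rw [Function.comp_apply, coordProj_apply_of_ne hne]
    exact hxk
  exists_neg := by
    intro k
    obtain ⟨x, hx, hxk⟩ := hP.exists_neg k.castSucc
    have hne : ι k.castSucc ≠ ι (Fin.last n) :=
      fun h => (Fin.castSucc_lt_last k).ne (hP.injective h)
    refine ⟨coordProj (ι (Fin.last n)) x, ⟨hP.coordProj_mem x hx _, coordProj_apply_self _ _⟩, ?_⟩
    rw [Function.comp_apply, coordProj_apply_of_ne hne]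
    exact hxk

theorem affDim_le {ι : Fin n → Fin d} {P : Set (E d)} (hP : IsLAB ι P) : affDim P ≤ n := by
  have h : vectorSpan ℝ P ≤ Submodule.span ℝ (Set.range fun k => (e (ι k) : E d)) := by
    rw [vectorSpan_def, Submodule.span_le]
    rintro _ ⟨x, hx, y, hy, rfl⟩
    have key : ∀ x ∈ P, x ∈ Submodule.span ℝ (Set.range fun k => (e (ι k) : E d)) := by
      intro x hx
      rw [eq_sum_smul_e x]
      refine Submodule.sum_mem _ fun k _ => ?_
      by_cases hk : k ∈ Set.range ι
      · obtain ⟨k, rfl⟩ := hk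
        exact Submodule.smul_mem _ _ (Submodule.subset_span ⟨k, rfl⟩)
      · rw [hP.apply_eq_zero x hx k hk, zero_smul]
        exact Submodule.zero_mem _
    exact Submodule.sub_mem _ (key x hx) (key y hy)
  calc affDim P ≤ Module.finrank ℝ (Submodule.span ℝ (Set.range fun k => (e (ι k) : E d))) :=
        Submodule.finrank_mono h
    _ ≤ Fintype.card (Fin n) := finrank_range_le_card _
    _ = n := Fintype.card_fin n

end IsLAB

/-! ### The sign of a face in a coordinate -/

/-- `F` is parallel to the `k`-th coordinate axis. -/
def IsHigh (k : Fin d) (F : Set (E d)) : Prop := ∃ x ∈ F, x k ≠ 0 ∧ coordProj k x ∈ F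

/-- `F` is contained in the `k`-th coordinate hyperplane. -/
def IsLow (k : Fin d) (F : Set (E d)) : Prop := ∀ x ∈ F, x k = 0

theorem IsHigh.mono {k : Fin d} {F G : Set (E d)} (h : IsHigh k F) (hFG : F ⊆ G) : IsHigh k G := by
  obtain ⟨x, hx, h1, h2⟩ := h
  exact ⟨x, hFG hx, h1, hFG h2⟩

theorem IsLow.mono {k : Fin d} {F G : Set (E d)} (h : IsLow k G) (hFG : F ⊆ G) : IsLow k F :=
  fun x hx => h x (hFG hx)

open Classical in
/-- The sign of the `k`-th coordinate on `F` if `F` is neither contained in the coordinate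
hyperplane nor parallel to the coordinate axis, and `0` otherwise. -/
noncomputable def faceSign (k : Fin d) (F : Set (E d)) : ℤ :=
  if h : (∃ x ∈ F, x k ≠ 0) ∧ ¬ IsHigh k F then (SignType.sign (h.1.choose k) : ℤ) else 0

theorem faceSign_of_isHigh {k : Fin d} {F : Set (E d)} (h : IsHigh k F) : faceSign k F = 0 := by
  rw [faceSign, dif_neg]
  exact fun h' => h'.2 h

theorem faceSign_of_isLow {k : Fin d} {F : Set (E d)} (h : IsLow k F) : faceSign k F = 0 := by
  rw [faceSign, dif_neg]
  rintro ⟨⟨x, hx, hxk⟩, _⟩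
  exact hxk (h x hx)

theorem signType_cast_ne_zero {r : ℝ} (h : r ≠ 0) : ((SignType.sign r : SignType) : ℤ) ≠ 0 := by
  rcases lt_or_gt_of_ne h with h | h <;> simp [h]

theorem faceSign_eq_zero_iff {k : Fin d} {F : Set (E d)} :
    faceSign k F = 0 ↔ IsHigh k F ∨ IsLow k F := by
  constructor
  · intro h
    by_contra hc
    push Not at hc
    obtain ⟨h1, h2⟩ := hc
    have h3 : ∃ x ∈ F, x k ≠ 0 := by
      by_contra h3
      push Not at h3
      exact h2 h3
    rw [faceSign, dif_pos ⟨h3, h1⟩] at h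
    exact signType_cast_ne_zero h3.choose_spec.2 h
  · rintro (h | h)
    · exact faceSign_of_isHigh h
    · exact faceSign_of_isLow h

section
variable {ι : Fin n → Fin d} {P F G : Set (E d)} {k : Fin d}

theorem IsHigh.map_eq_zero {l : StrongDual ℝ (E d)} {M : ℝ} (h : IsHigh k {x ∈ P | l x = M}) :
    l (e k) = 0 := by
  obtain ⟨x, hx, h1, h2⟩ := h
  have h3 := h2.2
  rw [map_coordProj, hx.2] at h3
  have : x k * l (e k) = 0 := by linarith
  exact (mul_eq_zero.1 this).resolve_left h1

theorem IsHigh.coordProj_mem (hP : IsLAB ι P) (hF : IsExposed ℝ P F) (h : IsHigh k F) {x : E d}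
    (hx : x ∈ F) : coordProj k x ∈ F := by
  obtain ⟨l, M, hl, rfl⟩ := hF.exists_support ⟨x, hx⟩
  refine ⟨hP.coordProj_mem x hx.1 k, ?_⟩
  rw [map_coordProj, h.map_eq_zero, hx.2, mul_zero, sub_zero]

theorem IsHigh.mem_of_coordProj_mem (hF : IsExposed ℝ P F) (h : IsHigh k F) {x : E d}
    (hx : x ∈ P) (hxF : coordProj k x ∈ F) : x ∈ F := by
  obtain ⟨l, M, hl, rfl⟩ := hF.exists_support ⟨_, hxF⟩
  refine ⟨hx, ?_⟩
  have := hxF.2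
  rwa [map_coordProj, h.map_eq_zero, mul_zero, sub_zero] at this

/-- Projecting a point of the face along `e k` cannot increase the supporting functional `l`, so `x
k * l (e k) ≥ 0`, and likewise for `y`. Opposite signs would give `l (e k) = 0`, and then the face
is high. -/
theorem mul_pos_of_not_isHigh (hP : IsLAB ι P) (hF : IsExposed ℝ P F) (h : ¬ IsHigh k F)
    {x y : E d} (hx : x ∈ F) (hy : y ∈ F) (hxk : x k ≠ 0) (hyk : y k ≠ 0) : 0 < x k * y k := by
  by_contra hneg
  have hneg' : x k * y k < 0 := lt_of_le_of_ne (not_lt.1 hneg) (mul_ne_zero hxk hyk)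
  apply h
  refine ⟨x, hx, hxk, ?_⟩
  obtain ⟨l, M, hl, rfl⟩ := hF.exists_support ⟨x, hx⟩
  have h1 := hl _ (hP.coordProj_mem x hx.1 k)
  have h2 := hl _ (hP.coordProj_mem y hy.1 k)
  rw [map_coordProj, hx.2] at h1
  rw [map_coordProj, hy.2] at h2
  refine ⟨hP.coordProj_mem x hx.1 k, ?_⟩
  rw [map_coordProj, hx.2]
  have : l (e k) = 0 := by
    by_contra hle
    have h3 : 0 ≤ (x k * l (e k)) * (y k * l (e k)) := mul_nonneg (by linarith) (by linarith)
    have h4 : 0 < l (e k) ^ 2 := by positivity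
    nlinarith
  rw [this, mul_zero, sub_zero]

theorem sign_cast_eq_of_mul_pos {a b : ℝ} (h : 0 < a * b) :
    ((SignType.sign a : SignType) : ℤ) = (SignType.sign b : SignType) := by
  rcases pos_and_pos_or_neg_and_neg_of_mul_pos h with ⟨h1, h2⟩ | ⟨h1, h2⟩ <;> simp [h1, h2]

theorem faceSign_eq_sign (hP : IsLAB ι P) (hF : IsExposed ℝ P F) (h : ¬ IsHigh k F)
    {x : E d} (hx : x ∈ F) (hxk : x k ≠ 0) : faceSign k F = (SignType.sign (x k) : SignType) := by
  have h' : (∃ x ∈ F, x k ≠ 0) ∧ ¬ IsHigh k F := ⟨⟨x, hx, hxk⟩, h⟩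
  rw [faceSign, dif_pos h']
  exact sign_cast_eq_of_mul_pos
    (mul_pos_of_not_isHigh hP hF h h'.1.choose_spec.1 hx h'.1.choose_spec.2 hxk)

theorem faceSign_eq_of_subset (hP : IsLAB ι P) (hF : IsExposed ℝ P F) (hG : IsExposed ℝ P G)
    (hFG : F ⊆ G) (h1 : faceSign k F ≠ 0) (h2 : faceSign k G ≠ 0) :
    faceSign k F = faceSign k G := by
  rw [Ne, faceSign_eq_zero_iff, not_or] at h1 h2
  obtain ⟨x, hx, hxk⟩ : ∃ x ∈ F, x k ≠ 0 := by
    have := h1.2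
    unfold IsLow at this
    push Not at this
    exact this
  rw [faceSign_eq_sign hP hF h1.1 hx hxk, faceSign_eq_sign hP hG h2.1 (hFG hx) hxk]

theorem faceSign_mul_self (h : faceSign k F ≠ 0) : faceSign k F * faceSign k F = 1 := by
  unfold faceSign at h ⊢
  split_ifs at h ⊢ with h'
  · rcases lt_or_gt_of_ne h'.1.choose_spec.2 with h | h <;> simp [h]
  · exact absurd rfl h

theorem exists_of_faceSign_ne_zero (h : faceSign k F ≠ 0) :
    ∃ x ∈ F, x k ≠ 0 ∧ faceSign k F = (SignType.sign (x k) : SignType) ∧ ¬ IsHigh k F := by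
  unfold faceSign at h ⊢
  split_ifs at h ⊢ with h'
  · exact ⟨_, h'.1.choose_spec.1, h'.1.choose_spec.2, rfl, h'.2⟩
  · exact absurd rfl h

end

/-- A point of a face that is not parallel to the axis and its sign. -/
theorem IsLAB.not_coordProj_mem_of_sign {ι : Fin n → Fin d} {P M : Set (E d)} {k : Fin d}
    (hP : IsLAB ι P) (hM : IsExposed ℝ P M) (hMk : ¬ IsHigh k M) {x z : E d} (hx : x ∈ P)
    (hz : z ∈ M) (hxz : 0 < x k * z k) : coordProj k x ∉ M := by
  intro hxM
  have hx0 : x k ≠ 0 := fun h => by simp [h] at hxz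
  obtain ⟨l, c, hl, rfl⟩ := hM.exists_support ⟨z, hz⟩
  have h1 := hl x hx
  have h2 := hl _ (hP.coordProj_mem z hz.1 k)
  have h3 := hxM.2
  rw [map_coordProj] at h3 h2
  rw [hz.2] at h2
  have h4 : l (e k) = 0 := by
    by_contra hle
    have : (x k * l (e k)) * (z k * l (e k)) ≤ 0 :=
      mul_nonpos_of_nonpos_of_nonneg (by linarith) (by linarith)
    have h4 : 0 < l (e k) ^ 2 := by positivity
    nlinarith
  exact hMk ⟨x, ⟨hx, by rw [h4] at h3; linarith⟩, hx0, hxM⟩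

/-- Shooting in the direction `a - y` ends at a point `z` where `a - y` is infeasible. If `y` were
in the smallest face of `z`, then `z` could be moved away from `y`, and a convex combination with
`a` would be a step from `z` along `a - y`. -/
theorem IsPolyhedron.exists_faceAt_notMem {P : Set (E d)} (hP : IsPolyhedron P) {a b y : E d}
    (ha : a ∈ P) (hb : b ∈ P) (hy : y ∈ P) (hya : y ∉ faceAt P a) :
    ∃ s ≥ (0 : ℝ), ∃ t > (0 : ℝ), a + t • (b + s • (a - y) - a) ∈ P ∧
      a ∈ faceAt P (a + t • (b + s • (a - y) - a)) ∧
      y ∉ faceAt P (a + t • (b + s • (a - y) - a)) := by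
  obtain ⟨s, hs, t, ht, hz, hzu, haz, -⟩ := hP.exists_shoot ha hb (u := a - y)
    fun ε hε hmem => hya ⟨hy, ε, hε, hmem⟩
  refine ⟨s, hs, t, ht, hz, haz, ?_⟩
  rintro ⟨-, ε, hε, hmem⟩
  refine hzu (ε / (1 + ε)) (by positivity) ?_
  have h1 : (1 + ε) ≠ 0 := by positivity
  have := hP.convex hmem ha (a := 1 / (1 + ε)) (b := ε / (1 + ε)) (by positivity) (by positivity)
    (by field_simp)
  convert this using 1
  set z := a + t • (b + s • (a - y) - a)
  have h2 : z = (1 / (1 + ε)) • z + (ε / (1 + ε)) • z := by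
    rw [← add_smul, ← add_div, div_self h1, one_smul]
  have h3 : 1 / (1 + ε) * ε = ε / (1 + ε) := by ring
  rw [smul_add, smul_smul, h3]
  nth_rewrite 1 [h2]
  module

theorem exists_faceAt_notMem_of_ne {P : Set (E d)} (hP : IsCompact P) {b y : E d} (hb : b ∈ P)
    (hby : b ≠ y) : ∃ s ≥ (0 : ℝ), b + s • (b - y) ∈ P ∧ y ∉ faceAt P (b + s • (b - y)) := by
  obtain ⟨s, hs, hz, hmax⟩ := exists_last_on_ray hP hb (sub_ne_zero.2 hby)
  refine ⟨s, hs, hz, ?_⟩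
  rintro ⟨-, ε, hε, hmem⟩
  have := hmax (s + ε * (1 + s)) (by convert hmem using 1; module)
  have : 0 < ε * (1 + s) := by positivity
  linarith

/-! ### Full chains of faces -/

/-- A strictly increasing sequence of `n + 1` non-empty faces of `P`. -/
@[ext]
structure FaceChain (n : ℕ) (P : Set (E d)) where
  face : Fin (n + 1) → Set (E d)
  exposed : ∀ j, IsExposed ℝ P (face j)
  nonempty_zero : (face 0).Nonempty
  strictMono : StrictMono face

namespace FaceChain

variable {P : Set (E d)}

theorem nonempty (F : FaceChain n P) (j : Fin (n + 1)) : (F.face j).Nonempty :=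
  F.nonempty_zero.mono (F.strictMono.monotone (Fin.zero_le j))

theorem subset (F : FaceChain n P) (j : Fin (n + 1)) : F.face j ⊆ P := (F.exposed j).subset

theorem finite (hP : IsPolyhedron P) : Finite (FaceChain n P) := by
  have := hP.finite_isExposed.to_subtype
  let f : FaceChain n P → Fin (n + 1) → {F | IsExposed ℝ P F} := fun F j => ⟨F.face j, F.exposed j⟩
  refine Finite.of_injective f fun F G h => ?_
  ext1
  funext j
  exact congrArg Subtype.val (congrFun h j)

theorem affDim_strictMono (F : FaceChain n P) : StrictMono fun j => affDim (F.face j) :=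
  fun i j hij => affDim_lt_of_ssubset (F.exposed i) (F.subset j) (F.nonempty i)
    (F.strictMono hij)

theorem le_affDim (F : FaceChain n P) (j : Fin (n + 1)) : (j : ℕ) ≤ affDim (F.face j) := by
  induction j using Fin.induction with
  | zero => simp
  | succ i ih =>
    have := F.affDim_strictMono (Fin.castSucc_lt_succ (i := i))
    simp only [Fin.val_castSucc, Fin.val_succ] at ih ⊢
    simp only at this
    omega

theorem affDim_add_le (F : FaceChain n P) (j : Fin (n + 1)) :
    affDim (F.face j) + (n - j) ≤ affDim (F.face (Fin.last n)) := by
  induction j using Fin.reverseInduction with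
  | last => simp
  | cast i ih =>
    have := F.affDim_strictMono (Fin.castSucc_lt_succ (i := i))
    simp only [Fin.val_castSucc, Fin.val_succ] at ih ⊢
    simp only at this
    omega

variable {ι : Fin n → Fin d}

/-- The dimension grows at every step of the chain and is at most `n` at the end, so no step can
skip a dimension. -/
theorem affDim_face (hP : IsLAB ι P) (F : FaceChain n P) (j : Fin (n + 1)) :
    affDim (F.face j) = j := by
  have h1 := F.le_affDim j
  have h2 := F.affDim_add_le j
  have h3 : affDim (F.face (Fin.last n)) ≤ affDim P :=
    Submodule.finrank_mono (vectorSpan_mono ℝ (F.subset _))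
  have h4 := hP.affDim_le
  have h5 := j.is_le
  omega

theorem face_last (hP : IsLAB ι P) (F : FaceChain n P) : F.face (Fin.last n) = P := by
  by_contra hne
  have h1 := affDim_lt_of_ssubset (F.exposed (Fin.last n)) subset_rfl (F.nonempty _)
    (LE.le.ssubset_of_ne (F.subset _) hne)
  have h2 := F.le_affDim (Fin.last n)
  have h3 := hP.affDim_le
  rw [Fin.val_last] at h2
  omega

open Classical in
/-- Replace one face of a chain. -/
def replace (F : FaceChain n P) (m : Fin n) (W : Set (E d)) (hW : IsExposed ℝ P W)
    (hne : W.Nonempty) (h1 : ∀ i < m.castSucc, F.face i ⊂ W) (h2 : W ⊂ F.face m.succ) :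
    FaceChain n P where
  face := Function.update F.face m.castSucc W
  exposed j := by
    rcases eq_or_ne j m.castSucc with rfl | h
    · simpa using hW
    · simpa [h] using F.exposed j
  nonempty_zero := by
    rcases eq_or_ne 0 m.castSucc with h | h
    · rw [h]
      simpa using hne
    · simpa [h] using F.nonempty_zero
  strictMono := by
    intro i j hij
    rcases eq_or_ne i m.castSucc with rfl | hi
    · have hj : j ≠ m.castSucc := hij.ne'
      rw [Function.update_self, Function.update_of_ne hj]
      exact h2.trans_le (F.strictMono.monotone (Fin.castSucc_lt_iff_succ_le.1 hij))
    · rcases eq_or_ne j m.castSucc with rfl | hj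
      · rw [Function.update_self, Function.update_of_ne hi]
        exact h1 i hij
      · rw [Function.update_of_ne hi, Function.update_of_ne hj]
        exact F.strictMono hij

theorem replace_face_self (F : FaceChain n P) (m : Fin n) (W : Set (E d)) (hW : IsExposed ℝ P W)
    (hne : W.Nonempty) (h1 : ∀ i < m.castSucc, F.face i ⊂ W) (h2 : W ⊂ F.face m.succ) :
    (F.replace m W hW hne h1 h2).face m.castSucc = W := Function.update_self ..

theorem replace_face_of_ne (F : FaceChain n P) (m : Fin n) (W : Set (E d)) (hW : IsExposed ℝ P W)
    (hne : W.Nonempty) (h1 : ∀ i < m.castSucc, F.face i ⊂ W) (h2 : W ⊂ F.face m.succ)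
    {j : Fin (n + 1)} (hj : j ≠ m.castSucc) :
    (F.replace m W hW hne h1 h2).face j = F.face j := Function.update_of_ne hj ..

/-- The existence half of the diamond property. Take `y` in the face to be exchanged but not in the
preceding one. Shooting away from `y`, starting at a relative interior point of the preceding face,
gives a face that contains the preceding one but not `y`. If there is no preceding face, the last
point of a ray pointing away from `y` is used instead. -/
theorem exists_other (hPc : IsCompact P) (hP : IsPolyhedron P) (F : FaceChain n P) (m : Fin n) :
    ∃ G : FaceChain n P, G.face m.castSucc ≠ F.face m.castSucc ∧
      ∀ j ≠ m.castSucc, G.face j = F.face j := by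
  obtain ⟨b, hb, hbm⟩ := Set.exists_of_ssubset (F.strictMono (Fin.castSucc_lt_succ (i := m)))
  have hbP := F.subset _ hb
  obtain ⟨l', c', hl', he'⟩ := (F.exposed m.succ).exists_support (F.nonempty _)
  suffices h : ∃ W : Set (E d), IsExposed ℝ P W ∧ W.Nonempty ∧ (∀ i < m.castSucc, F.face i ⊂ W) ∧
      W ⊂ F.face m.succ ∧ W ≠ F.face m.castSucc by
    obtain ⟨W, hW, hne, h1, h2, h3⟩ := h
    refine ⟨F.replace m W hW hne h1 h2, ?_, fun j hj => F.replace_face_of_ne m W hW hne h1 h2 hj⟩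
    rwa [replace_face_self]
  rcases Fin.eq_zero_or_eq_succ m.castSucc with hm | ⟨p, hp⟩
  · obtain ⟨y, hy⟩ := F.nonempty m.castSucc
    have hy' := F.strictMono.monotone (Fin.castSucc_lt_succ (i := m)).le hy
    have hby : b ≠ y := fun h => hbm (h ▸ hy)
    obtain ⟨s, hs, hz, hyz⟩ := exists_faceAt_notMem_of_ne hPc hbP hby
    have hzF : b + s • (b - y) ∈ F.face m.succ := by
      rw [he'] at hb hy' ⊢
      refine ⟨hz, ?_⟩
      simp [hb.2, hy'.2]
    have hW := isExposed_faceAt hP hz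
    refine ⟨faceAt P (b + s • (b - y)), hW, ⟨_, mem_faceAt_self hz⟩, ?_, ?_, ?_⟩
    · intro i hi
      rw [hm] at hi
      exact absurd hi (Fin.not_lt_zero i)
    · exact LE.le.ssubset_of_ne
        (faceAt_subset_of_isExtreme (F.exposed _).isExtreme hzF) fun h => hyz (h ▸ hy')
    · exact fun h => hyz (h ▸ hy)
  · have hpm : p.castSucc < m.castSucc := by rw [hp]; exact Fin.castSucc_lt_succ
    obtain ⟨y, hy, hyp⟩ := Set.exists_of_ssubset (F.strictMono hpm)
    obtain ⟨a, ha, hFa⟩ := exists_eq_faceAt hP (F.exposed p.castSucc).isExtreme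
      ((F.exposed _).convex hP.convex) (F.nonempty _)
    have haP := F.subset _ ha
    have hyP := F.subset _ hy
    obtain ⟨s, hs, t, ht, hz, haz, hyz⟩ := hP.exists_faceAt_notMem haP hbP hyP (hFa ▸ hyp)
    set z := a + t • (b + s • (a - y) - a) with hzdef
    have hy' := F.strictMono.monotone (Fin.castSucc_lt_succ (i := m)).le hy
    have ham := F.strictMono.monotone hpm.le ha
    have ha' := F.strictMono.monotone (Fin.castSucc_lt_succ (i := m)).le ham
    have hzF : z ∈ F.face m.succ := by
      rw [he'] at hb hy' ha' ⊢
      refine ⟨hz, ?_⟩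
      simp [hzdef, hb.2, hy'.2, ha'.2]
    have hzm : z ∉ F.face m.castSucc := by
      obtain ⟨l, c, hl, he⟩ := (F.exposed m.castSucc).exists_support (F.nonempty _)
      rw [he] at ham hy hbm ⊢
      rintro ⟨-, hzc⟩
      apply hbm
      refine ⟨hbP, ?_⟩
      simp only [hzdef, map_add, map_smul, map_sub, ham.2, hy.2, sub_self, smul_eq_mul] at hzc
      have : t * (l b - c) = 0 := by linarith
      rcases mul_eq_zero.1 this with h | h
      · exact absurd h ht.ne'
      · linarith
    have hW := isExposed_faceAt hP hz
    have hpW : F.face p.castSucc ⊆ faceAt P z := by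
      rw [hFa]
      exact faceAt_subset_of_isExtreme hW.isExtreme haz
    have hpW' : F.face p.castSucc ⊂ faceAt P z := LE.le.ssubset_of_ne hpW
      fun h => hzm (F.strictMono.monotone hpm.le (h ▸ mem_faceAt_self hz))
    refine ⟨faceAt P z, hW, ⟨_, mem_faceAt_self hz⟩, ?_, ?_, fun h => hyz (h ▸ hy)⟩
    · intro i hi
      rw [hp, ← Fin.le_castSucc_iff] at hi
      exact lt_of_le_of_lt (F.strictMono.monotone hi) hpW'
    · exact LE.le.ssubset_of_ne
        (faceAt_subset_of_isExtreme (F.exposed _).isExtreme hzF) fun h => hyz (h ▸ hy')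

/-! ### Orientation of chains -/

/-- The homogeneous coordinates of a point. -/
def homog (ι : Fin n → Fin d) (x : E d) : Fin (n + 1) → ℝ := Fin.cons 1 fun k => x (ι k)

/-- Points `c j` that lie in the `j`-th face of the chain, but not in the preceding ones. -/
def IsTransversal (F : FaceChain n P) (c : Fin (n + 1) → E d) : Prop :=
  ∀ j, c j ∈ F.face j ∧ ∀ i < j, c j ∉ F.face i

theorem exists_transversal (F : FaceChain n P) : ∃ c, F.IsTransversal c := by
  have : ∀ j, ∃ x, x ∈ F.face j ∧ ∀ i < j, x ∉ F.face i := by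
    intro j
    rcases Fin.eq_zero_or_eq_succ j with rfl | ⟨p, rfl⟩
    · obtain ⟨x, hx⟩ := F.nonempty_zero
      exact ⟨x, hx, fun i hi => absurd hi (Fin.not_lt_zero i)⟩
    · obtain ⟨x, hx, hxp⟩ := Set.exists_of_ssubset (F.strictMono (Fin.castSucc_lt_succ (i := p)))
      exact ⟨x, hx, fun i hi hxi =>
        hxp (F.strictMono.monotone (Fin.le_castSucc_iff.2 hi) hxi)⟩
  exact Classical.axiom_of_choice this

theorem _root_.FlagPolytope.IsLAB.map_eq_sum (hP : IsLAB ι P) (l : StrongDual ℝ (E d)) {x : E d}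
    (hx : x ∈ P) : l x = ∑ k, l (e (ι k)) * x (ι k) := by
  classical
  rw [FlagPolytope.map_eq_sum, ← Finset.sum_image (f := fun j => l (e j) * x j)
    (s := Finset.univ) (g := ι) (fun _ _ _ _ h => hP.injective h)]
  simp_rw [mul_comm]
  symm
  refine Finset.sum_subset (Finset.subset_univ _) fun j _ hj => ?_
  rw [hP.apply_eq_zero x hx j (by simpa using hj), zero_mul]

/-- The coefficients come from an affine functional supporting the preceding face; for `j = 0` the
constant -1 serves. -/
theorem exists_dual (hP : IsLAB ι P) (F : FaceChain n P) (j : Fin (n + 1)) :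
    ∃ y : Fin (n + 1) → ℝ, (∀ i < j, ∀ x ∈ F.face i, homog ι x ⬝ᵥ y = 0) ∧
      ∀ x ∈ P, (∀ i < j, x ∉ F.face i) → homog ι x ⬝ᵥ y < 0 := by
  rcases Fin.eq_zero_or_eq_succ j with rfl | ⟨p, rfl⟩
  · refine ⟨Fin.cons (-1) 0, fun i hi => absurd hi (Fin.not_lt_zero i), fun x _ _ => ?_⟩
    simp [homog, dotProduct, Fin.sum_univ_succ]
  · obtain ⟨l, c, hl, he⟩ := (F.exposed p.castSucc).exists_support (F.nonempty _)
    have key : ∀ x ∈ P, homog ι x ⬝ᵥ (Fin.cons (-c) fun k => l (e (ι k)) : Fin (n + 1) → ℝ) =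
        l x - c := by
      intro x hx
      rw [hP.map_eq_sum l hx]
      simp only [homog, dotProduct, Fin.sum_univ_succ, Fin.cons_zero, Fin.cons_succ]
      simp_rw [mul_comm]
      ring
    refine ⟨Fin.cons (-c) fun k => l (e (ι k)), fun i hi x hx => ?_, fun x hx hxi => ?_⟩
    · rw [key x (F.subset _ hx)]
      have := F.strictMono.monotone (Fin.le_castSucc_iff.2 hi) hx
      rw [he] at this
      rw [this.2, sub_self]
    · rw [key x hx]
      have h1 := hxi p.castSucc Fin.castSucc_lt_succ
      have h2 := hl x hx
      rw [he] at h1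
      have : l x ≠ c := fun h => h1 ⟨hx, h⟩
      exact sub_neg.2 (lt_of_le_of_ne h2 this)

/-- The matrix of the homogeneous coordinates of a sequence of points. -/
def pointMatrix (ι : Fin n → Fin d) (c : Fin (n + 1) → E d) :
    Matrix (Fin (n + 1)) (Fin (n + 1)) ℝ := Matrix.of fun j => homog ι (c j)

/-- Multiplied by the matrix of dual vectors, the point matrix of any transversal becomes triangular
with negative diagonal. The dual matrix depends on the chain only, so the sign of the determinant is
the same for all transversals. -/
theorem exists_det_mul (hP : IsLAB ι P) (F : FaceChain n P) :
    ∃ r : ℝ, ∀ c, F.IsTransversal c → 0 < (pointMatrix ι c).det * r := by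
  choose y hy1 hy2 using F.exists_dual hP
  let Y : Matrix (Fin (n + 1)) (Fin (n + 1)) ℝ := Matrix.of fun k j => y j k
  refine ⟨Y.det * (-1) ^ (n + 1), fun c hc => ?_⟩
  have hent : ∀ i j, (pointMatrix ι c * Y) i j = homog ι (c i) ⬝ᵥ y j := fun i j => rfl
  have htri : (pointMatrix ι c * Y).BlockTriangular OrderDual.toDual := by
    intro i j hij
    rw [hent]
    exact hy1 j i hij _ (hc i).1
  rw [← mul_assoc, ← Matrix.det_mul, Matrix.det_of_isLowerTriangular _ htri]
  have : ((-1 : ℝ)) ^ (n + 1) = ∏ _i : Fin (n + 1), (-1 : ℝ) := by simp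
  rw [this, ← Finset.prod_mul_distrib]
  refine Finset.prod_pos fun i _ => ?_
  rw [hent]
  have := hy2 i _ (F.subset _ (hc i).1) (hc i).2
  linarith

/-- The orientation of a chain. -/
noncomputable def orient (ι : Fin n → Fin d) (F : FaceChain n P) : ℤ :=
  (SignType.sign (pointMatrix ι F.exists_transversal.choose).det : SignType)

theorem orient_eq (hP : IsLAB ι P) (F : FaceChain n P) {c : Fin (n + 1) → E d}
    (hc : F.IsTransversal c) :
    F.orient ι = (SignType.sign (pointMatrix ι c).det : SignType) := by
  obtain ⟨r, hr⟩ := F.exists_det_mul hP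
  have h1 := hr _ F.exists_transversal.choose_spec
  have h2 := hr c hc
  apply sign_cast_eq_of_mul_pos
  have h3 := mul_pos h1 h2
  have h4 : 0 < r ^ 2 := by
    have : r ≠ 0 := fun h => by simp [h] at h1
    positivity
  by_contra hle
  nlinarith

theorem orient_ne_zero (hP : IsLAB ι P) (F : FaceChain n P) : F.orient ι ≠ 0 := by
  obtain ⟨r, hr⟩ := F.exists_det_mul hP
  obtain ⟨c, hc⟩ := F.exists_transversal
  rw [F.orient_eq hP hc]
  refine signType_cast_ne_zero fun h => ?_
  have := hr c hc
  simp [h] at this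

theorem abs_orient (hP : IsLAB ι P) (F : FaceChain n P) : |F.orient ι| = 1 := by
  have h := F.orient_ne_zero hP
  unfold orient at h ⊢
  generalize SignType.sign (pointMatrix ι F.exists_transversal.choose).det = σ at h ⊢
  cases σ <;> simp_all

/-- Adjacent chains have opposite orientations. -/
theorem orient_adjacent (hP : IsLAB ι P) {F G : FaceChain n P} {m : Fin n}
    (hne : G.face m.castSucc ≠ F.face m.castSucc)
    (hFG : ∀ j ≠ m.castSucc, G.face j = F.face j) : G.orient ι = - F.orient ι := by
  classical
  have hinc : ∀ {F G : FaceChain n P}, G.face m.castSucc ≠ F.face m.castSucc →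
      ∃ x ∈ F.face m.castSucc, x ∉ G.face m.castSucc := by
    intro F G hne
    by_contra hc
    push Not at hc
    have := affDim_lt_of_ssubset (F.exposed m.castSucc) (G.subset _) (F.nonempty _)
      (LE.le.ssubset_of_ne hc hne.symm)
    rw [F.affDim_face hP, G.affDim_face hP] at this
    exact lt_irrefl _ this
  obtain ⟨x, hxF, hxG⟩ := hinc hne
  obtain ⟨y, hyG, hyF⟩ := hinc hne.symm
  obtain ⟨c, hc⟩ := F.exists_transversal
  have hms : m.succ ≠ m.castSucc := (Fin.castSucc_lt_succ (i := m)).ne'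
  -- Both transversals use the midpoint of `x` and `y` at position `m + 1`. Their matrices then
  -- differ in one row, and modulo the midpoint row, `y` is `-x`.
  let cF : Fin (n + 1) → E d := Function.update (Function.update c m.succ (midpoint ℝ x y))
    m.castSucc x
  let cG : Fin (n + 1) → E d := Function.update (Function.update c m.succ (midpoint ℝ x y))
    m.castSucc y
  have hFs : F.face m.castSucc ⊆ F.face m.succ :=
    F.strictMono.monotone (Fin.castSucc_lt_succ (i := m)).le
  have hGs : G.face m.castSucc ⊆ G.face m.succ :=
    G.strictMono.monotone (Fin.castSucc_lt_succ (i := m)).le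
  have hmid : midpoint ℝ x y ∈ F.face m.succ := by
    refine ((F.exposed _).convex hP.convex).midpoint_mem (hFs hxF) ?_
    rw [← hFG _ hms]
    exact hGs hyG
  have hxP := F.subset _ hxF
  have hyP := G.subset _ hyG
  have hopen : midpoint ℝ x y ∈ openSegment ℝ x y := by
    refine ⟨1 / 2, 1 / 2, by norm_num, by norm_num, by norm_num, ?_⟩
    rw [midpoint_eq_smul_add, smul_add]
    norm_num
  have hmF : midpoint ℝ x y ∉ F.face m.castSucc := fun h =>
    hyF ((F.exposed _).isExtreme.right_mem_of_mem_openSegment hxP hyP h hopen)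
  have hmG : midpoint ℝ x y ∉ G.face m.castSucc := fun h =>
    hxG ((G.exposed _).isExtreme.left_mem_of_mem_openSegment hxP hyP h hopen)
  have hlt : ∀ i, i < m.succ → i ≤ m.castSucc := fun i hi => Fin.le_castSucc_iff.2 hi
  have hcF : F.IsTransversal cF := by
    intro j
    rcases eq_or_ne j m.castSucc with rfl | hj
    · simp only [cF, Function.update_self]
      refine ⟨hxF, fun i hi hxi => hxG ?_⟩
      rw [← hFG i hi.ne] at hxi
      exact G.strictMono.monotone hi.le hxi
    · simp only [cF, Function.update_of_ne hj]
      rcases eq_or_ne j m.succ with rfl | hj'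
      · simp only [Function.update_self]
        exact ⟨hmid, fun i hi h => hmF (F.strictMono.monotone (hlt i hi) h)⟩
      · simp only [Function.update_of_ne hj']
        exact hc j
  have hcG : G.IsTransversal cG := by
    intro j
    rcases eq_or_ne j m.castSucc with rfl | hj
    · simp only [cG, Function.update_self]
      refine ⟨hyG, fun i hi hxi => hyF ?_⟩
      rw [hFG i hi.ne] at hxi
      exact F.strictMono.monotone hi.le hxi
    · simp only [cG, Function.update_of_ne hj]
      rcases eq_or_ne j m.succ with rfl | hj'
      · simp only [Function.update_self]
        rw [hFG _ hms]
        exact ⟨hmid, fun i hi h => hmG (G.strictMono.monotone (hlt i hi)  h)⟩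
      · simp only [Function.update_of_ne hj']
        refine ⟨hFG j hj ▸ (hc j).1, fun i hi h => ?_⟩
        have hms' : m.castSucc < j ∨ j < m.castSucc := (lt_or_gt_of_ne hj).symm
        rcases hms' with h' | h'
        · have h1 : m.castSucc < m.succ := Fin.castSucc_lt_succ
          have h2 : m.succ < j := lt_of_le_of_ne (Fin.castSucc_lt_iff_succ_le.1 h') hj'.symm
          rcases le_or_gt i m.succ with h3 | h3
          · have := G.strictMono.monotone h3 h
            rw [hFG _ hms] at this
            exact (hc j).2 _ h2 this
          · rw [hFG i (h1.trans h3).ne'] at h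
            exact (hc j).2 i hi h
        · rw [hFG i (hi.trans h').ne] at h
          exact (hc j).2 i hi h
  rw [F.orient_eq hP hcF, G.orient_eq hP hcG]
  have hdet : (pointMatrix ι cG).det = - (pointMatrix ι cF).det := by
    have hrow : pointMatrix ι cG = (pointMatrix ι cF).updateRow m.castSucc
        ((2 : ℝ) • pointMatrix ι cF m.succ + (-1 : ℝ) • pointMatrix ι cF m.castSucc) := by
      ext j k
      rcases eq_or_ne j m.castSucc with rfl | hj
      · rw [Matrix.updateRow_self]
        simp only [pointMatrix, Matrix.of_apply, cG, cF, Function.update_self, Pi.add_apply,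
          Pi.smul_apply, Function.update_of_ne hms]
        refine Fin.cases ?_ (fun k => ?_) k
        · simp [homog]
          norm_num
        · simp only [homog, Fin.cons_succ, midpoint_eq_smul_add, PiLp.smul_apply, PiLp.add_apply,
            invOf_eq_inv, smul_eq_mul]
          ring
      · rw [Matrix.updateRow_ne hj]
        simp only [pointMatrix, Matrix.of_apply, cG, cF, Function.update_of_ne hj]
    rw [hrow, Matrix.det_updateRow_add, Matrix.det_updateRow_smul, Matrix.det_updateRow_smul,
      Matrix.updateRow_eq_self]
    rw [Matrix.det_zero_of_row_eq (i := m.castSucc) (j := m.succ) hms.symm]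
    · simp
    · rw [Matrix.updateRow_self, Matrix.updateRow_ne hms]
  rw [hdet, Left.sign_neg]
  simp

/-- A chain is determined by all its faces but one and its orientation. -/
theorem eq_of_orient_eq (hP : IsLAB ι P) {F G : FaceChain n P} {m : Fin n}
    (hFG : ∀ j ≠ m.castSucc, G.face j = F.face j) (h : G.orient ι = F.orient ι) : G = F := by
  have hm : G.face m.castSucc = F.face m.castSucc := by
    by_contra hne
    have h1 := orient_adjacent hP hne hFG
    have h2 := F.orient_ne_zero hP
    omega
  ext1
  funext j
  rcases eq_or_ne j m.castSucc with rfl | hj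
  · exact hm
  · exact hFG j hj

/-- The chain adjacent to `F` that differs from `F` in the `m`-th face only. -/
noncomputable def swap (hP : IsLAB ι P) (F : FaceChain n P) (m : Fin n) : FaceChain n P :=
  (F.exists_other hP.isCompact hP.isPolyhedron m).choose

theorem swap_face_of_ne (hP : IsLAB ι P) (F : FaceChain n P) (m : Fin n) {j : Fin (n + 1)}
    (hj : j ≠ m.castSucc) : (F.swap hP m).face j = F.face j :=
  (F.exists_other hP.isCompact hP.isPolyhedron m).choose_spec.2 j hj

theorem orient_swap (hP : IsLAB ι P) (F : FaceChain n P) (m : Fin n) :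
    (F.swap hP m).orient ι = - F.orient ι :=
  orient_adjacent hP (F.exists_other hP.isCompact hP.isPolyhedron m).choose_spec.1
    fun _ hj => F.swap_face_of_ne hP m hj

theorem swap_ne (hP : IsLAB ι P) (F : FaceChain n P) (m : Fin n) : F.swap hP m ≠ F := by
  intro h
  have h1 := F.orient_swap hP m
  have h2 := F.orient_ne_zero hP
  rw [h] at h1
  omega

theorem swap_swap (hP : IsLAB ι P) (F : FaceChain n P) (m : Fin n) :
    (F.swap hP m).swap hP m = F := by
  refine eq_of_orient_eq hP (m := m) (fun j hj => ?_) ?_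
  · rw [swap_face_of_ne hP _ m hj, swap_face_of_ne hP _ m hj]
  · rw [orient_swap, orient_swap, neg_neg]

end FaceChain

/-! ### Determinants of interval matrices -/

/-- Among the intervals that start at row 0 choose a shortest one and subtract its column from the
others starting there. This leaves intervals and a single non-zero entry in row 0, along which the
determinant is expanded. -/
theorem abs_det_le_one_of_interval : ∀ (n : ℕ) (A : Matrix (Fin n) (Fin n) ℤ) (lo hi : Fin n → ℕ),
    (∀ m k, A m k = if lo k ≤ m ∧ (m : ℕ) < hi k then 1 else 0) → |A.det| ≤ 1
  | 0, A, _, _, _ => by simp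
  | n + 1, A, lo, hi, hA => by
    classical
    by_cases hex : ∃ k, lo k = 0 ∧ 0 < hi k
    · obtain ⟨k₀, hk₀, hmin⟩ := (Finset.univ.filter fun k => lo k = 0 ∧ 0 < hi k).exists_min_image
        hi (by obtain ⟨k, hk⟩ := hex; exact ⟨k, by simpa using hk⟩)
      simp only [Finset.mem_filter, Finset.mem_univ, true_and] at hk₀ hmin
      let B : Matrix (Fin (n + 1)) (Fin (n + 1)) ℤ := Matrix.of fun m k =>
        A m k + (if k ≠ k₀ ∧ lo k = 0 ∧ 0 < hi k then -1 else 0) * A m k₀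
      have hdet : B.det = A.det := by
        rw [← Matrix.det_transpose B, ← Matrix.det_transpose A]
        exact Matrix.det_eq_of_forall_row_eq_smul_add_const
          (fun k => if k ≠ k₀ ∧ lo k = 0 ∧ 0 < hi k then -1 else 0) k₀ (by simp) fun m k => rfl
      have hB0 : ∀ k, B 0 k = if k = k₀ then 1 else 0 := by
        intro k
        simp only [B, Matrix.of_apply, hA, Fin.val_zero, nonpos_iff_eq_zero, hk₀, and_self,
          if_true, mul_one]
        by_cases h : k = k₀
        · subst h
          simp [hk₀]
        · by_cases h' : lo k = 0 ∧ 0 < hi k <;> simp [h, h']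
      rw [← hdet, Matrix.det_succ_row_zero, Finset.sum_eq_single k₀ (by
        intro k _ hk
        simp [hB0, hk]) (by simp), hB0, if_pos rfl, mul_one, abs_mul, abs_pow, abs_neg, abs_one,
        one_pow, one_mul]
      let k' : Fin n → Fin (n + 1) := k₀.succAbove
      -- With row 0 deleted all bounds drop by one, and a column that started at row 0 now starts
      -- where the shortest interval ended.
      refine abs_det_le_one_of_interval n _
        (fun j => if lo (k' j) = 0 ∧ 0 < hi (k' j) then hi k₀ - 1 else lo (k' j) - 1)
        (fun j => hi (k' j) - 1) fun m j => ?_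
      have hne : k' j ≠ k₀ := Fin.succAbove_ne _ _
      have hm := hmin (k' j)
      change B m.succ (k' j) = _
      simp only [B, Matrix.of_apply, hA, Fin.val_succ, hne, ne_eq, not_false_eq_true, true_and]
      obtain ⟨h1, h2⟩ := hk₀
      by_cases h' : lo (k' j) = 0 ∧ 0 < hi (k' j)
      · have h3 := hm h'
        simp only [h', and_self, if_true]
        split_ifs <;> first | rfl | omega
      · simp only [h', if_false, zero_mul, add_zero]
        split_ifs <;> first | rfl | omega
    · rw [Matrix.det_eq_zero_of_row_eq_zero 0]
      · simp
      · intro k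
        rw [hA, if_neg]
        simp only [Fin.val_zero, nonpos_iff_eq_zero]
        exact fun h => hex ⟨k, h⟩

theorem exists_forall_iff_lt {p : Fin n → Prop} (hp : ∀ i j, i ≤ j → p j → p i) :
    ∃ r : ℕ, ∀ m : Fin n, p m ↔ (m : ℕ) < r := by
  classical
  have hex : ∃ r : ℕ, ∀ m : Fin n, r ≤ m → ¬ p m := ⟨n, fun m hm => absurd m.is_lt hm.not_gt⟩
  refine ⟨Nat.find hex, fun m => ⟨fun h => ?_, fun h => ?_⟩⟩
  · by_contra hle
    exact Nat.find_spec hex m (not_lt.1 hle) h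
  · have := Nat.find_min hex h
    push Not at this
    obtain ⟨j, hj, hpj⟩ := this
    exact hp m j hj hpj

/-! ### The sign matrix of a chain -/

namespace FaceChain

variable {P : Set (E d)}

/-- The matrix of signs of the proper faces of a chain. -/
noncomputable def signMatrix (ι : Fin n → Fin d) (F : FaceChain n P) : Matrix (Fin n) (Fin n) ℤ :=
  Matrix.of fun m k => faceSign (ι k) (F.face m.castSucc)

theorem signMatrix_apply (ι : Fin n → Fin d) (F : FaceChain n P) (m k : Fin n) :
    F.signMatrix ι m k = faceSign (ι k) (F.face m.castSucc) := rfl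

variable {ι : Fin n → Fin d}

theorem signMatrix_eq_of_ne_zero (hP : IsLAB ι P) (F : FaceChain n P) {m m' k : Fin n}
    (h : F.signMatrix ι m k ≠ 0) (h' : F.signMatrix ι m' k ≠ 0) :
    F.signMatrix ι m k = F.signMatrix ι m' k := by
  rw [signMatrix_apply] at *
  rw [signMatrix_apply] at *
  rcases le_total m m' with hle | hle
  · exact faceSign_eq_of_subset hP (F.exposed _) (F.exposed _) (F.strictMono.monotone hle) h h'
  · exact (faceSign_eq_of_subset hP (F.exposed _) (F.exposed _) (F.strictMono.monotone hle) h'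
      h).symm

theorem abs_faceSign_le (k : Fin d) (G : Set (E d)) : |faceSign k G| ≤ 1 := by
  by_cases h : faceSign k G = 0
  · simp [h]
  · have := faceSign_mul_self h
    rw [abs_le]
    constructor <;> nlinarith

/-- Being low passes to smaller faces and being high to larger ones, so each column is a constant
sign times the indicator of an interval. -/
theorem abs_det_signMatrix_le (hP : IsLAB ι P) (F : FaceChain n P) :
    |(F.signMatrix ι).det| ≤ 1 := by
  classical
  have hlo : ∀ k, ∃ r : ℕ, ∀ m : Fin n, IsLow (ι k) (F.face m.castSucc) ↔ (m : ℕ) < r := fun k =>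
    exists_forall_iff_lt fun i j hij h => h.mono (F.strictMono.monotone hij)
  have hhi : ∀ k, ∃ r : ℕ, ∀ m : Fin n, ¬ IsHigh (ι k) (F.face m.castSucc) ↔ (m : ℕ) < r :=
    fun k => exists_forall_iff_lt fun i j hij h h' => h (h'.mono (F.strictMono.monotone hij))
  choose lo hlo using hlo
  choose hi hhi using hhi
  have hσ : ∀ k, ∃ σ : ℤ, |σ| ≤ 1 ∧ ∀ m, F.signMatrix ι m k ≠ 0 → F.signMatrix ι m k = σ := by
    intro k
    by_cases h : ∃ m, F.signMatrix ι m k ≠ 0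
    · obtain ⟨m, hm⟩ := h
      exact ⟨F.signMatrix ι m k, abs_faceSign_le _ _, fun m' hm' =>
        F.signMatrix_eq_of_ne_zero hP hm' hm⟩
    · push Not at h
      exact ⟨0, by simp, fun m hm => absurd (h m) hm⟩
  choose σ hσ1 hσ using hσ
  let B : Matrix (Fin n) (Fin n) ℤ := Matrix.of fun m k =>
    if lo k ≤ m ∧ (m : ℕ) < hi k then 1 else 0
  have hA : F.signMatrix ι = Matrix.of fun m k => σ k * B m k := by
    ext m k
    have hiff : F.signMatrix ι m k = 0 ↔ ¬ (lo k ≤ m ∧ (m : ℕ) < hi k) := by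
      rw [signMatrix_apply, faceSign_eq_zero_iff, hlo, ← hhi, ← not_lt]
      tauto
    simp only [B, Matrix.of_apply]
    split_ifs with h
    · rw [mul_one]
      exact hσ k m fun h0 => hiff.1 h0 h
    · rw [mul_zero]
      exact hiff.2 h
  rw [hA, Matrix.det_mul_row, abs_mul, Finset.abs_prod]
  exact mul_le_one₀ (Finset.prod_le_one (fun _ _ => abs_nonneg _) fun k _ => hσ1 k)
    (abs_nonneg _) (abs_det_le_one_of_interval n B lo hi fun _ _ => rfl)

theorem isHigh_top {k : Fin n} (hP : IsLAB ι P) : IsHigh (ι k) P := by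
  obtain ⟨x, hx, hxk⟩ := hP.exists_pos k
  exact ⟨x, hx, hxk.ne', hP.coordProj_mem x hx _⟩

/-- Every functional that supports a proper face is positive there. -/
theorem _root_.FlagPolytope.IsLAB.pos_of_ssubset (hP : IsLAB ι P) {l : StrongDual ℝ (E d)} {M : ℝ}
    (hl : ∀ x ∈ P, l x ≤ M) (hne : {x ∈ P | l x = M} ≠ P) : 0 < M := by
  have h0 := hl 0 hP.zero_mem
  rw [map_zero] at h0
  refine lt_of_le_of_ne h0 fun h => hne ?_
  subst h
  ext x
  exact ⟨fun hx => hx.1, fun hx => ⟨hx, hP.map_eq_zero_of_nonpos hl (hP.apply_eq_zero x hx)⟩⟩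

/-- `v` lies in all faces, so none is low in `c`; a face high in `c` would make the largest proper
face high, against `l (e (ι c)) ≠ 0`. -/
theorem signMatrix_eq_sign {ι : Fin (n + 1) → Fin d} (hP : IsLAB ι P) (F : FaceChain (n + 1) P)
    {v : E d} (hv : v ∈ F.face 0) {l : StrongDual ℝ (E d)} {M : ℝ}
    (he : F.face (Fin.last n).castSucc = {x ∈ P | l x = M}) {c : Fin (n + 1)}
    (hlc : l (e (ι c)) ≠ 0) (hvc : v (ι c) ≠ 0) (m : Fin (n + 1)) :
    F.signMatrix ι m c = (SignType.sign (v (ι c)) : SignType) := by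
  have hmq : m.castSucc ≤ (Fin.last n).castSucc := Fin.castSucc_le_castSucc_iff.2 (Fin.le_last m)
  refine faceSign_eq_sign hP (F.exposed _) (fun h => hlc ?_)
    (F.strictMono.monotone (Fin.zero_le _) hv) hvc
  have := h.mono (F.strictMono.monotone hmq)
  rw [he] at this
  exact this.map_eq_zero

theorem exists_support_pos {ι : Fin (n + 1) → Fin d} (hP : IsLAB ι P) (F : FaceChain (n + 1) P) :
    ∃ (l : StrongDual ℝ (E d)) (M : ℝ), 0 < M ∧ (∀ x ∈ P, l x ≤ M) ∧
      F.face (Fin.last n).castSucc = {x ∈ P | l x = M} := by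
  obtain ⟨l, M, hl, he⟩ := (F.exposed (Fin.last n).castSucc).exists_support (F.nonempty _)
  have hlt : F.face (Fin.last n).castSucc ⊂ P :=
    (F.strictMono (Fin.castSucc_lt_succ (i := Fin.last n))).trans_le (F.subset _)
  exact ⟨l, M, hP.pos_of_ssubset hl (he ▸ hlt.ne), hl, he⟩

/-- Some coordinate has the same non-zero sign on all proper faces of a chain. -/
theorem exists_common {ι : Fin (n + 1) → Fin d} (hP : IsLAB ι P) (F : FaceChain (n + 1) P) :
    ∃ c, ∃ τ : ℤ, τ ≠ 0 ∧ ∀ m, F.signMatrix ι m c = τ := by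
  obtain ⟨v, hv⟩ := F.nonempty_zero
  obtain ⟨l, M, hM, hl, he⟩ := F.exists_support_pos hP
  have hvq : v ∈ F.face (Fin.last n).castSucc := F.strictMono.monotone (Fin.zero_le _) hv
  rw [he] at hvq
  have hlv := hvq.2
  rw [hP.map_eq_sum l hvq.1] at hlv
  -- Since `l v = M > 0`, some coordinate contributes to `l v`; it is non-zero in both `l` and `v`.
  obtain ⟨c, -, hc⟩ := Finset.exists_ne_zero_of_sum_ne_zero (hlv.trans_ne hM.ne')
  have hvc : v (ι c) ≠ 0 := right_ne_zero_of_mul hc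
  exact ⟨c, _, signType_cast_ne_zero hvc,
    F.signMatrix_eq_sign hP hv he (left_ne_zero_of_mul hc) hvc⟩

open Classical in
/-- The common sign of the faces of a chain in the last coordinate. -/
noncomputable def lastSign (ι : Fin (n + 1) → Fin d) (F : FaceChain (n + 1) P) : ℤ :=
  if h : ∃ m, F.signMatrix ι m (Fin.last n) ≠ 0 then F.signMatrix ι h.choose (Fin.last n) else 0

theorem lastSign_eq {ι : Fin (n + 1) → Fin d} (hP : IsLAB ι P) (F : FaceChain (n + 1) P)
    {m : Fin (n + 1)} (h : F.signMatrix ι m (Fin.last n) ≠ 0) :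
    F.lastSign ι = F.signMatrix ι m (Fin.last n) := by
  have h' : ∃ m, F.signMatrix ι m (Fin.last n) ≠ 0 := ⟨m, h⟩
  rw [lastSign, dif_pos h']
  exact F.signMatrix_eq_of_ne_zero hP h'.choose_spec h

theorem lastSign_eq_zero {ι : Fin (n + 1) → Fin d} (F : FaceChain (n + 1) P)
    (h : ∀ m, F.signMatrix ι m (Fin.last n) = 0) : F.lastSign ι = 0 := by
  rw [lastSign, dif_neg]
  push Not
  exact h

end FaceChain

/-! ### Cofactor expansion of sign matrices -/

/-- The determinant of a matrix with a constant column, expanded with respect to its last column. -/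
theorem det_eq_sum_adjugate (A : Matrix (Fin (n + 1)) (Fin (n + 1)) ℤ) {c : Fin (n + 1)} {τ s : ℤ}
    (hτ : τ ≠ 0) (hc : ∀ m, A m c = τ) (hs : s * s = 1)
    (hA : ∀ m, A m (Fin.last n) ≠ 0 → A m (Fin.last n) = s) :
    A.det = ∑ m, s * A.adjugate (Fin.last n) m *
      (1 + ((Finset.univ.filter fun j => j ≠ m ∧ A j (Fin.last n) = 0).card : ℤ)) := by
  classical
  have hmul : ∀ k, ∑ m, A.adjugate (Fin.last n) m * A m k = if k = Fin.last n then A.det else 0 := by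
    intro k
    have := congrFun (congrFun A.adjugate_mul (Fin.last n)) k
    rw [Matrix.mul_apply] at this
    rw [this, Matrix.smul_apply, Matrix.one_apply]
    simp [eq_comm]
  have hlast : ∑ m, A.adjugate (Fin.last n) m * A m (Fin.last n) = A.det := by
    rw [hmul, if_pos rfl]
  have hs0 : s ≠ 0 := fun h => by simp [h] at hs
  set Z := Finset.univ.filter fun j => A j (Fin.last n) = 0 with hZ
  have hcard : ∀ m, ((Finset.univ.filter fun j => j ≠ m ∧ A j (Fin.last n) = 0).card : ℤ) =
      Z.card - if A m (Fin.last n) = 0 then 1 else 0 := by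
    intro m
    have h1 : (Finset.univ.filter fun j => j ≠ m ∧ A j (Fin.last n) = 0) = Z.erase m := by
      ext j
      simp [hZ]
    rw [h1]
    split_ifs with h
    · have hm : m ∈ Z := by simp [hZ, h]
      have := Finset.card_erase_add_one hm
      omega
    · rw [Finset.erase_eq_of_notMem (by simp [hZ, h]), sub_zero]
  -- Up to a multiple of the cofactor that does not depend on `m`, the new term is the usual
  -- cofactor term: the count of zeros outside row `m` drops by one exactly when the entry in row
  -- `m` vanishes.
  have hterm : ∀ m, s * A.adjugate (Fin.last n) m *
      (1 + ((Finset.univ.filter fun j => j ≠ m ∧ A j (Fin.last n) = 0).card : ℤ)) =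
      s * Z.card * A.adjugate (Fin.last n) m +
        A.adjugate (Fin.last n) m * A m (Fin.last n) := by
    intro m
    rw [hcard]
    split_ifs with h
    · rw [h]; ring
    · rw [hA m h]; ring
  rw [Finset.sum_congr rfl fun m _ => hterm m, Finset.sum_add_distrib, hlast, ← Finset.mul_sum]
  -- The cofactors of the last column are orthogonal to every other column, so they sum to zero if
  -- the constant column is another one. If it is the last column itself, that column has no zeros.
  have hzero : s * (Z.card : ℤ) * ∑ m, A.adjugate (Fin.last n) m = 0 := by
    rcases eq_or_ne c (Fin.last n) with rfl | hcl
    · have : Z = ∅ := by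
        rw [hZ, Finset.filter_eq_empty_iff]
        intro m _
        rw [hc m]
        exact hτ
      simp [this]
    · have h1 := hmul c
      rw [if_neg hcl] at h1
      simp_rw [hc] at h1
      rw [← Finset.sum_mul] at h1
      rw [(mul_eq_zero.1 h1).resolve_right hτ, mul_zero]
  rw [hzero, zero_add]

theorem isExposed_of_support {P : Set (E d)} (l : StrongDual ℝ (E d)) {M : ℝ}
    (hl : ∀ x ∈ P, l x ≤ M) : IsExposed ℝ P {x ∈ P | l x = M} := by
  rintro ⟨z, hz, hzM⟩
  refine ⟨l, ?_⟩
  ext x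
  constructor
  · rintro ⟨hx, hxM⟩
    exact ⟨hx, fun y hy => hxM ▸ hl y hy⟩
  · rintro ⟨hx, hmax⟩
    exact ⟨hx, le_antisymm (hl x hx) (hzM ▸ hmax z hz)⟩

theorem _root_.IsExposed.inter_set {P F : Set (E d)} (hF : IsExposed ℝ P F) (Q : Set (E d)) :
    IsExposed ℝ (P ∩ Q) (F ∩ Q) := by
  intro hne
  obtain ⟨l, M, hl, he⟩ := hF.exists_support (hne.mono Set.inter_subset_left)
  have := isExposed_of_support (P := P ∩ Q) l (fun x hx => hl x hx.1)
  have heq : F ∩ Q = {x ∈ P ∩ Q | l x = M} := by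
    rw [he]
    ext x
    simp only [Set.mem_inter_iff, Set.mem_ofPred_eq]
    tauto
  rw [heq] at hne ⊢
  exact this hne

/-! ### Restriction of chains to the last coordinate hyperplane -/

section FaceSection

variable {ι : Fin (n + 1) → Fin d} {P F : Set (E d)}

/-- Signs of faces do not change under restriction to the last coordinate hyperplane, if the face is
contained in the hyperplane or orthogonal to it. -/
theorem faceSign_inter (hP : IsLAB ι P) (hF : IsExposed ℝ P F)
    (hi : IsHigh (ι (Fin.last n)) F ∨ IsLow (ι (Fin.last n)) F) {k : Fin d}
    (hk : k ≠ ι (Fin.last n)) :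
    faceSign k (F ∩ {x | x (ι (Fin.last n)) = 0}) = faceSign k F := by
  set i := ι (Fin.last n) with hidef
  have hhigh : IsHigh k F → IsHigh k (F ∩ {x | x i = 0}) := by
    rintro ⟨x, hx, hxk, hxF⟩
    rcases hi with hi | hi
    · refine ⟨coordProj i x, ⟨hi.coordProj_mem hP hF hx, coordProj_apply_self _ _⟩, ?_, ?_, ?_⟩
      · rwa [coordProj_apply_of_ne hk]
      · rw [coordProj_comm]
        exact hi.coordProj_mem hP hF hxF
      · rw [coordProj_comm]
        exact coordProj_apply_self _ _
    · exact ⟨x, ⟨hx, hi x hx⟩, hxk, hxF, hi _ hxF⟩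
  by_cases h1 : IsHigh k F
  · rw [faceSign_of_isHigh h1, faceSign_of_isHigh (hhigh h1)]
  by_cases h2 : IsLow k F
  · rw [faceSign_of_isLow h2, faceSign_of_isLow (h2.mono Set.inter_subset_left)]
  obtain ⟨x, hx, hxk⟩ : ∃ x ∈ F, x k ≠ 0 := by
    unfold IsLow at h2
    push Not at h2
    exact h2
  obtain ⟨x', hx', hxk'⟩ : ∃ x' ∈ F ∩ {x | x i = 0}, x' k = x k := by
    rcases hi with hi | hi
    · exact ⟨coordProj i x, ⟨hi.coordProj_mem hP hF hx, coordProj_apply_self _ _⟩,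
        coordProj_apply_of_ne hk _⟩
    · exact ⟨x, ⟨hx, hi x hx⟩, rfl⟩
  rw [faceSign_eq_sign hP hF h1 hx hxk, ← hxk']
  exact faceSign_eq_sign hP.inter_coord (hF.inter_set _)
    (fun h => h1 (h.mono Set.inter_subset_left)) hx' (hxk' ▸ hxk)

end FaceSection

namespace FaceChain

variable {P : Set (E d)} {ι : Fin (n + 1) → Fin d}

/-- The `m`-th face is the only one with a non-zero sign in the last coordinate. -/
def IsSole (ι : Fin (n + 1) → Fin d) (F : FaceChain (n + 1) P) (m : Fin (n + 1)) : Prop :=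
  F.signMatrix ι m (Fin.last n) ≠ 0 ∧ ∀ j ≠ m, F.signMatrix ι j (Fin.last n) = 0

theorem IsSole.not_isHigh {F : FaceChain (n + 1) P} {m : Fin (n + 1)} (h : F.IsSole ι m) :
    ¬ IsHigh (ι (Fin.last n)) (F.face m.castSucc) :=
  fun h' => h.1 (faceSign_of_isHigh h')

theorem IsSole.isLow {F : FaceChain (n + 1) P} {m : Fin (n + 1)} (h : F.IsSole ι m)
    {j : Fin (n + 2)} (hj : j < m.castSucc) : IsLow (ι (Fin.last n)) (F.face j) := by
  induction j using Fin.lastCases with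
  | last => exact absurd hj (Fin.le_last _).not_gt
  | cast j =>
    have hjm : j ≠ m := fun h => hj.ne (h ▸ rfl)
    rcases faceSign_eq_zero_iff.1 (h.2 j hjm) with h' | h'
    · exact absurd (h'.mono (F.strictMono.monotone hj.le)) h.not_isHigh
    · exact h'

theorem IsSole.isHigh (hP : IsLAB ι P) {F : FaceChain (n + 1) P} {m : Fin (n + 1)}
    (h : F.IsSole ι m) {j : Fin (n + 2)} (hj : m.castSucc < j) :
    IsHigh (ι (Fin.last n)) (F.face j) := by
  induction j using Fin.lastCases with
  | last =>
    rw [F.face_last hP]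
    exact isHigh_top hP
  | cast j =>
    have hjm : j ≠ m := fun h => hj.ne (h ▸ rfl)
    rcases faceSign_eq_zero_iff.1 (h.2 j hjm) with h' | h'
    · exact h'
    · exact absurd (faceSign_of_isLow (h'.mono (F.strictMono.monotone hj.le))) h.1

theorem IsSole.exists_point {F : FaceChain (n + 1) P} {m : Fin (n + 1)}
    (h : F.IsSole ι m) : ∃ x ∈ F.face m.castSucc, x (ι (Fin.last n)) ≠ 0 ∧
      F.signMatrix ι m (Fin.last n) = (SignType.sign (x (ι (Fin.last n))) : SignType) ∧
      coordProj (ι (Fin.last n)) x ∉ F.face m.castSucc := by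
  obtain ⟨x, hx, hx0, hs, hh⟩ := exists_of_faceSign_ne_zero h.1
  exact ⟨x, hx, hx0, hs, fun h' => hh ⟨x, hx, hx0, h'⟩⟩

/-- The chain of the section with the last coordinate hyperplane. -/
def restrict (hP : IsLAB ι P) (F : FaceChain (n + 1) P) (m : Fin (n + 1)) (h : F.IsSole ι m) :
    FaceChain n (P ∩ {x | x (ι (Fin.last n)) = 0}) where
  face a := F.face (m.castSucc.succAbove a) ∩ {x | x (ι (Fin.last n)) = 0}
  exposed a := (F.exposed _).inter_set _
  nonempty_zero := by
    obtain ⟨x, hx⟩ := F.nonempty (m.castSucc.succAbove 0)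
    rcases lt_or_gt_of_ne (Fin.succAbove_ne m.castSucc 0) with hlt | hlt
    · exact ⟨x, hx, h.isLow hlt x hx⟩
    · exact ⟨_, (h.isHigh hP hlt).coordProj_mem hP (F.exposed _) hx, coordProj_apply_self _ _⟩
  strictMono := by
    intro a b hab
    have hpq := Fin.strictMono_succAbove m.castSucc hab
    set p := m.castSucc.succAbove a with hp
    set q := m.castSucc.succAbove b with hq
    have hpm : p ≠ m.castSucc := Fin.succAbove_ne _ _
    have hqm : q ≠ m.castSucc := Fin.succAbove_ne _ _
    have hsub : F.face p ∩ {x | x (ι (Fin.last n)) = 0} ⊆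
        F.face q ∩ {x | x (ι (Fin.last n)) = 0} :=
      Set.inter_subset_inter_left _ (F.strictMono.monotone hpq.le)
    suffices hex : ∃ y ∈ F.face q, y (ι (Fin.last n)) = 0 ∧ y ∉ F.face p by
      obtain ⟨y, hy, hy0, hyp⟩ := hex
      exact ⟨hsub, fun hle => hyp (hle ⟨hy, hy0⟩).1⟩
    obtain ⟨y, hy, hyp⟩ := Set.exists_of_ssubset (F.strictMono hpq)
    rcases lt_or_gt_of_ne hqm with hlt | hlt
    · exact ⟨y, hy, h.isLow hlt y hy, hyp⟩
    · rcases lt_or_gt_of_ne hpm with hlt' | hlt'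
      -- Here `p < m < q`. The projection of a point of the `m`-th face lies in the `q`-th face, but
      -- not in the `m`-th, hence not in the `p`-th.
      · obtain ⟨x, hx, -, -, hxm⟩ := h.exists_point
        exact ⟨_, (h.isHigh hP hlt).coordProj_mem hP (F.exposed _)
          (F.strictMono.monotone hlt.le hx), coordProj_apply_self _ _,
          fun hxp => hxm (F.strictMono.monotone hlt'.le hxp)⟩
      · exact ⟨_, (h.isHigh hP hlt).coordProj_mem hP (F.exposed _) hy, coordProj_apply_self _ _,
          fun hyp' => hyp
            ((h.isHigh hP hlt').mem_of_coordProj_mem (F.exposed _) (F.subset _ hy) hyp')⟩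

theorem restrict_face (hP : IsLAB ι P) (F : FaceChain (n + 1) P) (m : Fin (n + 1))
    (h : F.IsSole ι m) (a : Fin (n + 1)) : (F.restrict hP m h).face a =
      F.face (m.castSucc.succAbove a) ∩ {x | x (ι (Fin.last n)) = 0} := rfl

theorem signMatrix_restrict (hP : IsLAB ι P) (F : FaceChain (n + 1) P) (m : Fin (n + 1))
    (h : F.IsSole ι m) : (F.restrict hP m h).signMatrix (ι ∘ Fin.castSucc) =
      (F.signMatrix ι).submatrix m.succAbove Fin.castSucc := by
  ext j k
  rw [Matrix.submatrix_apply, signMatrix_apply, signMatrix_apply, restrict_face,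
    Fin.castSucc_succAbove_castSucc]
  refine faceSign_inter hP (F.exposed _) ?_ fun hk => (Fin.castSucc_lt_last k).ne (hP.injective hk)
  rcases lt_or_gt_of_ne (Fin.succAbove_ne m j) with hlt | hlt
  · exact Or.inr (h.isLow (Fin.castSucc_lt_castSucc_iff.2 hlt))
  · exact Or.inl (h.isHigh hP (Fin.castSucc_lt_castSucc_iff.2 hlt))

/-- A transversal of `F` can be formed from a transversal of the restriction and one point `x` of
the `m`-th face. All points but `x` lie in the hyperplane, so the last column of the point matrix
has a single non-zero entry. -/
theorem orient_restrict (hP : IsLAB ι P) (F : FaceChain (n + 1) P) (m : Fin (n + 1))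
    (h : F.IsSole ι m) : F.orient ι = (-1) ^ ((m : ℕ) + (n + 1)) * F.signMatrix ι m (Fin.last n) *
      (F.restrict hP m h).orient (ι ∘ Fin.castSucc) := by
  classical
  obtain ⟨x, hx, hx0, hs, hxm⟩ := h.exists_point
  set G := F.restrict hP m h with hG
  obtain ⟨c₀, hc₀⟩ := G.exists_transversal
  have hface : ∀ a, G.face a = F.face (m.castSucc.succAbove a) ∩ {x | x (ι (Fin.last n)) = 0} :=
    F.restrict_face hP m h
  have hGm : G.face m = F.face m.succ ∩ {x | x (ι (Fin.last n)) = 0} := by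
    rw [hface, Fin.succAbove_castSucc_self]
  have hGlt : ∀ a < m, G.face a ⊆ F.face m.castSucc := by
    intro a ha
    rw [hface, Fin.succAbove_castSucc_of_lt m a ha]
    exact Set.inter_subset_left.trans
      (F.strictMono.monotone (Fin.castSucc_le_castSucc_iff.2 ha.le))
  have hxs : coordProj (ι (Fin.last n)) x ∈ G.face m := by
    rw [hGm]
    exact ⟨(h.isHigh hP Fin.castSucc_lt_succ).coordProj_mem hP (F.exposed _)
      (F.strictMono.monotone (Fin.castSucc_lt_succ (i := m)).le hx), coordProj_apply_self _ _⟩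
  let c : Fin (n + 1) → E d := Function.update c₀ m (coordProj (ι (Fin.last n)) x)
  have hc : G.IsTransversal c := by
    intro a
    rcases eq_or_ne a m with rfl | ha
    · simp only [c, Function.update_self]
      exact ⟨hxs, fun b hb hxb => hxm (hGlt b hb hxb)⟩
    · simp only [c, Function.update_of_ne ha]
      exact hc₀ a
  let cF : Fin (n + 2) → E d := m.castSucc.insertNth x c
  have hcF : F.IsTransversal cF := by
    intro j
    rcases Fin.eq_self_or_eq_succAbove m.castSucc j with rfl | ⟨a, rfl⟩
    · simp only [cF, Fin.insertNth_apply_same]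
      exact ⟨hx, fun k hk hxk => hx0 (h.isLow hk x hxk)⟩
    · simp only [cF, Fin.insertNth_apply_succAbove]
      have hca : c a ∈ F.face (m.castSucc.succAbove a) ∩ {x | x (ι (Fin.last n)) = 0} := (hc a).1
      refine ⟨hca.1, fun k hk hck => ?_⟩
      rcases Fin.eq_self_or_eq_succAbove m.castSucc k with rfl | ⟨b, rfl⟩
      · have hma : m ≤ a := by
          rw [Fin.lt_succAbove_iff_le_castSucc] at hk
          exact Fin.castSucc_le_castSucc_iff.1 hk
        rcases hma.eq_or_lt with rfl | hlt
        · simp only [c, Function.update_self] at hck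
          exact hxm hck
        · refine (hc a).2 m hlt ?_
          rw [hGm]
          exact ⟨F.strictMono.monotone (Fin.castSucc_lt_succ (i := m)).le hck, hca.2⟩
      · exact (hc a).2 b (Fin.succAbove_lt_succAbove_iff.1 hk) ⟨hck, hca.2⟩
  rw [F.orient_eq hP hcF, G.orient_eq hP.inter_coord hc, hs]
  have hdet : (pointMatrix ι cF).det =
      (-1) ^ ((m : ℕ) + (n + 1)) * x (ι (Fin.last n)) * (pointMatrix (ι ∘ Fin.castSucc) c).det := by
    rw [Matrix.det_succ_column _ (Fin.last (n + 1)), Finset.sum_eq_single m.castSucc]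
    · have h1 : pointMatrix ι cF m.castSucc (Fin.last (n + 1)) = x (ι (Fin.last n)) := by
        rw [← Fin.succ_last]
        simp [pointMatrix, homog, cF]
      have h2 : (pointMatrix ι cF).submatrix m.castSucc.succAbove (Fin.last (n + 1)).succAbove =
          pointMatrix (ι ∘ Fin.castSucc) c := by
        ext a b
        simp only [Matrix.submatrix_apply, pointMatrix, Matrix.of_apply, cF,
          Fin.insertNth_apply_succAbove, Fin.succAbove_last]
        refine Fin.cases ?_ (fun b => ?_) b
        · simp [homog]
        · rw [← Fin.succ_castSucc]
          simp [homog]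
      rw [h1, h2]
      simp
    · intro j _ hj
      obtain ⟨a, rfl⟩ := Fin.exists_succAbove_eq hj
      have h1 : pointMatrix ι cF (m.castSucc.succAbove a) (Fin.last (n + 1)) = 0 := by
        rw [← Fin.succ_last]
        simp only [pointMatrix, homog, cF, Matrix.of_apply, Fin.cons_succ,
          Fin.insertNth_apply_succAbove]
        exact (hc a).1.2
      rw [h1]
      simp
    · simp
  rw [hdet, sign_mul, sign_mul, SignType.coe_mul, SignType.coe_mul, sign_pow, Left.sign_neg,
    sign_one, SignType.coe_pow]
  simp

/-! ### Weights of chains and their cancellation -/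

/-- The signed contribution of a chain. -/
noncomputable def weight (ι : Fin n → Fin d) (F : FaceChain n P) : ℤ :=
  F.orient ι * (F.signMatrix ι).det

/-- The terms of the expansion of the weight of a chain. -/
noncomputable def term (ι : Fin (n + 1) → Fin d) (F : FaceChain (n + 1) P) (m : Fin (n + 1)) : ℤ :=
  F.orient ι * (F.lastSign ι * (F.signMatrix ι).adjugate (Fin.last n) m *
    (1 + ((Finset.univ.filter fun j => j ≠ m ∧ F.signMatrix ι j (Fin.last n) = 0).card : ℤ)))

/-- An ordinary cofactor term contains the entry of row `m`. Trading it for the common sign and the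
number of zeros in the other rows removes this dependence, which is what `sum_term` needs; the trade
is free because some column is constant. -/
theorem weight_eq_sum_term (hP : IsLAB ι P) (F : FaceChain (n + 1) P) :
    F.weight ι = ∑ m, F.term ι m := by
  unfold weight term
  rw [← Finset.mul_sum]
  congr 1
  by_cases h : ∃ m, F.signMatrix ι m (Fin.last n) ≠ 0
  · obtain ⟨m, hm⟩ := h
    obtain ⟨c, τ, hτ, hc⟩ := F.exists_common hP
    refine det_eq_sum_adjugate _ hτ hc ?_ fun m hm => (F.lastSign_eq hP hm).symm
    rw [F.lastSign_eq hP hm]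
    exact faceSign_mul_self hm
  · push Not at h
    rw [F.lastSign_eq_zero h, Matrix.det_eq_zero_of_column_eq_zero (Fin.last n) h]
    simp

/-- All `n` other entries of the last column vanish, so the correction factor is `n + 1`. The minus
sign comes from the mismatch by one between the homogeneous point matrix, of size `n + 2`, and the
sign matrix, of size `n + 1`. -/
theorem term_of_isSole (hP : IsLAB ι P) (F : FaceChain (n + 1) P) (m : Fin (n + 1))
    (h : F.IsSole ι m) :
    F.term ι m = -(n + 1) * (F.restrict hP m h).weight (ι ∘ Fin.castSucc) := by
  have hcard : (Finset.univ.filter fun j => j ≠ m ∧ F.signMatrix ι j (Fin.last n) = 0) =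
      Finset.univ.erase m := by
    ext j
    simp only [Finset.mem_filter, Finset.mem_univ, true_and, Finset.mem_erase, and_true]
    exact ⟨fun hj => hj.1, fun hj => ⟨hj, h.2 j hj⟩⟩
  have hs : F.signMatrix ι m (Fin.last n) * F.signMatrix ι m (Fin.last n) = 1 :=
    faceSign_mul_self h.1
  unfold term weight
  rw [hcard, Finset.card_erase_of_mem (Finset.mem_univ _), Finset.card_univ, Fintype.card_fin,
    F.lastSign_eq hP h.1, F.orient_restrict hP m h, signMatrix_restrict,
    Matrix.adjugate_fin_succ_eq_det_submatrix, Fin.succAbove_last, Fin.val_last]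
  have hpow : ((-1 : ℤ)) ^ ((m : ℕ) + (n + 1)) * (-1) ^ ((m : ℕ) + n) = -1 := by
    rw [← pow_add]
    exact Odd.neg_one_pow ⟨(m : ℕ) + n, by ring⟩
  simp only [add_tsub_cancel_right]
  set s := F.signMatrix ι m (Fin.last n)
  set D := ((F.signMatrix ι).submatrix m.succAbove Fin.castSucc).det
  set o := (F.restrict hP m h).orient (ι ∘ Fin.castSucc)
  calc _ = ((-1 : ℤ) ^ ((m : ℕ) + (n + 1)) * (-1) ^ ((m : ℕ) + n)) * (s * s) * (n + 1) * (o * D) := by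
        ring
    _ = _ := by rw [hpow, hs]; ring

theorem signMatrix_swap (hP : IsLAB ι P) (F : FaceChain (n + 1) P) {m j : Fin (n + 1)}
    (hj : j ≠ m) (k : Fin (n + 1)) :
    (F.swap hP m).signMatrix ι j k = F.signMatrix ι j k := by
  rw [signMatrix_apply, signMatrix_apply, F.swap_face_of_ne hP m
    fun h => hj (Fin.castSucc_injective _ h)]

-- Exchanging the `m`-th face is an involution that reverses the orientation. If some other row has
-- a sign in the last coordinate, then the common sign, the cofactor and the number of zeros are all
-- read off from the rows other than `m`, and the two terms cancel. Otherwise the chain has its sole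
-- sign at `m`, or no sign at all and a zero term.
open Classical in
theorem sum_term (hP : IsLAB ι P) [Fintype (FaceChain (n + 1) P)] (m : Fin (n + 1)) :
    ∑ F : FaceChain (n + 1) P, F.term ι m =
      ∑ F : FaceChain (n + 1) P, if F.IsSole ι m then F.term ι m else 0 := by
  rw [← sub_eq_zero, ← Finset.sum_sub_distrib]
  have hzero : ∀ F : FaceChain (n + 1) P, (∀ j ≠ m, F.signMatrix ι j (Fin.last n) = 0) →
      (F.term ι m - if F.IsSole ι m then F.term ι m else 0) = 0 := by
    intro F h
    split_ifs with hs
    · exact sub_self _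
    · have : F.signMatrix ι m (Fin.last n) = 0 := by
        by_contra hne
        exact hs ⟨hne, h⟩
      rw [term, F.lastSign_eq_zero fun j => ?_]
      · simp
      · rcases eq_or_ne j m with rfl | hj
        · exact this
        · exact h j hj
  refine Finset.sum_involution (fun F _ => F.swap hP m) ?_ (fun F _ _ => F.swap_ne hP m)
    (fun F _ => Finset.mem_univ _) (fun F _ => F.swap_swap hP m)
  intro F _
  by_cases h : ∀ j ≠ m, F.signMatrix ι j (Fin.last n) = 0
  · rw [hzero F h, hzero _ fun j hj => by rw [signMatrix_swap hP F hj]; exact h j hj, add_zero]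
  · push Not at h
    obtain ⟨j, hj, hj0⟩ := h
    have hj0' : (F.swap hP m).signMatrix ι j (Fin.last n) ≠ 0 := by
      rwa [signMatrix_swap hP F hj]
    rw [if_neg fun hs => hj0 (hs.2 j hj), if_neg fun hs => hj0' (hs.2 j hj), sub_zero, sub_zero]
    have hsub : ((F.swap hP m).signMatrix ι).submatrix m.succAbove (Fin.last n).succAbove =
        (F.signMatrix ι).submatrix m.succAbove (Fin.last n).succAbove := by
      ext a b
      exact signMatrix_swap hP F (Fin.succAbove_ne m a) _
    have hfilter : (Finset.univ.filter fun j => j ≠ m ∧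
          (F.swap hP m).signMatrix ι j (Fin.last n) = 0) =
        Finset.univ.filter fun j => j ≠ m ∧ F.signMatrix ι j (Fin.last n) = 0 := by
      refine Finset.filter_congr fun k _ => ?_
      refine and_congr_right fun hk => ?_
      rw [signMatrix_swap hP F hk]
    unfold term
    rw [hfilter, orient_swap, F.lastSign_eq hP hj0, (F.swap hP m).lastSign_eq hP hj0',
      signMatrix_swap hP F hj, Matrix.adjugate_fin_succ_eq_det_submatrix,
      Matrix.adjugate_fin_succ_eq_det_submatrix, hsub]
    ring

end FaceChain

/-! ### Lifting chains from a coordinate section -/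

theorem coordProj_add_smul_e {k : Fin d} {x : E d} (hx : x k = 0) (r : ℝ) :
    coordProj k (x + r • e k) = x := by
  simp [coordProj, e_apply_self, hx]

theorem strictMono_insertNth {α : Type*} [Preorder α] {f : Fin (n + 1) → α} (hf : StrictMono f)
    {W : α} (m : Fin (n + 1)) (h1 : ∀ a < m, f a < W) (h2 : ∀ a, m ≤ a → W < f a) :
    StrictMono (m.castSucc.insertNth W f : Fin (n + 2) → α) := by
  intro i j hij
  rcases Fin.eq_self_or_eq_succAbove m.castSucc i with rfl | ⟨a, rfl⟩
  · obtain ⟨b, rfl⟩ := Fin.exists_succAbove_eq hij.ne'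
    rw [Fin.insertNth_apply_same, Fin.insertNth_apply_succAbove]
    rw [Fin.lt_succAbove_iff_le_castSucc] at hij
    exact h2 b (Fin.castSucc_le_castSucc_iff.1 hij)
  · rcases Fin.eq_self_or_eq_succAbove m.castSucc j with rfl | ⟨b, rfl⟩
    · rw [Fin.insertNth_apply_same, Fin.insertNth_apply_succAbove]
      rw [Fin.succAbove_lt_iff_castSucc_lt] at hij
      exact h1 a (Fin.castSucc_lt_castSucc_iff.1 hij)
    · rw [Fin.insertNth_apply_succAbove, Fin.insertNth_apply_succAbove]
      exact hf (Fin.succAbove_lt_succAbove_iff.1 hij)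

/-- The supporting functional of `F` composed with the projection exposes the preimage. -/
theorem isExposed_preimage {P F : Set (E d)} {k : Fin d} (hPk : ∀ x ∈ P, coordProj k x ∈ P)
    (hF : IsExposed ℝ (P ∩ {x | x k = 0}) F) :
    IsExposed ℝ P {x ∈ P | coordProj k x ∈ F} := by
  rintro ⟨z, hz⟩
  obtain ⟨l, M, hl, he⟩ := hF.exists_support ⟨_, hz.2⟩
  let l' : StrongDual ℝ (E d) := l - l (e k) • EuclideanSpace.proj k
  have hl' : ∀ x, l' x = l (coordProj k x) := by
    intro x
    rw [map_coordProj]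
    simp [l', mul_comm]
  have hex := isExposed_of_support (P := P) l' (M := M) (fun x hx => by
    rw [hl']
    exact hl _ ⟨hPk x hx, coordProj_apply_self _ _⟩)
  have heq : {x ∈ P | coordProj k x ∈ F} = {x ∈ P | l' x = M} := by
    ext x
    simp only [Set.mem_ofPred_eq, hl', he]
    constructor
    · rintro ⟨hx, -, h⟩
      exact ⟨hx, h⟩
    · rintro ⟨hx, h⟩
      exact ⟨hx, ⟨hPk x hx, coordProj_apply_self _ _⟩, h⟩
  rw [heq] at hz ⊢
  exact hex ⟨z, hz⟩

namespace FaceChain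

variable {P : Set (E d)} {ι : Fin (n + 1) → Fin d}

/-- Every chain of the section with the last coordinate hyperplane is the restriction of a chain
with a prescribed sign in the last coordinate. -/
theorem exists_restrict_eq (hP : IsLAB ι P)
    (G : FaceChain n (P ∩ {x | x (ι (Fin.last n)) = 0})) {σ : ℝ} (hσ : σ ≠ 0) :
    ∃ (F : FaceChain (n + 1) P) (m : Fin (n + 1)) (h : F.IsSole ι m),
      F.restrict hP m h = G ∧ F.signMatrix ι m (Fin.last n) = (SignType.sign σ : SignType) := by
  classical
  have hP' := hP.inter_coord
  have hσσ : 0 < σ * σ := mul_self_pos.2 hσ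
  obtain ⟨i, hi⟩ : ∃ i, i = ι (Fin.last n) := ⟨_, rfl⟩
  rw [← hi] at hP'
  let T : Fin (n + 1) → Set (E d) := fun a => G.face a
  have hTsub : ∀ a, T a ⊆ P ∩ {x | x i = 0} := fun a x hx => by
    rw [hi]
    exact G.subset a hx
  have hTexp : ∀ a, IsExposed ℝ (P ∩ {x | x i = 0}) (T a) := fun a => by
    rw [hi]
    exact G.exposed a
  let pre : Fin (n + 1) → Set (E d) := fun a => {x ∈ P | coordProj i x ∈ T a}
  have hpre : ∀ a, IsExposed ℝ P (pre a) := fun a =>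
    isExposed_preimage (fun x hx => hP.coordProj_mem x hx i) (hTexp a)
  have hTpre : ∀ a, T a ⊆ pre a := fun a x hx =>
    ⟨(hTsub a hx).1, by rwa [coordProj_of_eq_zero (hTsub a hx).2]⟩
  have hTlast : T (Fin.last n) = P ∩ {x | x i = 0} := by
    rw [hi]
    exact G.face_last hP.inter_coord
  have hext : ∃ a, ∃ x ∈ P, coordProj i x ∈ T a ∧ 0 < σ * x i := by
    refine ⟨Fin.last n, ?_⟩
    rw [hTlast]
    rcases lt_or_gt_of_ne hσ with h | h
    · obtain ⟨x, hx, hxi⟩ := hP.exists_neg (Fin.last n)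
      rw [← hi] at hxi
      exact ⟨x, hx, ⟨hP.coordProj_mem x hx i, coordProj_apply_self _ _⟩,
        mul_pos_of_neg_of_neg h hxi⟩
    · obtain ⟨x, hx, hxi⟩ := hP.exists_pos (Fin.last n)
      rw [← hi] at hxi
      exact ⟨x, hx, ⟨hP.coordProj_mem x hx i, coordProj_apply_self _ _⟩, mul_pos h hxi⟩
  -- `m` is the first index for which the preimage of `T m` has a point on the side of `σ`. The
  -- lifted chain keeps the faces `T a` before `m`, uses the preimages `pre a` from `m` on, and
  -- inserts one new face in between.
  obtain ⟨m, ⟨x, hxP, hxT, hxσ⟩, hmin⟩ := WellFounded.has_min (wellFounded_lt (α := Fin (n + 1)))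
    {a | ∃ x ∈ P, coordProj i x ∈ T a ∧ 0 < σ * x i} hext
  have hmin' : ∀ a < m, ∀ x ∈ P, coordProj i x ∈ T a → σ * x i ≤ 0 := by
    intro a ha x hx hxa
    by_contra hlt
    exact hmin a ⟨x, hx, hxa, not_le.1 hlt⟩ ha
  have hxi : x i ≠ 0 := fun h => by simp [h] at hxσ
  have hTmono : StrictMono T := G.strictMono
  -- Before `m` the preimage lies on the side opposite to `σ`, so its intersection with the
  -- hyperplane is extreme in it.
  have hTlow : ∀ a < m, IsExposed ℝ P (T a) := by
    intro a ha
    refine hP.isPolyhedron.isExposed_of_isExtreme ?_ ((hTexp a).convex hP'.convex)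
    refine (hpre a).isExtreme.trans ⟨hTpre a, ?_⟩
    rintro y hy z hz w hw ⟨α, β, hα, hβ, hαβ, rfl⟩
    have hy0 := hmin' a ha y hy.1 hy.2
    have hz0 := hmin' a ha z hz.1 hz.2
    have hw0 : α * y i + β * z i = 0 := by simpa using (hTsub a hw).2
    have h1 : α * (σ * y i) + β * (σ * z i) = 0 := by
      calc _ = σ * (α * y i + β * z i) := by ring
        _ = 0 := by rw [hw0, mul_zero]
    have h2 : α * (σ * y i) ≤ 0 := mul_nonpos_of_nonneg_of_nonpos hα.le hy0
    have h3 : β * (σ * z i) ≤ 0 := mul_nonpos_of_nonneg_of_nonpos hβ.le hz0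
    have h4 : α * (σ * y i) = 0 := by linarith
    have h5 : y i = 0 := by
      rcases mul_eq_zero.1 h4 with h | h
      · exact absurd h hα.ne'
      · exact (mul_eq_zero.1 h).resolve_left hσ
    have := hy.2
    rwa [coordProj_of_eq_zero h5] at this
  have hxm : coordProj i x ∈ pre m := hTpre m hxT
  have hbP : coordProj i x ∈ P := hxm.1
  have hb0 : coordProj i x i = 0 := coordProj_apply_self _ _
  have hray : coordProj i x + (x i / σ) • (σ • e i) ∈ P := by
    rw [smul_smul, div_mul_cancel₀ _ hσ, coordProj, sub_add_cancel]
    exact hxP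
  have hrpos : 0 < x i / σ := by
    rw [div_pos_iff]
    rcases pos_and_pos_or_neg_and_neg_of_mul_pos hxσ with h | h
    · exact Or.inl ⟨h.2, h.1⟩
    · exact Or.inr ⟨h.2, h.1⟩
  have hhighm : IsHigh i (pre m) := ⟨x, ⟨hxP, hxT⟩, hxi, hxm⟩
  -- The new face is the smallest face of `z`. It is not high since `z` cannot be pushed further
  -- along `σ • e i`.
  obtain ⟨z, hzP, hzσ, hzT, hzu, hzlow⟩ : ∃ z ∈ P, 0 < σ * z i ∧ z ∈ pre m ∧
      (∀ ε > (0 : ℝ), z + ε • (σ • e i) ∉ P) ∧ ∀ a < m, T a ⊆ faceAt P z := by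
    rcases Fin.eq_zero_or_eq_succ m with hm0 | ⟨p, hp⟩
    · have hu : σ • (e i : E d) ≠ 0 := by
        intro h
        have := congrArg (fun w : E d => w i) h
        simp [e_apply_self, hσ] at this
      obtain ⟨s, hs, hz, hmax⟩ := exists_last_on_ray hP.isCompact hbP hu
      have hs0 : 0 < s := hrpos.trans_le (hmax _ hray)
      refine ⟨_, hz, ?_, ⟨hz, ?_⟩, ?_, ?_⟩
      · simp only [PiLp.add_apply, PiLp.smul_apply, hb0, e_apply_self, smul_eq_mul]
        nlinarith [mul_pos hs0 hσσ]
      · rw [smul_smul, coordProj_add_smul_e hb0]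
        exact hxT
      · intro ε hε hmem
        rw [add_assoc, ← add_smul] at hmem
        have := hmax _ hmem
        linarith
      · intro a ha
        rw [hm0] at ha
        exact absurd ha (Fin.not_lt_zero a)
    · have hpm : p.castSucc < m := by rw [hp]; exact Fin.castSucc_lt_succ
      obtain ⟨a, ha, hTa⟩ := exists_eq_faceAt hP.isPolyhedron (hTlow _ hpm).isExtreme
        ((hTexp _).convex hP'.convex) (G.nonempty p.castSucc)
      have haP := (hTsub _ ha).1
      have ha0 : a i = 0 := (hTsub _ ha).2
      have hu : ∀ ε > (0 : ℝ), a + ε • (σ • e i) ∉ P := by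
        intro ε hε hmem
        have h1 := hmin' _ hpm _ hmem (by rw [smul_smul, coordProj_add_smul_e ha0]; exact ha)
        simp only [PiLp.add_apply, PiLp.smul_apply, ha0, e_apply_self, smul_eq_mul] at h1
        nlinarith [mul_pos hε hσσ]
      obtain ⟨s, hs, t, ht, hz, hzu, haz, hmax⟩ :=
        hP.isPolyhedron.exists_shoot haP hbP hu
      have hs0 : 0 < s := hrpos.trans_le (hmax _ hray)
      refine ⟨_, hz, ?_, ?_, hzu, ?_⟩
      · simp only [PiLp.add_apply, PiLp.smul_apply, PiLp.sub_apply, hb0, ha0, e_apply_self,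
          smul_eq_mul]
        have := mul_pos (mul_pos ht hs0) hσσ
        nlinarith
      · have ham : a ∈ pre m := hTpre m (hTmono.monotone hpm.le ha)
        obtain ⟨l, M, hl, he⟩ := (hpre m).exists_support ⟨_, hxm⟩
        rw [he] at hhighm ham hxm ⊢
        refine ⟨hz, ?_⟩
        simp [ham.2, hxm.2, hhighm.map_eq_zero]
      · intro b hb
        rw [hp, ← Fin.le_castSucc_iff] at hb
        refine (hTmono.monotone hb).trans ?_
        rw [hTa]
        exact faceAt_subset_of_isExtreme (isExposed_faceAt hP.isPolyhedron hz).isExtreme haz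
  have hzi : z i ≠ 0 := fun h => by simp [h] at hzσ
  have hW := isExposed_faceAt hP.isPolyhedron hzP
  have hzW := mem_faceAt_self hzP
  have hWhigh : ¬ IsHigh i (faceAt P z) := by
    intro hh
    obtain ⟨-, ε, hε, hmem⟩ := hh.coordProj_mem hP hW hzW
    refine hzu (ε * (z i / σ)) ?_ ?_
    · refine mul_pos hε ?_
      rw [div_pos_iff]
      rcases pos_and_pos_or_neg_and_neg_of_mul_pos hzσ with h | h
      · exact Or.inl ⟨h.2, h.1⟩
      · exact Or.inr ⟨h.2, h.1⟩
    · have : z + ε • (z - coordProj i z) = z + (ε * (z i / σ)) • (σ • e i) := by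
        rw [coordProj, sub_sub_cancel, smul_smul, smul_smul, mul_assoc, div_mul_cancel₀ _ hσ]
      rwa [← this]
  have hWpre : faceAt P z ⊆ pre m := faceAt_subset_of_isExtreme (hpre m).isExtreme hzT
  let f : Fin (n + 1) → Set (E d) := fun a => if a < m then T a else pre a
  have hfT : ∀ a, T a ⊆ f a := by
    intro a
    simp only [f]
    split_ifs
    · exact subset_rfl
    · exact hTpre a
  have hfpre : ∀ a, f a ⊆ pre a := by
    intro a
    simp only [f]
    split_ifs
    · exact hTpre a
    · exact subset_rfl
  have hpremono : Monotone pre := fun a b hab y hy => ⟨hy.1, hTmono.monotone hab hy.2⟩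
  have hf : StrictMono f := by
    intro a b hab
    obtain ⟨y, hyb, hya⟩ := Set.exists_of_ssubset (hTmono hab)
    have hsub : f a ⊆ f b := by
      by_cases hb : b < m
      · simp only [f, hb, hab.trans hb, if_true]
        exact hTmono.monotone hab.le
      · have : f b = pre b := by simp only [f, hb, if_false]
        rw [this]
        exact (hfpre a).trans (hpremono hab.le)
    refine ⟨hsub, fun hle => hya ?_⟩
    have := (hfpre a (hle (hfT b hyb))).2
    rwa [coordProj_of_eq_zero (hTsub b hyb).2] at this
  have hfW : ∀ a < m, f a < faceAt P z := by
    intro a ha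
    have : f a = T a := by simp only [f, ha, if_true]
    rw [this]
    exact LE.le.ssubset_of_ne (hzlow a ha) fun h => hzi (hTsub a (h ▸ hzW)).2
  have hWf : ∀ a, m ≤ a → faceAt P z < f a := by
    intro a ha
    have : f a = pre a := by simp only [f, ha.not_gt, if_false]
    rw [this]
    exact lt_of_lt_of_le (LE.le.ssubset_of_ne hWpre fun h => hWhigh (h ▸ hhighm))
      (hpremono ha)
  have hne : ∀ j, (m.castSucc.insertNth (α := fun _ => Set (E d)) (faceAt P z) f j).Nonempty := by
    intro j
    rcases Fin.eq_self_or_eq_succAbove m.castSucc j with rfl | ⟨a, rfl⟩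
    · rw [Fin.insertNth_apply_same]
      exact ⟨z, hzW⟩
    · rw [Fin.insertNth_apply_succAbove]
      exact (G.nonempty a).mono (hfT a)
  let F : FaceChain (n + 1) P :=
    { face := m.castSucc.insertNth (faceAt P z) f
      exposed := by
        intro j
        rcases Fin.eq_self_or_eq_succAbove m.castSucc j with rfl | ⟨a, rfl⟩
        · rw [Fin.insertNth_apply_same]
          exact hW
        · rw [Fin.insertNth_apply_succAbove]
          by_cases ha : a < m
          · simp only [f, ha, if_true]
            exact hTlow a ha
          · simp only [f, ha, if_false]
            exact hpre a
      nonempty_zero := hne 0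
      strictMono := strictMono_insertNth hf m hfW hWf }
  have hFm : F.face m.castSucc = faceAt P z :=
    Fin.insertNth_apply_same (α := fun _ => Set (E d)) m.castSucc (faceAt P z) f
  have hFa : ∀ a, F.face (m.castSucc.succAbove a) = f a := fun a =>
    Fin.insertNth_apply_succAbove (α := fun _ => Set (E d)) m.castSucc (faceAt P z) f a
  have hsign : F.signMatrix ι m (Fin.last n) = (SignType.sign (z i) : SignType) := by
    rw [signMatrix_apply, hFm, ← hi]
    exact faceSign_eq_sign hP hW hWhigh hzW hzi
  have hsole : F.IsSole ι m := by
    refine ⟨hsign ▸ signType_cast_ne_zero hzi, fun j hj => ?_⟩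
    obtain ⟨a, rfl⟩ := Fin.exists_succAbove_eq hj
    rw [signMatrix_apply, ← Fin.castSucc_succAbove_castSucc, hFa, ← hi]
    by_cases ha : a.castSucc < m
    · simp only [f, ha, if_true]
      exact faceSign_of_isLow fun y hy => (hTsub _ hy).2
    · simp only [f, ha, if_false]
      exact faceSign_of_isHigh (hhighm.mono (hpremono (not_lt.1 ha)))
  refine ⟨F, m, hsole, ?_, ?_⟩
  · ext1
    funext a
    rw [restrict_face, hFa]
    change f a ∩ {x | x (ι (Fin.last n)) = 0} = T a
    rw [← hi]
    by_cases ha : a < m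
    · simp only [f, ha, if_true]
      exact Set.inter_eq_left.2 fun y hy => (hTsub a hy).2
    · simp only [f, ha, if_false]
      ext y
      constructor
      · rintro ⟨hy, hy0⟩
        have := hy.2
        rwa [coordProj_of_eq_zero hy0] at this
      · exact fun hy => ⟨hTpre a hy, (hTsub a hy).2⟩
  · rw [hsign]
    exact (sign_cast_eq_of_mul_pos hzσ).symm

/-- A chain with a sole non-zero sign in the last coordinate is determined by this sign and by its
restriction. -/
theorem eq_of_restrict_eq (hP : IsLAB ι P) {F F' : FaceChain (n + 1) P} {m m' : Fin (n + 1)}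
    (h : F.IsSole ι m) (h' : F'.IsSole ι m') (hr : F.restrict hP m h = F'.restrict hP m' h')
    (hs : F.signMatrix ι m (Fin.last n) = F'.signMatrix ι m' (Fin.last n)) : F = F' ∧ m = m' := by
  have hface : ∀ a, F.face (m.castSucc.succAbove a) ∩ {x | x (ι (Fin.last n)) = 0} =
      F'.face (m'.castSucc.succAbove a) ∩ {x | x (ι (Fin.last n)) = 0} := fun a =>
    congrFun (congrArg FaceChain.face hr) a
  -- If `m < m'`, then the projection of `x` lies in the `m`-th face of `F'`, hence in the `m'`-th.
  -- This is impossible, because `x` has the sign of that face and the face is not high.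
  have key : ∀ {F F' : FaceChain (n + 1) P} {m m' : Fin (n + 1)} (_ : F.IsSole ι m)
      (_ : F'.IsSole ι m') (_ : ∀ a, F.face (m.castSucc.succAbove a) ∩
        {x | x (ι (Fin.last n)) = 0} = F'.face (m'.castSucc.succAbove a) ∩
        {x | x (ι (Fin.last n)) = 0})
      (_ : F.signMatrix ι m (Fin.last n) = F'.signMatrix ι m' (Fin.last n)), ¬ m < m' := by
    intro F F' m m' h h' hface hs hlt
    obtain ⟨x, hx, hx0, hxs, -⟩ := h.exists_point
    obtain ⟨z, hz, hz0, hzs, -⟩ := h'.exists_point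
    have hpos : 0 < x (ι (Fin.last n)) * z (ι (Fin.last n)) := by
      rw [hxs, hzs] at hs
      rcases lt_or_gt_of_ne hx0 with h1 | h1 <;> rcases lt_or_gt_of_ne hz0 with h2 | h2
      · exact mul_pos_of_neg_of_neg h1 h2
      · rw [sign_neg h1, sign_pos h2] at hs
        exact absurd hs (by decide)
      · rw [sign_pos h1, sign_neg h2] at hs
        exact absurd hs (by decide)
      · exact mul_pos h1 h2
    refine hP.not_coordProj_mem_of_sign (F'.exposed _) h'.not_isHigh (F.subset _ hx) hz hpos ?_
    have h1 : coordProj (ι (Fin.last n)) x ∈ F.face (m.castSucc.succAbove m) ∩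
        {x | x (ι (Fin.last n)) = 0} := by
      rw [Fin.succAbove_castSucc_self]
      exact ⟨(h.isHigh hP Fin.castSucc_lt_succ).coordProj_mem hP (F.exposed _)
        (F.strictMono.monotone (Fin.castSucc_lt_succ (i := m)).le hx), coordProj_apply_self _ _⟩
    rw [hface, Fin.succAbove_castSucc_of_lt m' m hlt] at h1
    exact F'.strictMono.monotone (Fin.castSucc_le_castSucc_iff.2 hlt.le) h1.1
  have hm : m = m' := le_antisymm (not_lt.1 (key h' h (fun a => (hface a).symm) hs.symm))
    (not_lt.1 (key h h' hface hs))
  subst hm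
  -- The faces other than the `m`-th are recovered from the section; the orientation, which the
  -- restriction and the sign determine, settles the remaining one.
  refine ⟨eq_of_orient_eq hP (m := m) (fun j hj => ?_) ?_, rfl⟩
  · obtain ⟨a, rfl⟩ := Fin.exists_succAbove_eq hj
    rcases lt_or_gt_of_ne hj with hlt | hlt
    · have h1 := hface a
      have h2 : ∀ {F : FaceChain (n + 1) P}, F.IsSole ι m → F.face (m.castSucc.succAbove a) ∩
          {x | x (ι (Fin.last n)) = 0} = F.face (m.castSucc.succAbove a) := fun h =>
        Set.inter_eq_left.2 fun x hx => h.isLow hlt x hx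
      rwa [h2 h, h2 h'] at h1
    · have key2 : ∀ {F F' : FaceChain (n + 1) P}, F.IsSole ι m → F'.IsSole ι m →
          F.face (m.castSucc.succAbove a) ∩ {x | x (ι (Fin.last n)) = 0} =
            F'.face (m.castSucc.succAbove a) ∩ {x | x (ι (Fin.last n)) = 0} →
          F.face (m.castSucc.succAbove a) ⊆ F'.face (m.castSucc.succAbove a) := by
        intro F F' h h' hface x hx
        refine (h'.isHigh hP hlt).mem_of_coordProj_mem (F'.exposed _) (F.subset _ hx) ?_
        have h1 : coordProj (ι (Fin.last n)) x ∈ F.face (m.castSucc.succAbove a) ∩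
            {x | x (ι (Fin.last n)) = 0} :=
          ⟨(h.isHigh hP hlt).coordProj_mem hP (F.exposed _) hx, coordProj_apply_self _ _⟩
        rw [hface] at h1
        exact h1.1
      exact subset_antisymm (key2 h h' (hface a)) (key2 h' h (hface a).symm)
  · rw [orient_restrict hP F m h, orient_restrict hP F' m h', hr, hs]

-- After the cancellation only pairs of a chain and its sole index remain. Restriction together with
-- the sign maps these bijectively onto the chains of the section times two signs, and each
-- contributes the factor `-(n + 1)`.
open Classical in
theorem sum_weight_succ (hP : IsLAB ι P) [Fintype (FaceChain (n + 1) P)]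
    [Fintype (FaceChain n (P ∩ {x | x (ι (Fin.last n)) = 0}))] :
    ∑ F : FaceChain (n + 1) P, F.weight ι = -(2 * (n + 1)) *
      ∑ G : FaceChain n (P ∩ {x | x (ι (Fin.last n)) = 0}), G.weight (ι ∘ Fin.castSucc) := by
  rw [Finset.sum_congr rfl fun F _ => F.weight_eq_sum_term hP, Finset.sum_comm,
    Finset.sum_congr rfl fun m _ => sum_term hP m]
  rw [Finset.sum_comm, ← Fintype.sum_prod_type', ← Finset.sum_filter]
  rw [Finset.sum_subtype (p := fun p : FaceChain (n + 1) P × Fin (n + 1) => p.1.IsSole ι p.2) _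
    (by simp)]
  let Θ : {p : FaceChain (n + 1) P × Fin (n + 1) // p.1.IsSole ι p.2} →
      FaceChain n (P ∩ {x | x (ι (Fin.last n)) = 0}) × Bool := fun p =>
    (p.1.1.restrict hP p.1.2 p.2, decide (0 < p.1.1.signMatrix ι p.1.2 (Fin.last n)))
  have hΘ : Function.Bijective Θ := by
    constructor
    · rintro ⟨⟨F, m⟩, h⟩ ⟨⟨F', m'⟩, h'⟩ heq
      simp only [Θ, Prod.mk.injEq, decide_eq_decide] at heq
      have hs : F.signMatrix ι m (Fin.last n) = F'.signMatrix ι m' (Fin.last n) := by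
        have h1 := faceSign_mul_self h.1
        have h2 := faceSign_mul_self h'.1
        have h3 := heq.2
        simp only [signMatrix_apply] at h3 ⊢
        rcases mul_self_eq_one_iff.1 h1 with h4 | h4 <;>
          rcases mul_self_eq_one_iff.1 h2 with h5 | h5 <;> rw [h4, h5] at h3 ⊢ <;>
          norm_num at h3
      obtain ⟨rfl, rfl⟩ := eq_of_restrict_eq hP h h' heq.1 hs
      rfl
    · rintro ⟨G, b⟩
      cases b
      · obtain ⟨F, m, h, hr, hs⟩ := exists_restrict_eq hP G (σ := -1) (by norm_num)
        refine ⟨⟨(F, m), h⟩, ?_⟩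
        simp only [Θ, hr, hs]
        simp
      · obtain ⟨F, m, h, hr, hs⟩ := exists_restrict_eq hP G (σ := 1) (by norm_num)
        refine ⟨⟨(F, m), h⟩, ?_⟩
        simp only [Θ, hr, hs]
        simp
  rw [Fintype.sum_bijective Θ hΘ _ (fun q => -((n : ℤ) + 1) * q.1.weight (ι ∘ Fin.castSucc))
    fun p => p.1.1.term_of_isSole hP p.1.2 p.2]
  rw [Fintype.sum_prod_type]
  simp only [Finset.sum_const, Finset.card_univ, Fintype.card_bool, Finset.mul_sum]
  refine Finset.sum_congr rfl fun G _ => ?_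
  rw [nsmul_eq_mul]
  push_cast
  ring

end FaceChain

/-- Cutting by one coordinate hyperplane at a time, each step yields a factor of absolute value `2 *
(n + 1)`. At `n = 0` the polytope is the origin, with one chain and an empty sign matrix. -/
theorem abs_sum_weight : ∀ (n : ℕ) (ι : Fin n → Fin d) (P : Set (E d)), IsLAB ι P →
    ∀ [Fintype (FaceChain n P)],
      |∑ F : FaceChain n P, F.weight ι| = 2 ^ n * (n.factorial : ℤ)
  | 0, ι, P, hP, _ => by
    have hP0 : ∀ x ∈ P, x = 0 := by
      intro x hx
      ext j
      exact hP.apply_eq_zero x hx j (by simp)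
    have huniq : ∀ F : FaceChain 0 P, ∀ j, F.face j = P := by
      intro F j
      have hj : j = Fin.last 0 := Subsingleton.elim (α := Fin 1) _ _
      rw [hj]
      exact F.face_last hP
    have : Unique (FaceChain 0 P) :=
      { default :=
          { face := fun _ => P
            exposed := fun _ => IsExposed.refl P
            nonempty_zero := hP.nonempty
            strictMono := Subsingleton.strictMono (α := Fin 1) _ }
        uniq := fun F => by
          ext1
          funext j
          exact huniq F j }
    rw [Fintype.sum_unique, FaceChain.weight, abs_mul, FaceChain.abs_orient hP]
    simp
  | n + 1, ι, P, hP, _ => by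
    have := FaceChain.finite (n := n) hP.inter_coord.isPolyhedron
    let _ := Fintype.ofFinite (FaceChain n (P ∩ {x | x (ι (Fin.last n)) = 0}))
    rw [FaceChain.sum_weight_succ hP, abs_mul, abs_sum_weight n _ _ hP.inter_coord, abs_neg,
      abs_of_nonneg (by positivity), Nat.factorial_succ, pow_succ]
    push_cast
    ring

/-! ### The equality case: nonsingular polytopes -/

/-- If the number of chains is minimal, then all sign matrices are invertible. -/
theorem IsLAB.det_ne_zero {ι : Fin n → Fin d} {P : Set (E d)} (hP : IsLAB ι P)
    (hcard : Nat.card (FaceChain n P) ≤ 2 ^ n * n.factorial) (F : FaceChain n P) :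
    (F.signMatrix ι).det ≠ 0 := by
  classical
  intro h0
  have := FaceChain.finite (n := n) hP.isPolyhedron
  let _ := Fintype.ofFinite (FaceChain n P)
  have h1 := abs_sum_weight n ι P hP
  -- Every chain contributes at most 1 in absolute value and `F` contributes nothing, so the total
  -- falls short of the required value.
  have h2 : |∑ G : FaceChain n P, G.weight ι| ≤ ∑ G : FaceChain n P, if G = F then 0 else 1 := by
    refine (Finset.abs_sum_le_sum_abs _ _).trans (Finset.sum_le_sum fun G _ => ?_)
    split_ifs with h
    · rw [h, FaceChain.weight, h0]
      simp
    · rw [FaceChain.weight, abs_mul, G.abs_orient hP, one_mul]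
      exact G.abs_det_signMatrix_le hP
  have h3 : (∑ G : FaceChain n P, if G = F then (0 : ℤ) else 1) = Nat.card (FaceChain n P) - 1 := by
    have : ∀ G : FaceChain n P, (if G = F then (0 : ℤ) else 1) = 1 - if G = F then 1 else 0 := by
      intro G
      split_ifs <;> rfl
    rw [Finset.sum_congr rfl fun G _ => this G, Finset.sum_sub_distrib]
    simp [Nat.card_eq_fintype_card]
  rw [h1, h3] at h2
  have : ((Nat.card (FaceChain n P) : ℕ) : ℤ) ≤ 2 ^ n * (n.factorial : ℤ) := by exact_mod_cast hcard
  linarith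

/-- All sign matrices of chains are invertible. -/
def IsNonsingular (ι : Fin n → Fin d) (P : Set (E d)) : Prop :=
  ∀ F : FaceChain n P, (F.signMatrix ι).det ≠ 0

/-- The sign matrix of a lifted chain has one non-zero entry in its last column, and the
complementary minor is the sign matrix of the given chain. -/
theorem IsNonsingular.inter_coord {ι : Fin (n + 1) → Fin d} {P : Set (E d)} (hP : IsLAB ι P)
    (hN : IsNonsingular ι P) :
    IsNonsingular (ι ∘ Fin.castSucc) (P ∩ {x | x (ι (Fin.last n)) = 0}) := by
  intro G hG
  obtain ⟨F, m, h, rfl, -⟩ := FaceChain.exists_restrict_eq hP G (σ := 1) one_ne_zero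
  apply hN F
  rw [FaceChain.signMatrix_restrict] at hG
  rw [Matrix.det_succ_column _ (Fin.last n), Finset.sum_eq_single m]
  · rw [Fin.succAbove_last, hG, mul_zero]
  · intro j _ hj
    rw [h.2 j hj]
    ring
  · simp

/-! ### Refinement of chains -/

/-- Suppose there is no such face. For each `y` in `B` outside `A`, shooting away from `y` gives a
point `z` whose smallest face contains `A` and misses `y`, so `z` must lie in `A`. Then `y - a` is a
combination of `b - a` and a direction of `A`, so `B` has at most one dimension more than `A`. -/
theorem exists_exposed_between {P A B : Set (E d)} (hP : IsPolyhedron P) (hA : IsExposed ℝ P A)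
    (hB : IsExposed ℝ P B) (hne : A.Nonempty) (hAB : A ⊂ B) (hdim : affDim A + 2 ≤ affDim B) :
    ∃ W, IsExposed ℝ P W ∧ A ⊂ W ∧ W ⊂ B := by
  by_contra hno
  push Not at hno
  obtain ⟨a, ha, hAa⟩ := exists_eq_faceAt hP hA.isExtreme (hA.convex hP.convex) hne
  obtain ⟨b, hb, hbA⟩ := Set.exists_of_ssubset hAB
  have haP := hA.subset ha
  have hbP := hB.subset hb
  have key : ∀ y ∈ B, y - a ∈ Submodule.span ℝ {b - a} ⊔ vectorSpan ℝ A := by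
    intro y hy
    by_cases hyA : y ∈ A
    · exact Submodule.mem_sup_right (vsub_mem_vectorSpan ℝ hyA ha)
    obtain ⟨s, hs, t, ht, hz, haz, hyz⟩ := hP.exists_faceAt_notMem haP hbP (hB.subset hy)
      (hAa ▸ hyA)
    set z := a + t • (b + s • (a - y) - a) with hzdef
    have hzB : z ∈ B := by
      obtain ⟨l, M, hl, he⟩ := hB.exists_support ⟨b, hb⟩
      rw [he] at hb hy ⊢
      have haB : a ∈ B := hAB.subset ha
      rw [he] at haB
      refine ⟨hz, ?_⟩
      simp [hzdef, hb.2, hy.2, haB.2]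
    have hWB : faceAt P z ⊆ B := faceAt_subset_of_isExtreme hB.isExtreme hzB
    have hAW : A ⊆ faceAt P z := by
      rw [hAa]
      exact faceAt_subset_of_isExtreme (isExposed_faceAt hP hz).isExtreme haz
    have hzA : z ∈ A := by
      by_contra hzA
      refine hno (faceAt P z) (isExposed_faceAt hP hz)
        (LE.le.ssubset_of_ne hAW fun h => hzA (h ▸ mem_faceAt_self hz))
        (LE.le.ssubset_of_ne hWB fun h => hyz (h ▸ hy))
    have hs0 : s ≠ 0 := by
      rintro rfl
      obtain ⟨l, M, hl, he⟩ := hA.exists_support hne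
      apply hbA
      rw [he] at ha hzA ⊢
      refine ⟨hbP, ?_⟩
      have h1 := hzA.2
      simp only [hzdef, zero_smul, add_zero, map_add, map_smul, map_sub, ha.2, smul_eq_mul] at h1
      have h2 : t * (l b - M) = 0 := by linarith
      rcases mul_eq_zero.1 h2 with h | h <;> linarith
    have hya : y - a = s⁻¹ • (b - a) - (t * s)⁻¹ • (z - a) := by
      have h1 : z - a = (t * s) • (s⁻¹ • (b - a) - (y - a)) := by
        rw [smul_sub, smul_smul, mul_assoc, mul_inv_cancel₀ hs0, hzdef]
        module
      rw [h1, smul_smul, inv_mul_cancel₀ (mul_ne_zero ht.ne' hs0)]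
      module
    rw [hya]
    exact Submodule.sub_mem _
      (Submodule.mem_sup_left (Submodule.smul_mem _ _ (Submodule.mem_span_singleton_self _)))
      (Submodule.mem_sup_right (Submodule.smul_mem _ _ (vsub_mem_vectorSpan ℝ hzA ha)))
  have hle : vectorSpan ℝ B ≤ Submodule.span ℝ {b - a} ⊔ vectorSpan ℝ A := by
    rw [vectorSpan_eq_span_vsub_set_right ℝ (hAB.subset ha), Submodule.span_le]
    rintro _ ⟨y, hy, rfl⟩
    exact key y hy
  have h1 := Submodule.finrank_mono hle
  have h2 := Submodule.finrank_add_le_finrank_add_finrank (Submodule.span ℝ {b - a})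
    (vectorSpan ℝ A)
  have h3 : Module.finrank ℝ (Submodule.span ℝ {b - a}) ≤ 1 := by
    simpa using finrank_span_le_card (R := ℝ) ({b - a} : Set (E d))
  unfold affDim at hdim
  omega

theorem exists_exposed_covBy {P B : Set (E d)} (hP : IsPolyhedron P) (hB : IsExposed ℝ P B)
    {A : Set (E d)} (hA : IsExposed ℝ P A) (hne : A.Nonempty) (hAB : A ⊂ B) :
    ∃ W, IsExposed ℝ P W ∧ A ⊆ W ∧ W ⊂ B ∧ affDim W + 1 = affDim B := by
  obtain ⟨k, hk⟩ : ∃ k, affDim B - affDim A = k := ⟨_, rfl⟩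
  induction k using Nat.strong_induction_on generalizing A with
  | _ k ih =>
    have hlt := affDim_lt_of_ssubset hA hB.subset hne hAB
    by_cases h : affDim A + 1 = affDim B
    · exact ⟨A, hA, subset_rfl, hAB, h⟩
    obtain ⟨W, hW, hAW, hWB⟩ := exists_exposed_between hP hA hB hne hAB (by omega)
    have h1 := affDim_lt_of_ssubset hA hW.subset hne hAW
    have h2 := affDim_lt_of_ssubset hW hB.subset (hne.mono hAW.subset) hWB
    obtain ⟨V, hV, h3, h4, h5⟩ := ih _ (by omega) hW (hne.mono hAW.subset) hWB rfl
    exact ⟨V, hV, hAW.subset.trans h3, h4, h5⟩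

theorem exists_chain {P A : Set (E d)} (hP : IsPolyhedron P) (hA : IsExposed ℝ P A)
    (hne : A.Nonempty) : ∀ (k : ℕ) {B : Set (E d)}, IsExposed ℝ P B → A ⊆ B →
    affDim B = affDim A + k → ∃ f : Fin (k + 1) → Set (E d),
      f 0 = A ∧ f (Fin.last k) = B ∧ StrictMono f ∧ ∀ j, IsExposed ℝ P (f j)
  | 0, B, hB, hAB, hdim => by
    have : A = B := by
      by_contra h
      have := affDim_lt_of_ssubset hA hB.subset hne (LE.le.ssubset_of_ne hAB h)
      omega
    exact ⟨fun _ => A, rfl, this, Subsingleton.strictMono (α := Fin 1) _, fun _ => hA⟩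
  | k + 1, B, hB, hAB, hdim => by
    have hAB' : A ⊂ B := LE.le.ssubset_of_ne hAB fun h => by
      rw [h] at hdim
      omega
    obtain ⟨W, hW, hAW, hWB, hWdim⟩ := exists_exposed_covBy hP hB hA hne hAB'
    obtain ⟨f, h0, hl, hf, hex⟩ := exists_chain hP hA hne k hW hAW (by omega)
    refine ⟨Fin.snoc (α := fun _ => Set (E d)) f B, ?_, by simp, ?_, ?_⟩
    · rw [← h0, ← Fin.castSucc_zero, Fin.snoc_castSucc]
    · rw [Fin.strictMono_iff_lt_succ]
      intro i
      rw [Fin.snoc_castSucc]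
      induction i using Fin.lastCases with
      | last =>
        rw [Fin.succ_last, Fin.snoc_last, hl]
        exact hWB
      | cast i =>
        rw [Fin.succ_castSucc, Fin.snoc_castSucc]
        exact hf Fin.castSucc_lt_succ
    · intro j
      induction j using Fin.lastCases with
      | last => simpa using hB
      | cast j => simpa using hex j

theorem affDim_singleton (v : E d) : affDim {v} = 0 := by
  simp [affDim]

/-- The sum of the weights is not zero, so a full chain exists, and its last face `P` has dimension
`n`. -/
theorem IsLAB.affDim_eq {ι : Fin n → Fin d} {P : Set (E d)} (hP : IsLAB ι P) : affDim P = n := by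
  have := FaceChain.finite (n := n) hP.isPolyhedron
  let _ := Fintype.ofFinite (FaceChain n P)
  have h := abs_sum_weight n ι P hP
  have hne : Nonempty (FaceChain n P) := by
    by_contra hne
    rw [not_nonempty_iff] at hne
    rw [Fintype.sum_empty, abs_zero] at h
    have : (0 : ℤ) < 2 ^ n * (n.factorial : ℤ) := by positivity
    omega
  obtain ⟨F⟩ := hne
  have h1 := F.affDim_face hP (Fin.last n)
  rwa [F.face_last hP] at h1

/-- This brings invertibility to bear on a given vertex and face: `M` is enlarged to a facet, which
is joined to the vertex by a chain. -/
theorem IsLAB.exists_faceChain {ι : Fin (n + 1) → Fin d} {P : Set (E d)} (hP : IsLAB ι P)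
    {v : E d} {M : Set (E d)} (hv : IsExposed ℝ P {v}) (hM : IsExposed ℝ P M) (hMP : M ≠ P)
    (hvM : v ∈ M) : ∃ F : FaceChain (n + 1) P,
      F.face 0 = {v} ∧ M ⊆ F.face (Fin.last n).castSucc := by
  obtain ⟨W, hW, hMW, hWP, hdim⟩ := exists_exposed_covBy hP.isPolyhedron (IsExposed.refl P) hM
    ⟨v, hvM⟩ (LE.le.ssubset_of_ne hM.subset hMP)
  rw [hP.affDim_eq] at hdim
  obtain ⟨f, h0, hl, hf, hex⟩ := exists_chain hP.isPolyhedron hv (Set.singleton_nonempty v) n hW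
    (Set.singleton_subset_iff.2 (hMW hvM)) (by rw [affDim_singleton]; omega)
  refine ⟨⟨Fin.snoc (α := fun _ => Set (E d)) f P, ?_, ?_, ?_⟩, ?_, ?_⟩
  · intro j
    induction j using Fin.lastCases with
    | last => simpa using IsExposed.refl P
    | cast j => simpa using hex j
  · rw [← Fin.castSucc_zero, Fin.snoc_castSucc, h0]
    exact Set.singleton_nonempty v
  · rw [Fin.strictMono_iff_lt_succ]
    intro i
    rw [Fin.snoc_castSucc]
    induction i using Fin.lastCases with
    | last =>
      rw [Fin.succ_last, Fin.snoc_last, hl]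
      exact hWP
    | cast i =>
      rw [Fin.succ_castSucc, Fin.snoc_castSucc]
      exact hf Fin.castSucc_lt_succ
  · change (Fin.snoc (α := fun _ => Set (E d)) f P : Fin (n + 2) → Set (E d)) 0 = {v}
    rw [← Fin.castSucc_zero, Fin.snoc_castSucc, h0]
  · change M ⊆ (Fin.snoc (α := fun _ => Set (E d)) f P : Fin (n + 2) → Set (E d)) _
    rwa [Fin.snoc_castSucc, hl]

/-! ### Vertices of nonsingular polytopes -/

/-- In a nonsingular polytope, a facet through a vertex is supported by a functional with at most
one coordinate in common with the vertex. -/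
theorem IsNonsingular.eq_of_ne_zero {ι : Fin (n + 1) → Fin d} {P : Set (E d)} (hP : IsLAB ι P)
    (hN : IsNonsingular ι P) (F : FaceChain (n + 1) P) {v : E d} (hv : v ∈ F.face 0)
    {l : StrongDual ℝ (E d)} {M : ℝ} (he : F.face (Fin.last n).castSucc = {x ∈ P | l x = M})
    {c c' : Fin (n + 1)} (hc : l (e (ι c)) ≠ 0) (hvc : v (ι c) ≠ 0) (hc' : l (e (ι c')) ≠ 0)
    (hvc' : v (ι c') ≠ 0) : c = c' := by
  classical
  by_contra hne
  apply hN F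
  have h1 := F.signMatrix_eq_sign hP hv he hc hvc
  have h2 := F.signMatrix_eq_sign hP hv he hc' hvc'
  set τ : ℤ := ((SignType.sign (v (ι c)) : SignType) : ℤ)
  set τ' : ℤ := ((SignType.sign (v (ι c')) : SignType) : ℤ) with hτ'
  -- The columns `c` and `c'` are constant, equal to `τ` and `τ'`, which gives an explicit kernel
  -- vector.
  rw [← Matrix.exists_mulVec_eq_zero_iff]
  refine ⟨τ' • Pi.single c 1 - τ • Pi.single c' 1, fun h => ?_, ?_⟩
  · have := congrFun h c
    simp only [Pi.sub_apply, Pi.smul_apply, Pi.single_eq_same, Pi.single_eq_of_ne hne,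
      smul_eq_mul, mul_one, mul_zero, sub_zero, Pi.zero_apply] at this
    exact signType_cast_ne_zero hvc' (hτ' ▸ this)
  · ext m
    rw [Matrix.mulVec_sub, Matrix.mulVec_smul, Matrix.mulVec_smul, Matrix.mulVec_single_one,
      Matrix.mulVec_single_one]
    simp [h1 m, h2 m, mul_comm]

/-- Otherwise `z` could be extended away from a small multiple of `-u` in `P`; shrinking the result
towards the origin gives a feasible step from `z` along `u`. -/
theorem IsLAB.faceAt_ne {ι : Fin n → Fin d} {P : Set (E d)} (hP : IsLAB ι P) {z u : E d}
    (hu : ∀ j, j ∉ Set.range ι → u j = 0) (hz : ∀ ε > (0 : ℝ), z + ε • u ∉ P) :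
    faceAt P z ≠ P := by
  intro h
  obtain ⟨η, hη, hmem⟩ := hP.exists_smul_mem (w := -u) fun j hj => by simp [hu j hj]
  rw [← h] at hmem
  obtain ⟨-, δ, hδ, hmem⟩ := hmem
  have h1 : (1 + δ) ≠ 0 := by positivity
  refine hz (δ / (1 + δ) * η) (by positivity) ?_
  have := hP.convex hmem hP.zero_mem (a := 1 / (1 + δ)) (b := δ / (1 + δ)) (by positivity)
    (by positivity) (by field_simp)
  convert this using 1
  have h2 : z = (1 / (1 + δ)) • z + (δ / (1 + δ)) • z := by
    rw [← add_smul, ← add_div, div_self h1, one_smul]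
  have h3 : δ / (1 + δ) = 1 / (1 + δ) * δ := by ring
  nth_rewrite 1 [h2]
  rw [h3]
  module

/-- A vertex of a nonsingular polytope maximizes each coordinate functional in its support. -/
theorem IsNonsingular.vertex_mul_le {ι : Fin (n + 1) → Fin d} {P : Set (E d)} (hP : IsLAB ι P)
    (hN : IsNonsingular ι P) {v p : E d} (hv : IsExposed ℝ P {v}) (hp : p ∈ P)
    {c : Fin (n + 1)} (hvc : v (ι c) ≠ 0) : v (ι c) * p (ι c) ≤ v (ι c) * v (ι c) := by
  by_contra hlt
  push Not at hlt
  set k := ι c with hk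
  have hvP : v ∈ P := hv.subset rfl
  have hq : p k • e k ∈ P := hP.smul_e_mem hp k
  have hvk : v k • e k ∈ P := hP.smul_e_mem hvP k
  set v' := coordProj k v with hv'
  have hv'P : v' ∈ P := hP.coordProj_mem v hvP k
  have hvv : v = v' + v k • e k := by simp [hv', coordProj]
  have hext : ∀ {x y : E d}, x ∈ P → y ∈ P → v ∈ openSegment ℝ x y → x = v := fun hx hy h =>
    hv.isExtreme.left_mem_of_mem_openSegment hx hy rfl h
  have hvpos : 0 < v k * v k := mul_self_pos.2 hvc
  have hΔ : 0 < (p k - v k) / v k := by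
    have : (p k - v k) / v k = (v k * p k - v k * v k) / (v k * v k) := by
      field_simp
    rw [this]
    exact div_pos (by linarith) hvpos
  have hek : v k • e k ≠ (0 : E d) := fun h => by
    have := congrArg (fun x : E d => x k) h
    simp [e_apply_self, hvc] at this
  -- `v` would lie strictly between its projection `v'` and the new point.
  have hstep : ∀ t > (0 : ℝ), v + (t * (p k - v k)) • e k ∉ P := by
    intro t ht hmem
    have h1 : v + (t * ((p k - v k) / v k)) • (v - v') ∈ P := by
      convert hmem using 2
      rw [hvv, add_sub_cancel_left, smul_smul]
      congr 1
      rw [← hvv]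
      field_simp
    have h2 := hext hv'P h1 (mem_openSegment_extension (by positivity))
    rw [h2] at hvv
    exact hek (by simpa using hvv)
  -- Here `v` would lie strictly between `v k • e k` and the new point. As `v` is a vertex, this
  -- leaves `v' = 0`, and then `p k • e k` contradicts `hstep`.
  have hu : ∀ ε > (0 : ℝ), v + ε • v' ∉ P := by
    intro ε hε hmem
    have h1 : v + ε • (v - v k • e k) ∈ P := by rwa [hv', coordProj] at hmem
    have h2 := hext hvk h1 (mem_openSegment_extension hε)
    have hv'0 : v' = 0 := by
      rw [h2] at hvv
      simpa using hvv
    refine hstep 1 one_pos ?_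
    convert hq using 1
    nth_rewrite 1 [← h2]
    module
  obtain ⟨s, hs, t, ht, hz, hzu, hvz, -⟩ := hP.isPolyhedron.exists_shoot hvP hq hu
  set z := v + t • (p k • e k + s • v' - v) with hzdef
  have hzeq : z = (v k + t * (p k - v k)) • e k + (1 + t * (s - 1)) • v' := by
    rw [hzdef]
    nth_rewrite 1 2 [hvv]
    module
  have hzk : z k = v k + t * (p k - v k) := by
    rw [hzeq]
    simp [e_apply_self, hv', coordProj_apply_self]
  -- For `s ≥ 1` the coefficient of `v'` in `z` is at least 1. A convex combination of `z` and `z k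
  -- • e k` brings it down to 1, which gives a point excluded by `hstep`.
  have hs1 : s < 1 := by
    by_contra hs1
    push Not at hs1
    have hκ : 1 ≤ 1 + t * (s - 1) := by nlinarith
    have h0 : (0 : ℝ) < 1 + t * (s - 1) := by linarith
    apply hstep t ht
    have hzk' := hP.smul_e_mem hz k
    rw [hzk] at hzk'
    have := hP.convex hz hzk' (a := (1 + t * (s - 1))⁻¹) (b := 1 - (1 + t * (s - 1))⁻¹)
      (by positivity) (sub_nonneg.2 (inv_le_one_of_one_le₀ hκ)) (by ring)
    convert this using 1
    rw [hzeq, smul_add, smul_smul _ _ v', inv_mul_cancel₀ h0.ne']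
    nth_rewrite 1 [hvv]
    module
  have hvM := hvz
  have hMe := isExposed_faceAt hP.isPolyhedron hz
  have hMP : faceAt P z ≠ P := hP.faceAt_ne (hP.apply_eq_zero v' hv'P) hzu
  obtain ⟨F, hF0, hFM⟩ := hP.exists_faceChain hv hMe hMP hvM
  obtain ⟨f, m, hm, hf, he⟩ := F.exists_support_pos hP
  have hfv : f v = m := by
    have := hFM hvM
    rw [he] at this
    exact this.2
  have hfz : f z = m := by
    have := hFM (mem_faceAt_self hz)
    rw [he] at this
    exact this.2
  have hfv' : f v = f v' + v k * f (e k) := by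
    conv_lhs => rw [hvv]
    simp
  -- The facet functional `f` takes the same value at `v` and `z`. This relation makes both `f (e
  -- k)` and `f v'` non-zero, so `f` shares with `v` the coordinate `k` and another one.
  have hrel : (p k - v k) * f (e k) = (1 - s) * f v' := by
    have h1 : f z = f v + t * (p k * f (e k) + s * f v' - f v) := by simp [hzdef]
    have h2 : t * (p k * f (e k) + s * f v' - f v) = 0 := by linarith
    have h3 := (mul_eq_zero.1 h2).resolve_left ht.ne'
    linarith
  have hfk : f (e k) ≠ 0 := by
    intro h
    rw [h, mul_zero] at hrel
    have := (mul_eq_zero.1 hrel.symm).resolve_left (by linarith)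
    rw [this, h] at hfv'
    simp at hfv'
    linarith
  have hpv : p k - v k ≠ 0 := fun h => by simp [h] at hΔ
  have hfv0 : f v' ≠ 0 := by
    intro h
    rw [h, mul_zero] at hrel
    exact mul_ne_zero hpv hfk hrel
  obtain ⟨c', hc'⟩ : ∃ c', v' (ι c') * f (e (ι c')) ≠ 0 := by
    by_contra hno
    push Not at hno
    apply hfv0
    rw [hP.map_eq_sum f hv'P]
    exact Finset.sum_eq_zero fun c' _ => by rw [mul_comm]; exact hno c'
  have hne : c' ≠ c := by
    rintro rfl
    apply hc'
    rw [← hk, hv', coordProj_apply_self, zero_mul]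
  have hvc' : v (ι c') ≠ 0 := by
    have := left_ne_zero_of_mul hc'
    rwa [hv', coordProj_apply_of_ne (hk ▸ fun h => hne (hP.injective h))] at this
  exact hne (hN.eq_of_ne_zero hP F (hF0 ▸ rfl) he (right_ne_zero_of_mul hc') hvc' hfk hvc)

/-! ### Sections by coordinate subspaces -/

theorem IsLAB.comp_perm {ι : Fin n → Fin d} {P : Set (E d)} (hP : IsLAB ι P)
    (σ : Equiv.Perm (Fin n)) : IsLAB (ι ∘ σ) P where
  injective := hP.injective.comp σ.injective
  isCompact := hP.isCompact
  isPolyhedron := hP.isPolyhedron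
  nonempty := hP.nonempty
  apply_eq_zero x hx j hj := hP.apply_eq_zero x hx j (by rwa [σ.surjective.range_comp] at hj)
  coordProj_mem := hP.coordProj_mem
  exists_pos k := hP.exists_pos (σ k)
  exists_neg k := hP.exists_neg (σ k)

theorem IsNonsingular.comp_perm {ι : Fin n → Fin d} {P : Set (E d)} (hN : IsNonsingular ι P)
    (σ : Equiv.Perm (Fin n)) : IsNonsingular (ι ∘ σ) P := by
  intro F
  have h : F.signMatrix (ι ∘ σ) = (F.signMatrix ι).submatrix id σ := rfl
  rw [h, Matrix.det_permute']
  exact mul_ne_zero (by simp) (hN F)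

/-- `P` is a locally anti-blocking polytope spanning the coordinate subspace with coordinates in
`K`, and its sign matrices are invertible. -/
def IsNonsingularOn (K : Set (Fin d)) (P : Set (E d)) : Prop :=
  ∃ (n : ℕ) (ι : Fin n → Fin d), Set.range ι = K ∧ IsLAB ι P ∧ IsNonsingular ι P

namespace IsNonsingularOn

variable {K : Set (Fin d)} {P : Set (E d)}

theorem isCompact (h : IsNonsingularOn K P) : IsCompact P := by
  obtain ⟨n, ι, -, hP, -⟩ := h
  exact hP.isCompact

theorem isPolyhedron (h : IsNonsingularOn K P) : IsPolyhedron P := by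
  obtain ⟨n, ι, -, hP, -⟩ := h
  exact hP.isPolyhedron

theorem zero_mem (h : IsNonsingularOn K P) : (0 : E d) ∈ P := by
  obtain ⟨n, ι, -, hP, -⟩ := h
  exact hP.zero_mem

theorem sum_mem (h : IsNonsingularOn K P) {x : E d} (hx : x ∈ P) (S : Finset (Fin d)) :
    ∑ k ∈ S, x k • e k ∈ P := by
  obtain ⟨n, ι, -, hP, -⟩ := h
  exact hP.sum_mem hx S

theorem apply_eq_zero (h : IsNonsingularOn K P) {x : E d} (hx : x ∈ P) {j : Fin d} (hj : j ∉ K) :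
    x j = 0 := by
  obtain ⟨n, ι, rfl, hP, -⟩ := h
  exact hP.apply_eq_zero x hx j hj

/-- Coordinates may be permuted, so `i` can be taken to be the last one. -/
theorem inter_coord (h : IsNonsingularOn K P) {i : Fin d} (hi : i ∈ K) :
    IsNonsingularOn (K \ {i}) (P ∩ {x | x i = 0}) := by
  obtain ⟨n, ι, rfl, hP, hN⟩ := h
  obtain ⟨c, rfl⟩ := hi
  cases n with
  | zero => exact c.elim0
  | succ n =>
    let σ : Equiv.Perm (Fin (n + 1)) := Equiv.swap (Fin.last n) c
    have hlast : (ι ∘ σ) (Fin.last n) = ι c := by simp [σ]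
    have hP' := hP.comp_perm σ
    have hL := hP'.inter_coord
    have hS := (hN.comp_perm σ).inter_coord hP'
    rw [hlast] at hL hS
    refine ⟨n, (ι ∘ σ) ∘ Fin.castSucc, ?_, hL, hS⟩
    rw [← σ.surjective.range_comp ι, ← hlast]
    ext j
    constructor
    · rintro ⟨m, rfl⟩
      refine ⟨⟨_, rfl⟩, fun h => ?_⟩
      exact (Fin.castSucc_lt_last m).ne (hP'.injective h)
    · rintro ⟨⟨m, rfl⟩, hm⟩
      induction m using Fin.lastCases with
      | last => exact absurd rfl hm
      | cast m => exact ⟨m, rfl⟩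

theorem inter_coords (h : IsNonsingularOn K P) (S : Finset (Fin d)) (hS : ↑S ⊆ K) :
    IsNonsingularOn (K \ S) (P ∩ {x | ∀ j ∈ S, x j = 0}) := by
  classical
  induction S using Finset.induction_on with
  | empty => simpa using h
  | insert a S ha ih =>
    rw [Finset.coe_insert, Set.insert_subset_iff] at hS
    have h1 := (ih hS.2).inter_coord (i := a) ⟨hS.1, ha⟩
    convert h1 using 1
    · rw [Finset.coe_insert, Set.sdiff_sdiff, Set.union_singleton]
    · rw [Set.inter_assoc]
      congr 1
      ext x
      simp [and_comm]

theorem vertex_mul_le (h : IsNonsingularOn K P) {v p : E d} (hv : IsExposed ℝ P {v}) (hp : p ∈ P)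
    {k : Fin d} (hvk : v k ≠ 0) : v k * p k ≤ v k * v k := by
  have hk : k ∈ K := by
    by_contra hk
    exact hvk (h.apply_eq_zero (hv.subset rfl) hk)
  obtain ⟨n, ι, rfl, hP, hN⟩ := h
  obtain ⟨c, rfl⟩ := hk
  cases n with
  | zero => exact c.elim0
  | succ n => exact hN.vertex_mul_le hP hv hp hvk

/-- Each face through a vertex has a supporting functional that shares at most one coordinate
with the vertex. -/
theorem exists_support (h : IsNonsingularOn K P) {v : E d} {M : Set (E d)}
    (hv : IsExposed ℝ P {v}) (hM : IsExposed ℝ P M) (hMP : M ≠ P) (hvM : v ∈ M) :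
    ∃ (l : StrongDual ℝ (E d)) (m : ℝ), 0 < m ∧ (∀ x ∈ M, l x = m) ∧
      ∀ k k', v k ≠ 0 → l (e k) ≠ 0 → v k' ≠ 0 → l (e k') ≠ 0 → k = k' := by
  have hK : ∀ k, v k ≠ 0 → k ∈ K := fun k hk => by
    by_contra hkK
    exact hk (h.apply_eq_zero (hv.subset rfl) hkK)
  obtain ⟨n, ι, rfl, hP, hN⟩ := h
  cases n with
  | zero =>
    refine absurd (hM.subset.antisymm fun x hx => ?_) hMP
    have : ∀ y ∈ P, y = 0 := fun y hy => by
      ext j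
      exact hP.apply_eq_zero y hy j (by simp)
    rw [this x hx, ← this v (hv.subset rfl)]
    exact hvM
  | succ n =>
    obtain ⟨F, hF0, hFM⟩ := hP.exists_faceChain hv hM hMP hvM
    obtain ⟨l, m, hm, -, he⟩ := F.exists_support_pos hP
    refine ⟨l, m, hm, fun x hx => ?_, fun k k' hk hlk hk' hlk' => ?_⟩
    · have := hFM hx
      rw [he] at this
      exact this.2
    · obtain ⟨c, rfl⟩ := hK k hk
      obtain ⟨c', rfl⟩ := hK k' hk'
      rw [hN.eq_of_ne_zero hP F (hF0 ▸ rfl) he hlk hk hlk' hk']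

/-- In dimension two, an edge through a vertex `v` is not high in a direction where `v` vanishes. -/
theorem not_isHigh_of_pair {i j : Fin d} (hij : i ≠ j) (h : IsNonsingularOn {i, j} P) {v : E d}
    {M : Set (E d)} (hv : IsExposed ℝ P {v}) (hM : IsExposed ℝ P M) (hMP : M ≠ P) (hvM : v ∈ M)
    (hvj : v j = 0) : ¬ IsHigh j M := by
  intro hj
  obtain ⟨n, ι, hι, hP, hN⟩ := h
  have hn : n = 1 + 1 := by
    have := Set.ncard_pair hij
    rw [← hι, Set.ncard_eq_toFinset_card', Set.toFinset_range,
      Finset.card_image_of_injective _ hP.injective] at this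
    simpa using this
  subst hn
  obtain ⟨F, hF0, hFM⟩ := hP.exists_faceChain hv hM hMP hvM
  obtain ⟨c, rfl⟩ : j ∈ Set.range ι := hι ▸ by simp
  -- The column of `j` vanishes: the vertex is low and the edge is high in this direction.
  refine hN F (Matrix.det_eq_zero_of_column_eq_zero c fun m => ?_)
  rw [F.signMatrix_apply]
  induction m using Fin.lastCases with
  | last => exact faceSign_of_isHigh (hj.mono hFM)
  | cast m =>
    have : m.castSucc = (0 : Fin 2) := by
      rw [Subsingleton.elim (α := Fin 1) m 0]
      rfl
    rw [this, Fin.castSucc_zero, hF0]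
    refine faceSign_of_isLow fun x hx => ?_
    rw [Set.mem_singleton_iff.1 hx, hvj]

/-- Krein–Milman; there are finitely many vertices, so their convex hull is already closed. -/
theorem subset_convexHull (h : IsNonsingularOn K P) : P ⊆ convexHull ℝ {v | IsExposed ℝ P {v}} := by
  have hfin : {v | IsExposed ℝ P {v}}.Finite :=
    h.isPolyhedron.finite_isExposed.preimage Set.singleton_injective.injOn
  have hsub : P.extremePoints ℝ ⊆ {v | IsExposed ℝ P {v}} := fun v hv =>
    h.isPolyhedron.isExposed_of_isExtreme (isExtreme_singleton.2 hv) (convex_singleton v)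
  have h1 := closure_convexHull_extremePoints h.isCompact h.isPolyhedron.convex
  nth_rewrite 1 [← h1]
  exact closure_minimal (convexHull_mono hsub) (hfin.isClosed_convexHull ℝ)

theorem map_le_of_vertices (h : IsNonsingularOn K P) {l : StrongDual ℝ (E d)} {M : ℝ}
    (hl : ∀ v, IsExposed ℝ P {v} → l v ≤ M) {x : E d} (hx : x ∈ P) : l x ≤ M :=
  convexHull_min (t := {y | l y ≤ M}) hl (convex_halfSpace_le l.toLinearMap.isLinear M)
    (h.subset_convexHull hx)

end IsNonsingularOn

/-! ### Flags and chains of faces -/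

theorem mem_coordSubspace {J : Set (Fin d)} {x : E d} :
    x ∈ coordSubspace J ↔ ∀ k, k ∉ J → x k = 0 := by
  constructor
  · intro hx k hk
    induction hx using Submodule.span_induction with
    | mem y hy =>
      obtain ⟨j, hj, rfl⟩ := hy
      exact e_apply_of_ne fun h => hk (h ▸ hj)
    | zero => rfl
    | add y z _ _ hy hz => simp [hy, hz]
    | smul a y _ hy => simp [hy]
  · intro h
    rw [eq_sum_smul_e x]
    refine Submodule.sum_mem _ fun k _ => ?_
    by_cases hk : k ∈ J
    · exact Submodule.smul_mem _ _ (Submodule.subset_span ⟨k, hk, rfl⟩)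
    · rw [h k hk, zero_smul]
      exact Submodule.zero_mem _

theorem inner_e (x : E d) (k : Fin d) : ⟪x, e k⟫ = x k := by
  simp [e, EuclideanSpace.inner_single_right]

theorem starProjection_compl_singleton (k : Fin d) (x : E d) :
    (coordSubspace {k}ᶜ).starProjection x = coordProj k x := by
  refine Submodule.eq_starProjection_of_mem_of_inner_eq_zero (K := coordSubspace {k}ᶜ) ?_ ?_
  · rw [mem_coordSubspace]
    intro j hj
    rw [Set.notMem_compl_iff, Set.mem_singleton_iff] at hj
    rw [hj, coordProj_apply_self]
  · intro w hw
    rw [mem_coordSubspace] at hw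
    rw [coordProj, sub_sub_cancel, inner_smul_left, real_inner_comm, inner_e, hw k (by simp),
      mul_zero]

theorem IsNormalized.abs_apply_le {P : Set (E d)} (h : IsNormalized P) {x : E d} (hx : x ∈ P)
    (k : Fin d) : |x k| ≤ 1 := by
  have h1 := (h k).1.2 ⟨x, hx, rfl⟩
  have h2 := (h k).2.2 ⟨x, hx, rfl⟩
  simp only [inner_neg_right, inner_e] at h1 h2
  exact abs_le.2 ⟨by linarith, h1⟩

theorem isLAB_id {P : Set (E d)} (hP : IsPolytope P) (hlab : IsLocallyAntiBlocking P)
    (hnorm : IsNormalized P) : IsLAB (id : Fin d → Fin d) P where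
  injective := Function.injective_id
  isCompact := hP.isCompact
  isPolyhedron := hP.isPolyhedron
  nonempty := hP.nonempty
  apply_eq_zero x _ j hj := absurd ⟨j, rfl⟩ hj
  coordProj_mem x hx j := by
    have := (hlab {j}ᶜ).subset (Set.mem_image_of_mem _ hx)
    rw [starProjection_compl_singleton] at this
    exact this.1
  exists_pos k := by
    obtain ⟨x, hx, h⟩ := (hnorm k).1.1
    simp only [inner_e] at h
    exact ⟨x, hx, by simp [h]⟩
  exists_neg k := by
    obtain ⟨x, hx, h⟩ := (hnorm k).2.1
    simp only [inner_neg_right, inner_e] at h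
    exact ⟨x, hx, by simp only [id]; linarith⟩

theorem dim_of_nonempty {F : Set (E d)} (h : F.Nonempty) : dim F = affDim F := by
  rw [dim, if_neg h.ne_empty, affDim]

/-- A chain becomes a flag when the empty face is added at index -1; distinct chains give distinct
flags. -/
theorem card_faceChain_le {ι : Fin d → Fin d} {P : Set (E d)} (hP : IsLAB ι P)
    (hfin : (flags P).Finite) : Nat.card (FaceChain d P) ≤ (flags P).ncard := by
  have hdim : dim P = d := by rw [dim_of_nonempty hP.nonempty, hP.affDim_eq]
  have hlt : ∀ i : Set.Icc (-1 : ℤ) (dim P), (i : ℤ).toNat < d + 1 := fun i => by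
    have := i.2.2
    omega
  let f : FaceChain d P → flags P := fun F =>
    ⟨fun i => if (i : ℤ) = -1 then ∅ else F.face ⟨(i : ℤ).toNat, hlt i⟩, by
      refine ⟨fun i => ?_, fun i j hij => ?_⟩
      · have := i.2.1
        by_cases hi : (i : ℤ) = -1
        · simp only [hi, if_true]
          exact ⟨isExposed_empty, by simp [dim]⟩
        · simp only [hi, if_false]
          refine ⟨F.exposed _, ?_⟩
          rw [dim_of_nonempty (F.nonempty _), F.affDim_face hP]
          simp only
          omega
      · have hij' : (i : ℤ) < j := hij
        have := i.2.1
        have hj : (j : ℤ) ≠ -1 := by omega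
        by_cases hi : (i : ℤ) = -1
        · simp only [hi, hj, if_true, if_false]
          exact Set.empty_ssubset.2 (F.nonempty _)
        · simp only [hi, hj, if_false]
          exact F.strictMono (Fin.mk_lt_mk.2 (by omega))⟩
  have := hfin.to_subtype
  refine Nat.card_le_card_of_injective f fun F G h => ?_
  ext1
  funext j
  have h1 := congrFun (congrArg Subtype.val h) ⟨(j : ℤ), by omega, by have := j.is_le; omega⟩
  have h2 : ((j : ℕ) : ℤ) ≠ -1 := by omega
  simpa [f, h2] using h1

theorem isNonsingularOn_univ {P : Set (E d)} (hP : IsPolytope P) (hlab : IsLocallyAntiBlocking P)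
    (hnorm : IsNormalized P) (hflag : IsFlagMinimizing P) : IsNonsingularOn Set.univ P := by
  have hL := isLAB_id hP hlab hnorm
  refine ⟨d, id, Set.range_id, hL, fun F => hL.det_ne_zero ?_ F⟩
  rw [← hflag]
  -- `Set.ncard` is 0 on infinite sets, so the prescribed positive number of flags implies
  -- finiteness.
  refine card_faceChain_le hL (Set.finite_of_ncard_ne_zero ?_)
  rw [hflag]
  positivity

/-! ### Normalized nonsingular polytopes -/

/-- A nonsingular polytope in the cube `[-1, 1]^d` that contains all vectors `± e_k`. -/
structure IsUnitNonsingular (P : Set (E d)) : Prop where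
  nonsingularOn : IsNonsingularOn Set.univ P
  abs_apply_le : ∀ x ∈ P, ∀ k, |x k| ≤ 1
  smul_e_mem : ∀ k, ∀ r : ℝ, r = 1 ∨ r = -1 → r • e k ∈ P

theorem isUnitNonsingular {P : Set (E d)} (hP : IsPolytope P) (hlab : IsLocallyAntiBlocking P)
    (hnorm : IsNormalized P) (hflag : IsFlagMinimizing P) : IsUnitNonsingular P where
  nonsingularOn := isNonsingularOn_univ hP hlab hnorm hflag
  abs_apply_le _ hx := hnorm.abs_apply_le hx
  smul_e_mem k r hr := by
    have hL := isLAB_id hP hlab hnorm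
    rcases hr with rfl | rfl
    · obtain ⟨x, hx, h⟩ := (hnorm k).1.1
      simp only [inner_e] at h
      rw [← h]
      exact hL.smul_e_mem hx k
    · obtain ⟨x, hx, h⟩ := (hnorm k).2.1
      simp only [inner_neg_right, inner_e] at h
      have : x k = -1 := by linarith
      rw [← this]
      exact hL.smul_e_mem hx k

/-- The section of `P` by the coordinate subspace with coordinates in `K`. -/
def coordSection (P : Set (E d)) (K : Finset (Fin d)) : Set (E d) :=
  P ∩ {x | ∀ j, j ∉ K → x j = 0}

variable {P : Set (E d)}

theorem coordSection_univ : coordSection P Finset.univ = P := by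
  simp [coordSection]

theorem mem_coordSection_pair {i j : Fin d} (hij : i ≠ j) {x : E d} :
    x ∈ coordSection P {i, j} ↔ x ∈ P ∧ x = x i • e i + x j • e j := by
  constructor
  · rintro ⟨hx, h0⟩
    refine ⟨hx, ?_⟩
    ext k
    by_cases hi : k = i
    · subst hi
      simp [e_apply, hij]
    by_cases hj : k = j
    · subst hj
      simp [e_apply, hi]
    · rw [h0 k (by simp [hi, hj])]
      simp [e_apply, hi, hj]
  · rintro ⟨hx, h0⟩
    refine ⟨hx, fun k hk => ?_⟩
    simp only [Finset.mem_insert, Finset.mem_singleton, not_or] at hk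
    rw [h0]
    simp [e_apply, hk.1, hk.2]

namespace IsUnitNonsingular

theorem convex (hP : IsUnitNonsingular P) : Convex ℝ P := hP.nonsingularOn.isPolyhedron.convex

theorem coordSection_nonsingularOn (hP : IsUnitNonsingular P) (K : Finset (Fin d)) :
    IsNonsingularOn (K : Set (Fin d)) (coordSection P K) := by
  classical
  have := hP.nonsingularOn.inter_coords Kᶜ (Set.subset_univ _)
  convert this using 1
  · ext j
    simp
  · rw [coordSection]
    congr 1
    ext x
    simp

theorem smul_e_mem_coordSection (hP : IsUnitNonsingular P) {K : Finset (Fin d)} {k : Fin d} (hk : k ∈ K) {r : ℝ}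
    (hr : r = 1 ∨ r = -1) : r • e k ∈ coordSection P K := by
  refine ⟨hP.smul_e_mem k r hr, fun j hj => ?_⟩
  rw [PiLp.smul_apply, e_apply_of_ne (ne_of_mem_of_not_mem hk hj).symm, smul_zero]

/-- A non-zero coordinate of a vertex is extremal in its direction, and the section contains `e k`
and `-e k` but does not leave the cube. -/
theorem vertex_apply (hP : IsUnitNonsingular P) {K : Finset (Fin d)} {v : E d} (hv : IsExposed ℝ (coordSection P K) {v})
    (k : Fin d) : v k = 0 ∨ v k = 1 ∨ v k = -1 := by
  by_cases h0 : v k = 0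
  · exact Or.inl h0
  refine Or.inr ?_
  have hvP := hv.subset (Set.mem_singleton v)
  have hk : k ∈ K := by
    by_contra hk
    exact h0 (hvP.2 k hk)
  have hN := hP.coordSection_nonsingularOn K
  have h1 := hN.vertex_mul_le hv (hP.smul_e_mem_coordSection hk (Or.inl rfl)) h0
  have h2 := hN.vertex_mul_le hv (hP.smul_e_mem_coordSection hk (Or.inr rfl)) h0
  have h3 := abs_le.1 (hP.abs_apply_le v hvP.1 k)
  simp only [PiLp.smul_apply, e_apply_self, smul_eq_mul, mul_one, mul_neg] at h1 h2
  rcases lt_or_gt_of_ne h0 with h | h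
  · right
    nlinarith
  · left
    nlinarith

/-! ### Two-dimensional sections -/

/-- If the other corner is missing, `α • e i` is a vertex of the plane section. The edge `x i = α`
joins it to the given corner, so it is high in `j`, although the vertex vanishes there; this
contradicts `not_isHigh_of_pair`. -/
theorem corner_neg (hP : IsUnitNonsingular P) {i j : Fin d} (hij : i ≠ j) {α β : ℝ} (hα : α = 1 ∨ α = -1)
    (hβ : β = 1 ∨ β = -1) (h : α • e i + β • e j ∈ P) : α • e i - β • e j ∈ P := by
  by_contra hno
  have hN := hP.coordSection_nonsingularOn {i, j}
  have hαα : α * α = 1 := by rcases hα with rfl | rfl <;> norm_num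
  have hββ : β * β = 1 := by rcases hβ with rfl | rfl <;> norm_num
  have hQ : ∀ x ∈ coordSection P {i, j}, α * x i ≤ 1 := fun x hx => by
    have h1 := hP.abs_apply_le x hx.1 i
    have h2 : |α| = 1 := by rcases hα with rfl | rfl <;> norm_num
    have h3 := le_abs_self (α * x i)
    rw [abs_mul, h2, one_mul] at h3
    linarith
  have hle : ∀ x ∈ coordSection P {i, j}, α * x i - β * x j ≤ 1 := by
    intro x hx
    let l : StrongDual ℝ (E d) := α • EuclideanSpace.proj i - β • EuclideanSpace.proj j
    have hl : ∀ y : E d, l y = α * y i - β * y j := fun y => rfl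
    rw [← hl]
    refine hN.map_le_of_vertices (fun v hv => ?_) hx
    rw [hl]
    by_contra hlt
    push Not at hlt
    apply hno
    have hvQ := hv.subset (Set.mem_singleton v)
    rw [mem_coordSection_pair hij] at hvQ
    have h1 : v i = α ∧ v j = -β := by
      rcases hP.vertex_apply hv i with h1 | h1 | h1 <;>
      rcases hP.vertex_apply hv j with h2 | h2 | h2 <;>
      rcases hα with rfl | rfl <;> rcases hβ with rfl | rfl <;>
      rw [h1, h2] at hlt ⊢ <;> first | (exfalso; linarith) | norm_num
    have h2 := hvQ.2
    rw [h1.1, h1.2, neg_smul, ← sub_eq_add_neg] at h2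
    rw [← h2]
    exact hvQ.1
  let l : StrongDual ℝ (E d) := α • EuclideanSpace.proj i
  have hl : ∀ y : E d, l y = α * y i := fun y => rfl
  have hM : IsExposed ℝ (coordSection P {i, j}) {x ∈ coordSection P {i, j} | l x = 1} :=
    isExposed_of_support l hQ
  have hαe : α • e i ∈ coordSection P {i, j} := hP.smul_e_mem_coordSection (by simp) hα
  have hji : j ≠ i := hij.symm
  have hv : IsExposed ℝ (coordSection P {i, j}) {α • e i} := by
    -- The sum of the two valid inequalities `hQ` and `hle` is tight only at `α • e i`.
    let l' : StrongDual ℝ (E d) := l + (l - β • EuclideanSpace.proj j)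
    have hl' : ∀ y : E d, l' y = α * y i + (α * y i - β * y j) := fun y => rfl
    have h1 := isExposed_of_support (P := coordSection P {i, j}) (M := 2) l' fun x hx => by
      linarith [hl' x, hQ x hx, hle x hx]
    convert h1 using 1
    ext x
    rw [Set.mem_singleton_iff]
    constructor
    · rintro rfl
      refine ⟨hαe, ?_⟩
      rw [hl']
      simp [e_apply, hji, hαα]
      norm_num
    · rintro ⟨hx, hx2⟩
      have h2 := hQ x hx
      have h3 := hle x hx
      rw [hl'] at hx2
      have h4 : α * x i = 1 := by linarith
      have h5 : β * x j = 0 := by linarith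
      have h6 : x i = α := by
        calc x i = α * (α * x i) := by rw [← mul_assoc, hαα, one_mul]
          _ = α := by rw [h4, mul_one]
      have h7 : x j = 0 := by
        calc x j = β * (β * x j) := by rw [← mul_assoc, hββ, one_mul]
          _ = 0 := by rw [h5, mul_zero]
      rw [((mem_coordSection_pair hij).1 hx).2, h6, h7, zero_smul, add_zero]
  rw [Finset.coe_pair] at hN
  refine hN.not_isHigh_of_pair hij hv hM (fun h => ?_) ⟨hαe, ?_⟩ ?_ ?_
  · have h0 := hN.zero_mem
    rw [← h] at h0
    simpa using h0.2
  · rw [hl]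
    simp [e_apply_self, hαα]
  · simp [e_apply_of_ne hji]
  · refine ⟨α • e i + β • e j, ⟨?_, ?_⟩, ?_, ?_, ?_⟩
    · rw [mem_coordSection_pair hij]
      refine ⟨h, ?_⟩
      simp [e_apply, hij, hji]
    · rw [hl]
      simp [e_apply, hij, hαα]
    · rcases hβ with rfl | rfl <;> simp [e_apply, hji]
    · have : coordProj j (α • e i + β • e j) = α • e i := by
        rw [coordProj_add_smul_e]
        simp [e_apply, hji]
      rw [this]
      exact hαe
    · have : coordProj j (α • e i + β • e j) = α • e i := by
        rw [coordProj_add_smul_e]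
        simp [e_apply, hji]
      rw [this, hl]
      simp [e_apply_self, hαα]

end IsUnitNonsingular

theorem inter_coordSubspace (K : Finset (Fin d)) :
    P ∩ (coordSubspace (K : Set (Fin d)) : Set (E d)) = coordSection P K := by
  ext x
  simp [coordSection, mem_coordSubspace]

theorem _root_.Convex.add_smul_mem_of_abs_le {a b : E d} (hP : Convex ℝ P) (h1 : a + b ∈ P)
    (h2 : a - b ∈ P) {r : ℝ} (hr : |r| ≤ 1) : a + r • b ∈ P := by
  have hr' := abs_le.1 hr
  have := hP h1 h2 (a := (1 + r) / 2) (b := (1 - r) / 2) (by linarith) (by linarith) (by ring)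
  convert this using 1
  module

namespace IsUnitNonsingular

theorem corner_mem (hP : IsUnitNonsingular P) {i j : Fin d} (hij : i ≠ j)
    (h : IsAxisAligned P i j) {α β : ℝ} (hα : α = 1 ∨ α = -1) (hβ : β = 1 ∨ β = -1) :
    α • e i + β • e j ∈ P := by
  obtain ⟨a₁, b₁, a₂, b₂, -, -, -, -, h⟩ := h
  have hpair : ((({i, j} : Finset (Fin d)) : Set (Fin d))) = {i, j} := Finset.coe_pair
  rw [← hpair, inter_coordSubspace] at h
  have h1 : α ∈ Set.Icc a₁ b₁ := by
    have := hP.smul_e_mem_coordSection (K := {i, j}) (k := i) (by simp) hα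
    rw [h] at this
    obtain ⟨s, hs, t, -, hst⟩ := this
    have h2 := congrArg (fun x : E d => x i) hst
    simp [e_apply, hij] at h2
    rwa [h2]
  have h2 : β ∈ Set.Icc a₂ b₂ := by
    have := hP.smul_e_mem_coordSection (K := {i, j}) (k := j) (by simp) hβ
    rw [h] at this
    obtain ⟨s, -, t, ht, hst⟩ := this
    have h2 := congrArg (fun x : E d => x j) hst
    simp [e_apply, hij.symm] at h2
    rwa [h2]
  have : α • e i + β • e j ∈ coordSection P {i, j} := by
    rw [h]
    exact ⟨α, h1, β, h2, rfl⟩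
  exact this.1

/-- `corner_neg` in both coordinates leads from one corner to all four, and their convex hull fills
the square. -/
theorem isAxisAligned_of_corner (hP : IsUnitNonsingular P) {i j : Fin d} (hij : i ≠ j) {α β : ℝ}
    (hα : α = 1 ∨ α = -1) (hβ : β = 1 ∨ β = -1) (h : α • e i + β • e j ∈ P) :
    IsAxisAligned P i j := by
  have h2 : α • e i - β • e j ∈ P := hP.corner_neg hij hα hβ h
  have hα' : -α = 1 ∨ -α = -1 := by rcases hα with rfl | rfl <;> norm_num
  have hβ' : -β = 1 ∨ -β = -1 := by rcases hβ with rfl | rfl <;> norm_num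
  have h3 : β • e j - α • e i ∈ P := hP.corner_neg hij.symm hβ hα (by rwa [add_comm])
  have h4 : (-β) • e j - α • e i ∈ P :=
    hP.corner_neg hij.symm hβ' hα (by rwa [neg_smul, neg_add_eq_sub])
  have hall : ∀ {α' β' : ℝ}, α' = 1 ∨ α' = -1 → β' = 1 ∨ β' = -1 → α' • e i + β' • e j ∈ P := by
    intro α' β' h5 h6
    have h7 : α' = α ∨ α' = -α := by
      rcases hα with rfl | rfl <;> rcases h5 with rfl | rfl <;> norm_num
    have h8 : β' = β ∨ β' = -β := by
      rcases hβ with rfl | rfl <;> rcases h6 with rfl | rfl <;> norm_num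
    rcases h7 with rfl | rfl <;> rcases h8 with rfl | rfl
    · exact h
    · rwa [neg_smul, ← sub_eq_add_neg]
    · rwa [neg_smul, neg_add_eq_sub]
    · convert h4 using 1
      module
  refine ⟨-1, 1, -1, 1, by norm_num, by norm_num, by norm_num, by norm_num, ?_⟩
  rw [← Finset.coe_pair, inter_coordSubspace]
  ext x
  rw [mem_coordSection_pair hij]
  constructor
  · rintro ⟨hx, hxe⟩
    exact ⟨x i, abs_le.1 (hP.abs_apply_le x hx i), x j, abs_le.1 (hP.abs_apply_le x hx j), hxe⟩
  · rintro ⟨s, hs, t, ht, rfl⟩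
    have hst : ∀ {γ : ℝ}, γ = 1 ∨ γ = -1 → γ • e i + t • e j ∈ P := fun hγ =>
      hP.convex.add_smul_mem_of_abs_le (by simpa using hall hγ (Or.inl rfl))
        (by simpa [sub_eq_add_neg] using hall hγ (Or.inr rfl)) (abs_le.2 ht)
    refine ⟨?_, by simp [e_apply, hij, hij.symm]⟩
    rw [add_comm]
    refine hP.convex.add_smul_mem_of_abs_le ?_ ?_ (abs_le.2 hs)
    · simpa [add_comm] using hst (Or.inl rfl)
    · simpa [sub_eq_add_neg, add_comm] using hst (Or.inr rfl)

theorem isDiamond_of_no_corner (hP : IsUnitNonsingular P) {i j : Fin d} (hij : i ≠ j)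
    (h : ∀ α β : ℝ, α = 1 ∨ α = -1 → β = 1 ∨ β = -1 → α • e i + β • e j ∉ P) :
    IsDiamond P i j := by
  refine ⟨-1, 1, -1, 1, by norm_num, by norm_num, by norm_num, by norm_num, ?_⟩
  rw [← Finset.coe_pair, inter_coordSubspace]
  have hN := hP.coordSection_nonsingularOn {i, j}
  have hsegment : ∀ k ∈ ({i, j} : Finset (Fin d)), ∀ s ∈ Set.Icc (-1 : ℝ) 1,
      s • e k ∈ coordSection P {i, j} := by
    intro k hk s hs
    have := hN.isPolyhedron.convex.add_smul_mem_of_abs_le (a := 0) (b := e k)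
      (by simpa using hP.smul_e_mem_coordSection hk (Or.inl rfl))
      (by simpa using hP.smul_e_mem_coordSection hk (Or.inr rfl)) (abs_le.2 hs)
    simpa using this
  refine Set.Subset.antisymm ?_ (convexHull_min ?_ hN.isPolyhedron.convex)
  · refine hN.subset_convexHull.trans (convexHull_mono fun v hv => ?_)
    have hvP := (mem_coordSection_pair hij).1 (hv.subset (Set.mem_singleton v))
    have h1 := hP.vertex_apply hv i
    have h2 := hP.vertex_apply hv j
    by_cases hi : v i = 0
    · refine Or.inr ⟨v j, abs_le.1 (hP.abs_apply_le v hvP.1 j), ?_⟩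
      rw [hvP.2, hi]
      simp [e_apply]
    by_cases hj : v j = 0
    · refine Or.inl ⟨v i, abs_le.1 (hP.abs_apply_le v hvP.1 i), ?_⟩
      rw [hvP.2, hj]
      simp [e_apply]
    refine absurd hvP.1 ?_
    rw [hvP.2]
    exact h _ _ (h1.resolve_left hi) (h2.resolve_left hj)
  · rintro _ (⟨s, hs, rfl⟩ | ⟨t, ht, rfl⟩)
    · exact hsegment i (by simp) s hs
    · exact hsegment j (by simp) t ht

theorem hasGraph (hP : IsUnitNonsingular P) : HasGraph P := by
  intro i j hij
  by_cases h : ∃ α β : ℝ, (α = 1 ∨ α = -1) ∧ (β = 1 ∨ β = -1) ∧ α • e i + β • e j ∈ P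
  · obtain ⟨α, β, hα, hβ, h⟩ := h
    exact Or.inl (hP.isAxisAligned_of_corner hij hα hβ h)
  · right
    push Not at h
    exact hP.isDiamond_of_no_corner hij h

/-! ### Cliques -/

/-- Induction on the clique; up to size two this is normalization and the definition of an edge.
Otherwise, if `w` were missing, its projections `coordProj a w` would be vertices on one proper
face. A functional constant on that face has the same non-zero value of `w a * f (e a)` for all `a`
in `K`, so it shares at least two coordinates with such a vertex. -/
theorem mem_of_isClique (hP : IsUnitNonsingular P) {K : Finset (Fin d)}
    (hK : (graph P).IsClique K) {w : E d} (hw : ∀ k ∈ K, w k = 1 ∨ w k = -1)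
    (hw0 : ∀ k, k ∉ K → w k = 0) : w ∈ P := by
  classical
  induction K using Finset.strongInduction generalizing w with
  | H K ih =>
    have hsum : w = ∑ k ∈ K, w k • e k := by
      conv_lhs => rw [eq_sum_smul_e w]
      refine (Finset.sum_subset (Finset.subset_univ K) fun k _ hk => ?_).symm
      rw [hw0 k hk, zero_smul]
    have hww : ∀ k ∈ K, w k * w k = 1 := fun k hk => by
      rcases hw k hk with h | h <;> rw [h] <;> norm_num
    have hproj : ∀ i ∈ K, coordProj i w ∈ coordSection P K := by
      intro i hi
      refine ⟨ih (K.erase i) (Finset.erase_ssubset hi)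
        (hK.subset (by simp)) (fun k hk => ?_)
        fun k hk => ?_, fun k hk => ?_⟩
      · rw [coordProj_apply_of_ne (Finset.ne_of_mem_erase hk)]
        exact hw k (Finset.mem_of_mem_erase hk)
      · rcases eq_or_ne k i with rfl | hki
        · exact coordProj_apply_self _ _
        · rw [coordProj_apply_of_ne hki]
          exact hw0 k fun h => hk (Finset.mem_erase.2 ⟨hki, h⟩)
      · rw [coordProj_apply_of_ne (ne_of_mem_of_not_mem hi hk).symm]
        exact hw0 k hk
    rcases Nat.lt_or_ge K.card 3 with hcard | hcard
    · interval_cases hc : K.card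
      · rw [Finset.card_eq_zero] at hc
        rw [hsum, hc, Finset.sum_empty]
        exact hP.nonsingularOn.zero_mem
      · obtain ⟨i, rfl⟩ := Finset.card_eq_one.1 hc
        rw [hsum, Finset.sum_singleton]
        exact hP.smul_e_mem i _ (hw i (by simp))
      · obtain ⟨i, j, hij, rfl⟩ := Finset.card_eq_two.1 hc
        rw [hsum, Finset.sum_pair hij]
        have hadj : (graph P).Adj i j := hK (by simp) (by simp) hij
        exact hP.corner_mem hij hadj.2 (hw i (by simp)) (hw j (by simp))
    by_contra hwP
    have hN := hP.coordSection_nonsingularOn K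
    let l : StrongDual ℝ (E d) := ∑ k ∈ K, w k • EuclideanSpace.proj k
    have hl : ∀ x : E d, l x = ∑ k ∈ K, w k * x k := fun x => by simp [l]
    have hterm : ∀ x ∈ P, ∀ k ∈ K, w k * x k ≤ 1 := by
      intro x hx k hk
      have h1 := hP.abs_apply_le x hx k
      have h2 := le_abs_self (w k * x k)
      have h3 : |w k| = 1 := by rcases hw k hk with h | h <;> rw [h] <;> norm_num
      rw [abs_mul, h3, one_mul] at h2
      linarith
    -- A vertex differs from `w` in some coordinate, and since its coordinates are 0, 1 or -1, that
    -- coordinate contributes at most 0.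
    have hle : ∀ x ∈ coordSection P K, l x ≤ K.card - 1 := by
      intro x hx
      refine hN.map_le_of_vertices (fun v hv => ?_) hx
      have hvQ := hv.subset (Set.mem_singleton v)
      obtain ⟨i, hi, hvi⟩ : ∃ i ∈ K, v i ≠ w i := by
        by_contra hno
        push Not at hno
        apply hwP
        have : v = w := by
          ext k
          by_cases hk : k ∈ K
          · exact hno k hk
          · rw [hw0 k hk, hvQ.2 k hk]
        exact this ▸ hvQ.1
      have h0 : w i * v i ≤ 0 := by
        rcases hw i hi with h1 | h1 <;> rcases hP.vertex_apply hv i with h2 | h2 | h2 <;>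
          rw [h1, h2] at hvi ⊢ <;> first | exact absurd rfl hvi | norm_num
      rw [hl, ← Finset.add_sum_erase _ _ hi]
      have h1 := Finset.sum_le_card_nsmul (K.erase i) (fun k => w k * v k) 1 fun k hk =>
        hterm v hvQ.1 k (Finset.mem_of_mem_erase hk)
      rw [Finset.card_erase_of_mem hi, nsmul_eq_mul, mul_one, Nat.cast_sub (by omega)] at h1
      push_cast at h1
      linarith
    have hlproj : ∀ i ∈ K, l (coordProj i w) = K.card - 1 := by
      intro i hi
      rw [hl, ← Finset.add_sum_erase _ _ hi, coordProj_apply_self, mul_zero, zero_add]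
      rw [Finset.sum_congr rfl (g := fun _ => (1 : ℝ)) fun k hk => by
        rw [coordProj_apply_of_ne (Finset.ne_of_mem_erase hk),
          hww k (Finset.mem_of_mem_erase hk)]]
      rw [Finset.sum_const, Finset.card_erase_of_mem hi, nsmul_eq_mul, mul_one,
        Nat.cast_sub (by omega), Nat.cast_one]
    obtain ⟨i, j, k, hi, hj, hk, hij, hik, hjk⟩ := Finset.two_lt_card_iff.1 hcard
    have hz : IsExposed ℝ (coordSection P K) {coordProj i w} := by
      have hrest : ∀ x ∈ coordSection P K, ∑ k ∈ K.erase i, w k * x k ≤ K.card - 1 := fun x hx => by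
        have h1 := Finset.sum_le_card_nsmul (K.erase i) (fun k => w k * x k) 1 fun k hk =>
          hterm x hx.1 k (Finset.mem_of_mem_erase hk)
        rwa [Finset.card_erase_of_mem hi, nsmul_eq_mul, mul_one, Nat.cast_sub (by omega),
          Nat.cast_one] at h1
      have hsplit : ∀ x : E d, l x = w i * x i + ∑ k ∈ K.erase i, w k * x k := fun x => by
        rw [hl, ← Finset.add_sum_erase _ _ hi]
      -- `g` is `l` plus the part of `l` outside coordinate `i`; both summands are at most `K.card -
      -- 1`, and both are tight only at `coordProj i w`.
      let g : StrongDual ℝ (E d) := (2 : ℝ) • l - w i • EuclideanSpace.proj i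
      have hg : ∀ x : E d, g x = 2 * l x - w i * x i := fun x => rfl
      have h1 := isExposed_of_support (P := coordSection P K) (M := 2 * (K.card - 1)) g
        fun x hx => by linarith [hg x, hle x hx, hsplit x, hrest x hx]
      convert h1 using 1
      ext x
      rw [Set.mem_singleton_iff]
      constructor
      · rintro rfl
        refine ⟨hproj i hi, ?_⟩
        rw [hg, hlproj i hi, coordProj_apply_self, mul_zero, sub_zero]
      · rintro ⟨hx, hxg⟩
        have h2 := hle x hx
        have h3 := hrest x hx
        have h4 := hsplit x
        rw [hg] at hxg
        have h5 : w i * x i = 0 := by linarith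
        have h6 : ∑ k ∈ K.erase i, w k * x k = ∑ k ∈ K.erase i, 1 := by
          rw [Finset.sum_const, Finset.card_erase_of_mem hi, nsmul_eq_mul, mul_one,
            Nat.cast_sub (by omega), Nat.cast_one]
          linarith
        rw [Finset.sum_eq_sum_iff_of_le fun k hk =>
          hterm x hx.1 k (Finset.mem_of_mem_erase hk)] at h6
        ext k
        by_cases hk : k ∈ K
        · rcases eq_or_ne k i with rfl | hki
          · rw [coordProj_apply_self]
            refine (mul_eq_zero.1 h5).resolve_left fun h => ?_
            have := hww k hk
            rw [h, mul_zero] at this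
            exact zero_ne_one this
          · rw [coordProj_apply_of_ne hki]
            calc x k = w k * (w k * x k) := by rw [← mul_assoc, hww k hk, one_mul]
              _ = w k := by rw [h6 k (Finset.mem_erase.2 ⟨hki, hk⟩), mul_one]
        · rw [hx.2 k hk, (hproj i hi).2 k hk]
    have hM := isExposed_of_support (P := coordSection P K) l hle
    obtain ⟨f, m, hm, hf, huniq⟩ := hN.exists_support hz hM (fun h => by
        have h0 := hN.zero_mem
        rw [← h] at h0
        have h1 := h0.2
        rw [map_zero] at h1
        have : (3 : ℝ) ≤ K.card := by exact_mod_cast hcard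
        linarith) ⟨hproj i hi, hlproj i hi⟩
    have hκ : ∀ a ∈ K, w a * f (e a) = f w - m := by
      intro a ha
      have := hf _ ⟨hproj a ha, hlproj a ha⟩
      rw [map_coordProj] at this
      linarith
    have hκ0 : f w - m ≠ 0 := by
      intro h0
      have h1 : f w = 0 := by
        conv_lhs => rw [hsum]
        rw [map_sum]
        refine Finset.sum_eq_zero fun a ha => ?_
        rw [map_smul, smul_eq_mul, hκ a ha, h0]
      linarith
    have hne : ∀ a ∈ K, w a ≠ 0 ∧ f (e a) ≠ 0 := fun a ha =>
      mul_ne_zero_iff.1 ((hκ a ha).symm ▸ hκ0)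
    refine hjk (huniq j k ?_ (hne j hj).2 ?_ (hne k hk).2)
    · rw [coordProj_apply_of_ne hij.symm]
      exact (hne j hj).1
    · rw [coordProj_apply_of_ne hik.symm]
      exact (hne k hk).1

end IsUnitNonsingular

/-! ### The clique hull -/

theorem oneVec_apply (s : Fin d → SignType) (k : Fin d) : oneVec s k = (s k : ℝ) := by
  simp [oneVec, e_apply]

theorem orthantCone_subset_coordSubspace {s : Fin d → SignType} {J : Set (Fin d)} :
    (orthantCone s : Set (E d)) ⊆ (coordSubspace J : Set (E d)) ↔ ∀ k, s k ≠ 0 → k ∈ J := by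
  have hcast : ∀ {t : SignType}, t ≠ 0 → (t : ℝ) ≠ 0 := by
    intro t ht
    cases t <;> simp at ht ⊢
  constructor
  · intro h k hk
    by_contra hkJ
    have h1 : (s k : ℝ) • e k ∈ coordSubspace J := h (PointedCone.subset_hull ⟨k, hk, rfl⟩)
    have h2 := mem_coordSubspace.1 h1 k hkJ
    rw [PiLp.smul_apply, e_apply_self, smul_eq_mul, mul_one] at h2
    exact hcast hk h2
  · intro h x hx
    refine Submodule.span_le.2 ?_ (PointedCone.hull_le_span (R := ℝ) _ hx)
    rintro _ ⟨k, hk, rfl⟩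
    exact Submodule.smul_mem _ _ (Submodule.subset_span ⟨k, h k hk, rfl⟩)

namespace IsUnitNonsingular

/-- The plane projections of a vertex to pairs of its support are corners in `P`, so the support is
a clique. The other inclusion is `mem_of_isClique`. -/
theorem eq_cliqueHull (hP : IsUnitNonsingular P) : P = cliqueHull (graph P) := by
  classical
  refine Set.Subset.antisymm ?_ (convexHull_min ?_ hP.convex)
  · refine hP.nonsingularOn.subset_convexHull.trans (convexHull_mono fun v hv => ?_)
    have hvP : v ∈ P := hv.subset (Set.mem_singleton v)
    have hv01 : ∀ k, v k = 0 ∨ v k = 1 ∨ v k = -1 := fun k =>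
      hP.vertex_apply (K := Finset.univ) (by rw [coordSection_univ]; exact hv) k
    refine ⟨fun k => SignType.sign (v k), ⟨{k | v k ≠ 0}, fun i hi j hj hij => ⟨hij, ?_⟩, ?_⟩, ?_⟩
    · refine hP.isAxisAligned_of_corner hij ((hv01 i).resolve_left hi) ((hv01 j).resolve_left hj) ?_
      rw [← Finset.sum_pair hij (f := fun k => v k • e k)]
      exact hP.nonsingularOn.sum_mem hvP _
    · rw [orthantCone_subset_coordSubspace]
      exact fun k hk h => hk (by simp [h])
    · ext k
      rw [oneVec_apply]
      rcases hv01 k with h | h | h <;> simp [h]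
  · rintro _ ⟨s, ⟨J, hJ, hs⟩, rfl⟩
    rw [orthantCone_subset_coordSubspace] at hs
    refine hP.mem_of_isClique (K := Finset.univ.filter fun k => s k ≠ 0)
      (hJ.subset fun k hk => hs k (by simpa using hk)) (fun k hk => ?_) fun k hk => ?_
    · rw [oneVec_apply]
      have : s k ≠ 0 := by simpa using hk
      cases h : s k <;> simp [h] at this ⊢
    · rw [oneVec_apply]
      have : s k = 0 := by simpa using hk
      simp [this]

end IsUnitNonsingular

end FlagPolytope

theorem mainTheorem5 (d : ℕ) (P : Set (FlagPolytope.E d))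
    (hP : FlagPolytope.IsPolytope P)
    (hlab : FlagPolytope.IsLocallyAntiBlocking P)
    (hnorm : FlagPolytope.IsNormalized P)
    (hflag : FlagPolytope.IsFlagMinimizing P) :
    FlagPolytope.HasGraph P ∧
    P = FlagPolytope.cliqueHull (FlagPolytope.graph P) ∧
    (∀ Q : Set (FlagPolytope.E d),
      FlagPolytope.IsPolytope Q → FlagPolytope.IsLocallyAntiBlocking Q →
      FlagPolytope.IsNormalized Q → FlagPolytope.IsFlagMinimizing Q →
      FlagPolytope.graph Q = FlagPolytope.graph P → Q = P) ∧
    (∀ v ∈ FlagPolytope.vertices P, ∀ i : Fin d, v i = 0 ∨ v i = 1 ∨ v i = -1) := by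
  have hU := FlagPolytope.isUnitNonsingular hP hlab hnorm hflag
  refine ⟨hU.hasGraph, hU.eq_cliqueHull, fun Q hQ hQlab hQnorm hQflag hG => ?_, fun v hv i => ?_⟩
  · rw [hU.eq_cliqueHull, ← hG]
    exact (FlagPolytope.isUnitNonsingular hQ hQlab hQnorm hQflag).eq_cliqueHull
  · refine hU.vertex_apply (K := Finset.univ) ?_ i
    rw [FlagPolytope.coordSection_univ]
    exact hv.1
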